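/- Fix an integer $k\ge 3$. A binary $k$-uniform Markov random field on $n$ nodes is given by an arbitrary real $k$-tensor $J=(J_{i_1\dots i_k})_{i_1,\dots,i_k\in[n]}$. Its partition function is $$Z=\sum_{x\in\{\pm1\}^n}\exp\Big(\sum_{i_1,\dots,i_k=1}^n J_{i_1\dots i_k}x_{i_1}\cdots x_{i_k}\Big),$$ and we write $\|\vec J\|_1=\sum|J_{i_1\dots i_k}|$ and $\|\vec J\|_\infty=\max|J_{i_1\dots i_k}|$. The field is called $\Delta$-dense if $\Delta\|\vec J\|_\infty\le\|\vec J\|_1/n^k$. The model of computation is a randomized real RAM: memory with indirect addressing holding natural numbers and real numbers; exact operations $+,-,\times$ and comparison on natural numbers and $+,-,\times,/$ and comparison on real numbers (no rounding, no transcendental functions, and only natural numbers as program constants); probing an entry of $J$ at given indices; and drawing a uniformly random element of $\{0,\dots,m\}$. Each such operation takes unit time. Then there are constants $C>0$ and $A\in\mathbb N$ and a randomized algorithm in this model, all depending only on $k$, such that the following holds for all $\epsilon>0$, $0<\delta<1$ and $0<\Delta\le1$, and for every $\Delta$-dense binary $k$-uniform Markov random field $J$ on $n\ge 2^{C/(\epsilon^2\Delta)}$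 nodes. Given $n,\epsilon,\delta,\Delta$ and probe access to the entries of $J$, the algorithm halts, whatever the outcomes of its random draws, within time $$2^{A\left(1+x\log^A(2+x)\right)}\,\bigl(1+\log(1/\delta)\bigr)\,n^k,\qquad x=\frac1{\epsilon^2\Delta},$$ that is, in time $2^{\tilde O(1/\epsilon^2\Delta)}\log(1/\delta)\,n^k$, and with probability at least $1-\delta$ it outputs a number $y$ with $|y-\log Z|\le\epsilon\,(\|\vec J\|_1+n)$. -/

import Mathlib

open scoped ENNReal

noncomputable section

/-! ### Binary `k`-uniform Markov random fields -/

/-- The interactions of a binary `k`-uniform Markov random field on `n` nodes: an arbitrary real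
`k`-tensor `J = (J_{i_1, …, i_k})`, the indices ranging over the `n` nodes. -/
abbrev Tensor (k n : ℕ) : Type := (Fin k → Fin n) → ℝ

namespace Tensor

variable {k n : ℕ}

/-- The `ℓ¹` norm of the vector of all `n ^ k` entries. -/
def l1Norm (J : Tensor k n) : ℝ := ∑ i, |J i|

/-- The maximal absolute value of an entry (`‖·‖` is the sup norm on a finite product). -/
def linftyNorm (J : Tensor k n) : ℝ := ‖J‖

/-- `Δ`-density: `Δ ‖J‖_∞ ≤ ‖J‖_1 / n ^ k`. -/
def IsDense (Δ : ℝ) (J : Tensor k n) : Prop :=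
  Δ * J.linftyNorm ≤ J.l1Norm / (n : ℝ) ^ k

/-- `J(x, …, x) = ∑ J_{i_1 … i_k} x_{i_1} ⋯ x_{i_k}` at a configuration `x` of `±1` spins. -/
def energy (J : Tensor k n) (x : Fin n → ℤˣ) : ℝ :=
  ∑ i : Fin k → Fin n, J i * ∏ j, ((x (i j) : ℤ) : ℝ)

/-- The partition function `Z = ∑_{x ∈ {±1}^n} exp (J(x, …, x))`. -/
def partitionFunction (J : Tensor k n) : ℝ := ∑ x : Fin n → ℤˣ, Real.exp (J.energy x)

end Tensor

/-! ### Randomized real RAM programs with oracle access to a tensor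

The memory consists of arrays of natural numbers and arrays of real numbers. The name of an array
is fixed in the program, the index of a cell is computed at run time (indirect addressing). The
arithmetic operations are `+, -, *` on natural numbers and `+, -, *, /` on real numbers, with
comparisons of both; there is no rounding of a real number to an integer, no logarithm or
exponential, and the only constants are natural numbers. An entry of the tensor can be probed at
given indices, and a uniformly random element of `{0, …, m}` can be drawn. -/

namespace RealRAM

/-- A memory state: `nat a i` and `real a i` are the contents of cell `i` of the array `a`. -/
structure State where
  nat : ℕ → ℕ → ℕ
  real : ℕ → ℕ → ℝ

namespace State

/-- Write `v` into cell `i` of the array `a` of natural numbers. -/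
def setNat (σ : State) (a i v : ℕ) : State :=
  { σ with nat := Function.update σ.nat a (Function.update (σ.nat a) i v) }

/-- Write `v` into cell `i` of the array `a` of real numbers. -/
def setReal (σ : State) (a i : ℕ) (v : ℝ) : State :=
  { σ with real := Function.update σ.real a (Function.update (σ.real a) i v) }

/-- The initial state: the natural number `n` and the real numbers `ε, δ, Δ` are given,
all other cells are `0`. -/
def init (n : ℕ) (ε δ Δ : ℝ) : State where
  nat a i := if a = 0 ∧ i = 0 then n else 0
  real a i :=
    if a = 0 ∧ i = 0 then ε else if a = 0 ∧ i = 1 then δ else if a = 0 ∧ i = 2 then Δ else 0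

/-- The output cell. -/
def output (σ : State) : ℝ := σ.real 0 0

end State

/-- Natural number expressions (subtraction is truncated). -/
inductive NExpr : Type
  | const (c : ℕ)
  | cell (a : ℕ) (i : NExpr)
  | add (e f : NExpr)
  | sub (e f : NExpr)
  | mul (e f : NExpr)

def NExpr.eval (σ : State) : NExpr → ℕ
  | const c => c
  | cell a i => σ.nat a (i.eval σ)
  | add e f => e.eval σ + f.eval σ
  | sub e f => e.eval σ - f.eval σ
  | mul e f => e.eval σ * f.eval σ

/-- Real expressions; `probe` reads the entry of the tensor at the given `k` indices. -/
inductive RExpr (k : ℕ) : Type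
  | ofNat (e : NExpr)
  | cell (a : ℕ) (i : NExpr)
  | probe (i : Fin k → NExpr)
  | add (e f : RExpr k)
  | sub (e f : RExpr k)
  | mul (e f : RExpr k)
  | div (e f : RExpr k)

/-- The entry of the tensor at the nodes with the numbers `i`, and `0` if one of these numbers is
not the number of a node (the nodes are numbered `0, …, n - 1`). -/
def probeValue {k n : ℕ} (J : Tensor k n) (i : Fin k → ℕ) : ℝ :=
  if h : ∀ j, i j < n then J (fun j => ⟨i j, h j⟩) else 0

def RExpr.eval {k n : ℕ} (J : Tensor k n) (σ : State) : RExpr k → ℝ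
  | ofNat e => (e.eval σ : ℝ)
  | cell a i => σ.real a (i.eval σ)
  | probe i => probeValue J (fun j => (i j).eval σ)
  | add e f => e.eval J σ + f.eval J σ
  | sub e f => e.eval J σ - f.eval J σ
  | mul e f => e.eval J σ * f.eval J σ
  | div e f => e.eval J σ / f.eval J σ

/-- Tests. -/
inductive BExpr (k : ℕ) : Type
  | natLt (e f : NExpr)
  | realLt (e f : RExpr k)
  | neg (b : BExpr k)
  | conj (b c : BExpr k)

def BExpr.eval {k n : ℕ} (J : Tensor k n) (σ : State) : BExpr k → Bool
  | natLt e f => decide (e.eval σ < f.eval σ)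
  | realLt e f => decide (e.eval J σ < f.eval J σ)
  | neg b => !(b.eval J σ)
  | conj b c => b.eval J σ && c.eval J σ

/-- Programs. `setNat a i e` and `setReal a i e` store the value of `e` in cell `i` of the array
`a`; `rand a i e` stores there a uniformly random element of `{0, …, m}`, where `m` is the value
of `e`, independent of all earlier draws. -/
inductive Prog (k : ℕ) : Type
  | skip
  | setNat (a : ℕ) (i : NExpr) (e : NExpr)
  | setReal (a : ℕ) (i : NExpr) (e : RExpr k)
  | rand (a : ℕ) (i : NExpr) (e : NExpr)
  | seq (p q : Prog k)
  | ite (b : BExpr k) (p q : Prog k)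
  | loop (b : BExpr k) (p : Prog k)

/-- A configuration: the list of what remains to be executed, and the memory. It is halted when
nothing remains. -/
abbrev Config (k : ℕ) : Type := List (Prog k) × State

/-- One step of the machine, as a probability distribution on the next configuration. Every
assignment, probe, random draw, test, and sequencing costs one step. (The size of the expressions
in a fixed program is bounded, so counting the single operations inside of the expressions would
change running times by at most a constant factor that depends only on the program.) -/
def step {k n : ℕ} (J : Tensor k n) : Config k → PMF (Config k)
  | ([], σ) => PMF.pure ([], σ)
  | (.skip :: K, σ) => PMF.pure (K, σ)
  | (.setNat a i e :: K, σ) => PMF.pure (K, σ.setNat a (i.eval σ) (e.eval σ))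
  | (.setReal a i e :: K, σ) => PMF.pure (K, σ.setReal a (i.eval σ) (e.eval J σ))
  | (.rand a i e :: K, σ) =>
      (PMF.uniformOfFintype (Fin (e.eval σ + 1))).map
        (fun v : Fin (e.eval σ + 1) => (K, σ.setNat a (i.eval σ) v.val))
  | (.seq p q :: K, σ) => PMF.pure (p :: q :: K, σ)
  | (.ite b p q :: K, σ) => PMF.pure (if b.eval J σ then p :: K else q :: K, σ)
  | (.loop b p :: K, σ) => PMF.pure (if b.eval J σ then p :: .loop b p :: K else K, σ)

/-- The distribution of the configuration after `t` steps. -/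
def stepN {k n : ℕ} (J : Tensor k n) : ℕ → Config k → PMF (Config k)
  | 0, c => PMF.pure c
  | t + 1, c => (step J c).bind (stepN J t)

/-- The distribution of the configuration after `t` steps of the program `P` on the tensor `J`
with parameters `ε, δ, Δ`. -/
def run {k n : ℕ} (P : Prog k) (J : Tensor k n) (ε δ Δ : ℝ) (t : ℕ) : PMF (Config k) :=
  stepN J t ([P], State.init n ε δ Δ)

/-- Whatever the outcomes of the random draws, the program has halted after at most `t` steps. -/
def HaltsWithin {k n : ℕ} (P : Prog k) (J : Tensor k n) (ε δ Δ : ℝ) (t : ℕ) : Prop :=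
  ∀ c ∈ (run P J ε δ Δ t).support, c.1 = []

/-- The probability that after `t` steps the program has halted with an output in `S`. -/
def outputProb {k n : ℕ} (P : Prog k) (J : Tensor k n) (ε δ Δ : ℝ) (t : ℕ) (S : Set ℝ) : ℝ≥0∞ :=
  (run P J ε δ Δ t).toOuterMeasure {c | c.1 = [] ∧ c.2.output ∈ S}

end RealRAM

/-- The bound `2 ^ Õ(x) * log (1 / δ) * n ^ k`, where `Õ(x)` stands for
`A * (1 + x * log (2 + x) ^ A)`, and `log (1 / δ)` for `1 + log (1 / δ)`. -/
def timeBound (A : ℕ) (x δ : ℝ) (n k : ℕ) : ℝ :=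
  (2 : ℝ) ^ ((A : ℝ) * (1 + x * Real.log (2 + x) ^ A)) * (1 + Real.log (1 / δ)) * (n : ℝ) ^ k

end

/-! By Gibbs' variational principle, log Z is the maximum of expected energy plus entropy over all
probability measures on configurations. For the product measure with means x this quantity is, up to
tuples with repeated indices, the mean-field free energy F(x) = J(x, …, x) + ∑ H(x_i). By density
the repeated indices cost at most 2k²‖J‖₁/(Δn), so no F(x) exceeds log Z by more than that
(`Tensor.meanEnergy_add_spinEntropy_le`). It remains to find an x with F(x) not much below log Z by
guessing only O(1/(ε²Δ)) bits.

The candidates are regularized best responses. Draw T of order k²/(ε²Δ) random k-tuples of nodes.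
Add up, with signs, the k rows of J through each of the first τ tuples to a field S on the nodes.
Let x_i maximize S_i y + (β + τ + 1) H(y) over [-1, 1].

To see that some signs are good, let a configuration X choose them, so that every signed row pairs
nonnegatively with X - x for the current response x. Telescoping the k slots of the multilinear form
shows that the average of these pairings dominates J(X) - J(x)
(`Tensor.abs_meanEnergy_sub_le_rowPair`). This drives a follow-the-regularized-leader argument: the
potential ∑ max_y (S_i y + (β + τ) H(y)) - ⟨S, X⟩ changes in a round, on average over the rows, by
at most F(x) - J(X) plus a second-order term that density controls
(`Tensor.optValue_adaptField_le`). The entropy of x enters because the weight of H grows by one per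
round.

If X is drawn from the Gibbs measure, the final potential divided by β + T is, up to n/L, the code
length of X under a product measure described by the rows and kT sign bits. Its mean is therefore at
least the Gibbs entropy minus kT, up to that error (`Tensor.gibbsEntropy_le`). Hence the average of
F over time, rows and X is at least E J(X) plus the Gibbs entropy, which is log Z, minus small
errors (`Tensor.le_sum_freeEnergy`). Since F is never much above log Z, a uniformly random time, row
sample and sign sequence is good with probability at least 2^-(kT+1) (`Tensor.card_good_ge`). About
2^(kT+1) log(1/δ) trials suffice, each dominated by one evaluation of F in time O(n^k)
(`RealRAM.wins_trialsProg`).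

The machine has no logarithm, so H is replaced by the polynomial `truncEntropy`, which is still
strongly concave, and the maximization runs over a grid. -/

noncomputable section

/-! ### Polynomial approximation of the binary entropy -/

/-- The entropy of a `±1` variable with mean `x`. -/
def spinEntropy (x : ℝ) : ℝ := Real.negMulLog ((1 + x) / 2) + Real.negMulLog ((1 - x) / 2)

/-- The partial sum of the power series of `spinEntropy` whose value at `±1` is `0`. -/
def truncEntropy (L : ℕ) (x : ℝ) : ℝ :=
  ∑ j ∈ Finset.range L, (1 - x ^ (2 * j + 2)) / ((2 * j + 2) * (2 * j + 1))

/-- The summands are dominated by 1/((m+1)(m+2)), which telescopes. The true supremum is below log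
2, but 1 suffices for the initial potential. -/
theorem truncEntropy_le_one (L : ℕ) (x : ℝ) : truncEntropy L x ≤ 1 := by
  have h : ∀ L : ℕ, truncEntropy L x ≤ 1 - 1 / ((L : ℝ) + 1) := by
    intro L
    induction L with
    | zero => simp [truncEntropy]
    | succ m ih =>
      rw [truncEntropy, Finset.sum_range_succ]
      have hp : (0 : ℝ) ≤ x ^ (2 * m + 2) := Even.pow_nonneg ⟨m + 1, by ring⟩ x
      have h1 : (1 - x ^ (2 * m + 2)) / ((2 * (m : ℝ) + 2) * (2 * m + 1))
          ≤ 1 / ((2 * (m : ℝ) + 2) * (2 * m + 1)) := by gcongr; linarith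
      have h2 : 1 / ((2 * (m : ℝ) + 2) * (2 * m + 1)) ≤ 1 / (((m : ℝ) + 1) * (m + 2)) := by
        apply one_div_le_one_div_of_le (by positivity)
        nlinarith [(Nat.cast_nonneg m : (0 : ℝ) ≤ m)]
      have h3 : 1 / (((m : ℝ) + 1) * (m + 2)) = 1 / ((m : ℝ) + 1) - 1 / ((m : ℝ) + 1 + 1) := by
        field_simp; ring
      rw [truncEntropy] at ih
      push_cast
      linarith
  have := h L
  have h' : 0 ≤ 1 / ((L : ℝ) + 1) := by positivity
  linarith

theorem continuous_truncEntropy (L : ℕ) : Continuous (truncEntropy L) := by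
  unfold truncEntropy; fun_prop

theorem truncEntropy_neg (L : ℕ) (x : ℝ) : truncEntropy L (-x) = truncEntropy L x := by
  unfold truncEntropy
  refine Finset.sum_congr rfl fun j _ => ?_
  rw [Even.neg_pow ⟨j + 1, by ring⟩]

theorem abs_pow_sub_pow_le_of_abs_le_one {a b : ℝ} (ha : |a| ≤ 1) (hb : |b| ≤ 1) (m : ℕ) :
    |a ^ m - b ^ m| ≤ m * |a - b| := by
  induction m with
  | zero => simp
  | succ m ih =>
    have e : a ^ (m + 1) - b ^ (m + 1) = (a ^ m - b ^ m) * a + b ^ m * (a - b) := by ring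
    rw [e]
    refine (abs_add_le _ _).trans ?_
    rw [abs_mul, abs_mul, abs_pow]
    have h1 : |a ^ m - b ^ m| * |a| ≤ m * |a - b| * 1 := by gcongr
    have h2 : |b| ^ m * |a - b| ≤ 1 * |a - b| := by
      gcongr; exact pow_le_one₀ (abs_nonneg _) hb
    push_cast; linarith

/-- Each of the L summands is 1-Lipschitz on [-1, 1]. Unlike the entropy itself, the truncation has
a bounded slope up to ±1, so rounding to a grid is harmless. -/
theorem abs_truncEntropy_sub_le (L : ℕ) {a b : ℝ} (ha : |a| ≤ 1) (hb : |b| ≤ 1) :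
    |truncEntropy L a - truncEntropy L b| ≤ L * |a - b| := by
  unfold truncEntropy
  rw [← Finset.sum_sub_distrib]
  refine (Finset.abs_sum_le_sum_abs _ _).trans ?_
  have : ∀ j ∈ Finset.range L, |(1 - a ^ (2 * j + 2)) / ((2 * (j : ℝ) + 2) * (2 * j + 1)) -
      (1 - b ^ (2 * j + 2)) / ((2 * j + 2) * (2 * j + 1))| ≤ |a - b| := by
    intro j _
    rw [← sub_div, abs_div, abs_of_pos (by positivity : (0 : ℝ) < (2 * j + 2) * (2 * j + 1)),
      div_le_iff₀ (by positivity)]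
    have h := abs_pow_sub_pow_le_of_abs_le_one ha hb (2 * j + 2)
    rw [show 1 - a ^ (2 * j + 2) - (1 - b ^ (2 * j + 2)) = -(a ^ (2 * j + 2) - b ^ (2 * j + 2))
      by ring, abs_neg]
    push_cast at h
    have : (2 * (j : ℝ) + 2) * |a - b| ≤ |a - b| * ((2 * j + 2) * (2 * j + 1)) := by
      have h0 : (0 : ℝ) ≤ |a - b| * (2 * j + 2) * (2 * j) := by positivity
      nlinarith
    linarith
  refine (Finset.sum_le_sum this).trans ?_
  simp

/-- `truncEntropy L` is `1`-strongly concave. -/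
theorem truncEntropy_strongConcave {L : ℕ} (hL : 1 ≤ L) (a b : ℝ) {t : ℝ} (h0 : 0 ≤ t)
    (h1 : t ≤ 1) :
    t * truncEntropy L a + (1 - t) * truncEntropy L b + t * (1 - t) * (a - b) ^ 2 / 2
      ≤ truncEntropy L (t * a + (1 - t) * b) := by
  obtain ⟨m, rfl⟩ := Nat.exists_eq_add_of_le' hL
  unfold truncEntropy
  -- The summand j = 0 is (1 - x²)/2 and carries all of the strong concavity; the others are concave
  -- because even powers are convex.
  rw [Finset.sum_range_succ', Finset.sum_range_succ', Finset.sum_range_succ']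
  have key : ∑ j ∈ Finset.range m, t * ((1 - a ^ (2 * (j + 1) + 2)) /
        ((2 * ((j + 1 : ℕ) : ℝ) + 2) * (2 * ((j + 1 : ℕ) : ℝ) + 1))) +
      ∑ j ∈ Finset.range m, (1 - t) * ((1 - b ^ (2 * (j + 1) + 2)) /
        ((2 * ((j + 1 : ℕ) : ℝ) + 2) * (2 * ((j + 1 : ℕ) : ℝ) + 1))) ≤
      ∑ j ∈ Finset.range m, (1 - (t * a + (1 - t) * b) ^ (2 * (j + 1) + 2)) /
        ((2 * ((j + 1 : ℕ) : ℝ) + 2) * (2 * ((j + 1 : ℕ) : ℝ) + 1)) := by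
    rw [← Finset.sum_add_distrib]
    refine Finset.sum_le_sum fun j _ => ?_
    rw [← mul_div_assoc, ← mul_div_assoc, ← add_div]
    gcongr
    have hc := (Even.convexOn_pow (𝕜 := ℝ) (n := 2 * (j + 1) + 2) ⟨j + 2, by ring⟩).2
      (Set.mem_univ a) (Set.mem_univ b) h0 (sub_nonneg.2 h1) (by ring)
    simp only [smul_eq_mul] at hc
    linarith
  rw [← Finset.mul_sum, ← Finset.mul_sum] at key
  simp only [Nat.cast_zero, mul_zero, zero_add, mul_one]
  linear_combination key

/-- At 0 the truncation is a partial sum of the alternating harmonic series, hence equal to 1/(L+1)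
+ … + 1/(2L), which is compared with log((2L+1)/(L+1)). -/
theorem log_two_sub_le_truncEntropy_zero {L : ℕ} (hL : 1 ≤ L) :
    Real.log 2 - 1 / L ≤ truncEntropy L 0 := by
  have hS : ∀ L : ℕ, truncEntropy L 0 = ∑ m ∈ Finset.range L, 1 / ((L : ℝ) + m + 1) := by
    intro L
    induction L with
    | zero => simp [truncEntropy]
    | succ m ih =>
      rw [truncEntropy, Finset.sum_range_succ, ← truncEntropy, ih, zero_pow (by omega), sub_zero,
        Finset.sum_range_succ]
      cases m with
      | zero => norm_num
      | succ m =>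
        rw [Finset.sum_range_succ', Finset.sum_range_succ]
        have : ∀ k ∈ Finset.range m, 1 / (((m + 1 : ℕ) : ℝ) + ((k + 1 : ℕ) : ℝ) + 1) =
            1 / (((m + 1 + 1 : ℕ) : ℝ) + (k : ℝ) + 1) := by
          intro k _; push_cast; ring_nf
        rw [Finset.sum_congr rfl this]
        push_cast
        have h1 : (m : ℝ) + 1 + 0 + 1 ≠ 0 := by positivity
        field_simp
        ring
  have h : ∀ L : ℕ, Real.log ((2 * L + 1) / (L + 1)) ≤ truncEntropy L 0 := by
    intro L
    have hP : ∀ M : ℕ, Real.log ((L + M + 1) / (L + 1)) ≤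
        ∑ m ∈ Finset.range M, 1 / ((L : ℝ) + m + 1) := by
      intro M
      induction M with
      | zero =>
        have : (L : ℝ) + 1 ≠ 0 := by positivity
        simp [this]
      | succ m ih =>
        rw [Finset.sum_range_succ]
        have e : (L + (m + 1 : ℕ) + 1 : ℝ) / (L + 1) =
            (L + m + 1) / (L + 1) * (1 + 1 / (L + m + 1)) := by
          push_cast; field_simp; ring
        rw [e, Real.log_mul (by positivity) (by positivity)]
        have := Real.log_le_sub_one_of_pos (show (0 : ℝ) < 1 + 1 / (L + m + 1) by positivity)
        linarith
    have := hP L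
    rw [← two_mul] at this
    rw [hS]; exact this
  have h1 := h L
  have hL' : (0 : ℝ) < L := by exact_mod_cast hL
  have e : ((2 * L + 1) / (L + 1) : ℝ) = 2 / (1 + 1 / (2 * L + 1)) := by
    field_simp; ring
  rw [e, Real.log_div (by norm_num) (by positivity)] at h1
  have h2 := Real.log_le_sub_one_of_pos (show (0 : ℝ) < 1 + 1 / (2 * L + 1) by positivity)
  have h3 : (1 : ℝ) / (2 * L + 1) ≤ 1 / L := by gcongr; linarith
  linarith

theorem spinEntropy_neg (x : ℝ) : spinEntropy (-x) = spinEntropy x := by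
  unfold spinEntropy
  rw [add_comm, sub_neg_eq_add, ← sub_eq_add_neg]

theorem hasDerivAt_spinEntropy_sub_truncEntropy (L : ℕ) {x : ℝ} (h0 : -1 < x) (h1 : x < 1) :
    HasDerivAt (fun x => spinEntropy x - truncEntropy L x)
      (-(1 / 2) * (Real.log (1 + x) - Real.log (1 - x)) +
        ∑ j ∈ Finset.range L, x ^ (2 * j + 1) / (2 * j + 1)) x := by
  have hp : (1 + x) / 2 ≠ 0 := by linarith
  have hm : (1 - x) / 2 ≠ 0 := by linarith
  have d1 : HasDerivAt (fun x : ℝ => (1 + x) / 2) (1 / 2) x :=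
    ((hasDerivAt_id x).const_add 1).div_const 2
  have d2 : HasDerivAt (fun x : ℝ => (1 - x) / 2) (-1 / 2) x :=
    ((hasDerivAt_id x).const_sub 1).div_const 2
  have e1 := (Real.hasDerivAt_negMulLog hp).comp x d1
  have e2 := (Real.hasDerivAt_negMulLog hm).comp x d2
  have e3 : HasDerivAt (truncEntropy L)
      (∑ j ∈ Finset.range L, (-((2 * j + 2 : ℕ) * x ^ (2 * j + 1))) / ((2 * j + 2) * (2 * j + 1)))
      x := by
    unfold truncEntropy
    refine HasDerivAt.fun_sum fun j _ => ?_
    exact ((hasDerivAt_pow (2 * j + 2) x).const_sub 1).div_const _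
  refine ((e1.add e2).sub e3).congr_deriv ?_
  have : ∑ j ∈ Finset.range L, (-(((2 * j + 2 : ℕ) : ℝ) * x ^ (2 * j + 1))) /
      ((2 * (j : ℝ) + 2) * (2 * j + 1)) = - ∑ j ∈ Finset.range L, x ^ (2 * j + 1) / (2 * (j : ℝ) + 1) := by
    rw [← Finset.sum_neg_distrib]
    refine Finset.sum_congr rfl fun j _ => ?_
    push_cast; field_simp
  rw [this, Real.log_div (by linarith) two_ne_zero, Real.log_div (by linarith) two_ne_zero]
  ring

/-- On [0, 1) the derivative is minus a tail of the series of artanh, all of whose terms are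
nonnegative. The difference thus lies between its value 0 at 1 and its value at 0, which gives both
comparisons of the entropies. -/
theorem antitoneOn_spinEntropy_sub_truncEntropy (L : ℕ) :
    AntitoneOn (fun x => spinEntropy x - truncEntropy L x) (Set.Icc 0 1) := by
  refine antitoneOn_of_hasDerivWithinAt_nonpos (convex_Icc 0 1) ?_
    (fun x hx => (hasDerivAt_spinEntropy_sub_truncEntropy L ?_ ?_).hasDerivWithinAt) ?_
  · have := continuous_truncEntropy L
    have := Real.continuous_negMulLog
    unfold spinEntropy
    fun_prop
  · rw [interior_Icc] at hx; linarith [hx.1]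
  · rw [interior_Icc] at hx; exact hx.2
  · intro x hx
    rw [interior_Icc] at hx
    have hs := Real.hasSum_log_sub_log_of_abs_lt_one (abs_lt.2 ⟨by linarith [hx.1], hx.2⟩)
    have := sum_le_hasSum (Finset.range L) (fun j _ => by have := hx.1; positivity) hs
    have e : ∑ j ∈ Finset.range L, (2 : ℝ) * (1 / (2 * j + 1)) * x ^ (2 * j + 1) =
        2 * ∑ j ∈ Finset.range L, x ^ (2 * j + 1) / (2 * j + 1) := by
      rw [Finset.mul_sum]; exact Finset.sum_congr rfl fun j _ => by ring
    linarith

theorem spinEntropy_zero : spinEntropy 0 = Real.log 2 := by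
  unfold spinEntropy Real.negMulLog
  norm_num
  ring_nf
  rw [Real.log_div] <;> norm_num

theorem truncEntropy_le_spinEntropy (L : ℕ) {x : ℝ} (hx : |x| ≤ 1) :
    truncEntropy L x ≤ spinEntropy x := by
  have key : ∀ x ∈ Set.Icc (0 : ℝ) 1, truncEntropy L x ≤ spinEntropy x := by
    intro x hx
    have := antitoneOn_spinEntropy_sub_truncEntropy L hx (Set.right_mem_Icc.2 zero_le_one) hx.2
    simp only [spinEntropy, truncEntropy] at *
    norm_num at this
    linarith
  rcases le_total 0 x with h | h
  · exact key x ⟨h, (abs_le.1 hx).2⟩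
  · rw [← truncEntropy_neg, ← spinEntropy_neg]
    exact key (-x) ⟨by linarith, by linarith [(abs_le.1 hx).1]⟩

theorem spinEntropy_le_truncEntropy_add {L : ℕ} (hL : 1 ≤ L) {x : ℝ} (hx : |x| ≤ 1) :
    spinEntropy x ≤ truncEntropy L x + 1 / L := by
  have key : ∀ x ∈ Set.Icc (0 : ℝ) 1, spinEntropy x ≤ truncEntropy L x + 1 / L := by
    intro x hx
    have := antitoneOn_spinEntropy_sub_truncEntropy L (Set.left_mem_Icc.2 zero_le_one) hx hx.1
    have h2 := log_two_sub_le_truncEntropy_zero hL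
    simp only [spinEntropy_zero] at this
    linarith
  rcases le_total 0 x with h | h
  · exact key x ⟨h, (abs_le.1 hx).2⟩
  · rw [← truncEntropy_neg, ← spinEntropy_neg]
    exact key (-x) ⟨by linarith, by linarith [(abs_le.1 hx).1]⟩

/-- The two-point free energy is attained at the mean `tanh h`. -/
theorem log_exp_add_exp_neg (h : ℝ) :
    Real.log (Real.exp h + Real.exp (-h)) = h * Real.tanh h + spinEntropy (Real.tanh h) := by
  have hz : 0 < Real.exp h + Real.exp (-h) := by positivity
  have e1 : (1 + Real.tanh h) / 2 = Real.exp h / (Real.exp h + Real.exp (-h)) := by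
    rw [Real.tanh_eq]; field_simp; ring
  have e2 : (1 - Real.tanh h) / 2 = Real.exp (-h) / (Real.exp h + Real.exp (-h)) := by
    rw [Real.tanh_eq]; field_simp; ring
  rw [spinEntropy, Real.negMulLog, Real.negMulLog, e1, e2,
    Real.log_div (Real.exp_pos _).ne' hz.ne', Real.log_div (Real.exp_pos _).ne' hz.ne',
    Real.log_exp, Real.log_exp, Real.tanh_eq]
  field_simp
  ring

/-! ### The regularized maximum -/

/-- A point of `[-1, 1]` at which `S y + c * truncEntropy L y` is maximal. -/
theorem exists_isMaxOn_truncEntropy (L : ℕ) (c S : ℝ) :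
    ∃ x : ℝ, |x| ≤ 1 ∧ ∀ y, |y| ≤ 1 → S * y + c * truncEntropy L y ≤ S * x + c * truncEntropy L x := by
  have := continuous_truncEntropy L
  obtain ⟨x, hx, hm⟩ := (isCompact_Icc (a := (-1 : ℝ)) (b := 1)).exists_isMaxOn
    ⟨0, by norm_num, by norm_num⟩
    (f := fun y => S * y + c * truncEntropy L y) (by fun_prop)
  exact ⟨x, abs_le.2 hx, fun y hy => hm (abs_le.1 hy)⟩

/-- The mean that maximizes `S y + c * truncEntropy L y` over `[-1, 1]`. -/
def optMean (L : ℕ) (c S : ℝ) : ℝ := (exists_isMaxOn_truncEntropy L c S).choose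

theorem abs_optMean_le (L : ℕ) (c S : ℝ) : |optMean L c S| ≤ 1 :=
  (exists_isMaxOn_truncEntropy L c S).choose_spec.1

/-- The maximum of `S y + c * truncEntropy L y` over `[-1, 1]`. -/
def optValue (L : ℕ) (c S : ℝ) : ℝ := S * optMean L c S + c * truncEntropy L (optMean L c S)

theorem le_optValue (L : ℕ) (c S : ℝ) {y : ℝ} (hy : |y| ≤ 1) :
    S * y + c * truncEntropy L y ≤ optValue L c S :=
  (exists_isMaxOn_truncEntropy L c S).choose_spec.2 y hy

theorem abs_convexComb_le {x y t : ℝ} (hx : |x| ≤ 1) (hy : |y| ≤ 1) (h0 : 0 ≤ t) (h1 : t ≤ 1) :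
    |t * x + (1 - t) * y| ≤ 1 := by
  rw [abs_le] at *
  constructor <;> nlinarith

/-- Quadratic growth away from the maximizer: strong concavity at the midpoint of y and the
maximizer, compared with the maximum. The midpoint gives c/4. -/
theorem add_sq_le_optValue {L : ℕ} (hL : 1 ≤ L) {c : ℝ} (hc : 0 ≤ c) (S : ℝ) {y : ℝ}
    (hy : |y| ≤ 1) :
    S * y + c * truncEntropy L y + c / 4 * (y - optMean L c S) ^ 2 ≤ optValue L c S := by
  have hx := abs_optMean_le L c S
  have h1 := truncEntropy_strongConcave hL y (optMean L c S) (t := 1 / 2) (by norm_num) (by norm_num)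
  have h2 := le_optValue L c S (abs_convexComb_le hy hx (t := 1 / 2) (by norm_num) (by norm_num))
  have h3 := mul_le_mul_of_nonneg_left h1 hc
  rw [optValue] at *
  nlinarith

/-- Smoothness of the regularized maximum. -/
theorem optValue_add_le {L : ℕ} (hL : 1 ≤ L) {c : ℝ} (hc : 0 < c) (S g : ℝ) :
    optValue L c (S + g) ≤ optValue L c S + g * optMean L c S + g ^ 2 / c := by
  have hy := abs_optMean_le L c (S + g)
  have h := add_sq_le_optValue hL hc.le S hy
  set y := optMean L c (S + g) with hyd
  have e : optValue L c (S + g) = (S + g) * y + c * truncEntropy L y := rfl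
  set x := optMean L c S
  -- The linear gain from moving the maximizer is absorbed by the quadratic growth, by completing
  -- the square.
  have h2 : g * (y - x) ≤ c / 4 * (y - x) ^ 2 + g ^ 2 / c := by
    have : c / 4 * (y - x) ^ 2 + g ^ 2 / c - g * (y - x) = (c * (y - x) / 2 - g) ^ 2 / c := by
      field_simp; ring
    have h3 : 0 ≤ (c * (y - x) / 2 - g) ^ 2 / c := by positivity
    linarith
  nlinarith

/-- Testing the smaller regularization at the old maximizer. Since the weight grows by one per
round, this puts the entropy of the response into the potential and turns energies into free
energies. -/
theorem optValue_le_optValue_sub_one (L : ℕ) (c S : ℝ) :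
    optValue L c S ≤ optValue L (c - 1) S + truncEntropy L (optMean L c S) := by
  have := le_optValue L (c - 1) S (abs_optMean_le L c S)
  rw [optValue]
  linarith

theorem optValue_zero_le (L : ℕ) {c : ℝ} (hc : 0 ≤ c) : optValue L c 0 ≤ c := by
  have := truncEntropy_le_one L (optMean L c 0)
  rw [optValue]
  nlinarith

/-- The left side is the maximum of hy + H(y), attained at tanh h, with h = S/c; the truncation
loses at most 1/L. It compares the normalizer of a product measure with the potential. -/
theorem log_exp_add_exp_neg_le {L : ℕ} (hL : 1 ≤ L) {c : ℝ} (hc : 0 < c) (S : ℝ) :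
    Real.log (Real.exp (S / c) + Real.exp (-(S / c))) ≤ optValue L c S / c + 1 / L := by
  rw [log_exp_add_exp_neg]
  have ht : |Real.tanh (S / c)| ≤ 1 := (Real.abs_tanh_lt_one _).le
  have h1 := spinEntropy_le_truncEntropy_add hL ht
  have h2 := div_le_div_of_nonneg_right (le_optValue L c S ht) hc.le
  rw [add_div, mul_div_cancel_left₀ _ hc.ne', mul_div_right_comm] at h2
  linarith

/-- A maximizer over a grid of width `1 / G` is within `1 / G` of the maximizer over `[-1, 1]`. -/
theorem abs_sub_optMean_le {L : ℕ} (hL : 1 ≤ L) {c : ℝ} (hc : 0 < c) (S : ℝ) {G : ℕ} (hG : 0 < G)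
    {g : ℕ} (hg : g ≤ 2 * G)
    (hmax : ∀ g' : ℕ, g' ≤ 2 * G →
      S * ((g' : ℝ) / G - 1) + c * truncEntropy L ((g' : ℝ) / G - 1) ≤
        S * ((g : ℝ) / G - 1) + c * truncEntropy L ((g : ℝ) / G - 1)) :
    |((g : ℝ) / G - 1) - optMean L c S| ≤ 1 / G := by
  have hG' : (0 : ℝ) < G := by exact_mod_cast hG
  have hgrid : ∀ g : ℕ, g ≤ 2 * G → |(g : ℝ) / G - 1| ≤ 1 := by
    intro g hg
    have h1 : (g : ℝ) / G ≤ 2 := by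
      rw [div_le_iff₀ hG']; exact_mod_cast hg
    have h2 : 0 ≤ (g : ℝ) / G := by positivity
    rw [abs_le]; constructor <;> linarith
  have hx := abs_optMean_le L c S
  set x := optMean L c S with hxd
  set f : ℝ → ℝ := fun y => S * y + c * truncEntropy L y with hf
  have hfx : ∀ y, |y| ≤ 1 → f y ≤ f x := fun y hy => le_optValue L c S hy
  -- a point strictly between a grid maximizer and `x` is not on the grid
  have key : ∀ t : ℝ, 0 < t → t < 1 → f (t * x + (1 - t) * ((g : ℝ) / G - 1)) ≤ f ((g : ℝ) / G - 1) →
      x = (g : ℝ) / G - 1 := by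
    intro t h0 h1 hle
    by_contra hne
    have h2 := truncEntropy_strongConcave hL x ((g : ℝ) / G - 1) h0.le h1.le
    have h3 := hfx _ (hgrid g hg)
    have h4 : 0 < t * (1 - t) * (x - ((g : ℝ) / G - 1)) ^ 2 / 2 := by
      have : 0 < (x - ((g : ℝ) / G - 1)) ^ 2 := by
        have := sub_ne_zero.2 hne
        positivity
      have : 0 < 1 - t := by linarith
      positivity
    have h5 := mul_le_mul_of_nonneg_left h2 hc.le
    have h6 := mul_pos hc h4
    simp only [hf] at *
    have h7 := mul_le_mul_of_nonneg_left h3 h0.le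
    nlinarith
  by_contra hcon
  rw [not_le, lt_abs] at hcon
  rcases hcon with h | h
  · have hg1 : 1 ≤ g := by
      by_contra hlt
      have : g = 0 := by omega
      subst this
      have h3 := (abs_le.1 hx).1
      have : 0 < 1 / (G : ℝ) := by positivity
      rw [Nat.cast_zero, zero_div] at h; linarith
    have hm := hmax (g - 1) (by omega)
    have e : (((g - 1 : ℕ) : ℝ) / G - 1) = ((g : ℝ) / G - 1) - 1 / G := by
      rw [Nat.cast_sub hg1]; field_simp; push_cast; ring
    rw [e] at hm
    set y := (g : ℝ) / G - 1
    have hpos : 0 < y - x := lt_trans (by positivity) h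
    have e2 : y - 1 / G = (1 / G / (y - x)) * x + (1 - 1 / G / (y - x)) * y := by
      field_simp; ring
    have := key (1 / G / (y - x)) (by positivity) (by rw [div_lt_one hpos]; exact h)
      (by rw [← e2]; exact hm)
    linarith
  · have hg1 : g + 1 ≤ 2 * G := by
      by_contra hlt
      have : g = 2 * G := by omega
      subst this
      have h3 := (abs_le.1 hx).2
      have : 0 < 1 / (G : ℝ) := by positivity
      push_cast at h
      rw [mul_div_assoc, div_self hG'.ne'] at h
      linarith
    have hm := hmax (g + 1) hg1
    have e : (((g + 1 : ℕ) : ℝ) / G - 1) = ((g : ℝ) / G - 1) + 1 / G := by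
      push_cast; field_simp; ring
    rw [e] at hm
    set y := (g : ℝ) / G - 1
    have hpos : 0 < x - y := lt_trans (by positivity) (by linarith : 1 / (G : ℝ) < x - y)
    have e2 : y + 1 / G = (1 / G / (x - y)) * x + (1 - 1 / G / (x - y)) * y := by
      field_simp; ring
    have := key (1 / G / (x - y)) (by positivity) (by rw [div_lt_one hpos]; linarith)
      (by rw [← e2]; exact hm)
    linarith

/-! ### Resampling of a coordinate and Gibbs' inequality -/

/-- The map (u, v) ↦ (u with v at a, u a) is an involution, so resampling one coordinate preserves
the uniform distribution. -/
theorem sum_sum_update {ι α : Type*} [Fintype ι] [DecidableEq ι] [Fintype α] (a : ι)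
    (f : (ι → α) → ℝ) :
    ∑ u, ∑ v, f (Function.update u a v) = Fintype.card α * ∑ u, f u := by
  have e : Function.Involutive
      (fun p : (ι → α) × α => (Function.update p.1 a p.2, p.1 a)) := by
    rintro ⟨u, v⟩; simp
  rw [← Fintype.sum_prod_type']
  have := Equiv.sum_comp e.toPerm (fun p : (ι → α) × α => f p.1)
  simp only [Function.Involutive.coe_toPerm] at this
  rw [this, Fintype.sum_prod_type]
  simp [Finset.mul_sum]

/-- Gibbs' inequality. -/
theorem sum_mul_log_sub_log_le {ι : Type*} [Fintype ι] {p w : ι → ℝ} (hp : ∀ i, 0 ≤ p i)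
    (hp1 : ∑ i, p i = 1) (hw : ∀ i, 0 < w i) :
    ∑ i, p i * (Real.log (w i) - Real.log (p i)) ≤ Real.log (∑ i, w i) := by
  have hne : (Finset.univ : Finset ι).Nonempty := by
    by_contra h
    rw [Finset.not_nonempty_iff_eq_empty] at h
    simp [h] at hp1
  have hW : 0 < ∑ i, w i := Finset.sum_pos (fun i _ => hw i) hne
  have h : ∀ i, p i * (Real.log (w i) - Real.log (p i)) ≤
      w i / (∑ i, w i) - p i + p i * Real.log (∑ i, w i) := by
    intro i
    rcases (hp i).eq_or_lt with h0 | h0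
    · rw [← h0]; have := (div_pos (hw i) hW).le; simpa using this
    · have h1 := Real.log_le_sub_one_of_pos
        (show 0 < w i / (p i * ∑ i, w i) from div_pos (hw i) (mul_pos h0 hW))
      rw [Real.log_div (hw i).ne' (mul_pos h0 hW).ne', Real.log_mul h0.ne' hW.ne'] at h1
      have h2 := mul_le_mul_of_nonneg_left h1 h0.le
      have h3 : p i * (w i / (p i * ∑ i, w i) - 1) = w i / (∑ i, w i) - p i := by
        field_simp
      rw [h3] at h2
      linarith
  refine (Finset.sum_le_sum fun i _ => h i).trans ?_
  rw [Finset.sum_add_distrib, Finset.sum_sub_distrib, ← Finset.sum_div, div_self hW.ne', hp1,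
    ← Finset.sum_mul, hp1]
  simp

namespace Tensor

variable {k n : ℕ}

/-! ### The multilinear energy and the consequences of density -/

/-- The multilinear form of the tensor at a vector of means. -/
def meanEnergy (J : Tensor k n) (x : Fin n → ℝ) : ℝ := ∑ i, J i * ∏ j, x (i j)

/-- The spins of a configuration as real numbers. -/
def spin (X : Fin n → ℤˣ) (i : Fin n) : ℝ := ((X i : ℤ) : ℝ)

theorem abs_spin (X : Fin n → ℤˣ) (i : Fin n) : |spin X i| = 1 := by
  rcases Int.units_eq_one_or (X i) with h | h <;> simp [spin, h]

theorem energy_eq (J : Tensor k n) (X : Fin n → ℤˣ) : J.energy X = J.meanEnergy (spin X) := rfl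

theorem prod_sub_prod_eq (a b : Fin k → ℝ) :
    ∏ j, a j - ∏ j, b j = ∑ j, (a j - b j) * (∏ l with l < j, b l) * ∏ l with j < l, a l := by
  have := Finset.prod_sub_ordered (Finset.univ) a (fun j => a j - b j)
  simp only [sub_sub_cancel] at this
  rw [this]; ring

theorem meanEnergy_sub_eq (J : Tensor k n) (x y : Fin n → ℝ) :
    J.meanEnergy x - J.meanEnergy y = ∑ j, ∑ u : Fin k → Fin n, J u *
      ((x (u j) - y (u j)) * (∏ l with l < j, y (u l)) * ∏ l with j < l, x (u l)) := by
  rw [meanEnergy, meanEnergy, ← Finset.sum_sub_distrib, Finset.sum_comm]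
  refine Finset.sum_congr rfl fun u _ => ?_
  rw [← mul_sub, prod_sub_prod_eq (fun j => x (u j)) (fun j => y (u j)), Finset.mul_sum]

theorem abs_prod_le_one {ι : Type*} (s : Finset ι) {a : ι → ℝ} (h : ∀ i, |a i| ≤ 1) :
    |∏ i ∈ s, a i| ≤ 1 := by
  rw [Finset.abs_prod]
  exact Finset.prod_le_one (fun i _ => abs_nonneg _) fun i _ => h i

/-- The pairing of the row of `J` through `u` in direction `j` with `z`. -/
def rowPair (J : Tensor k n) (u : Fin k → Fin n) (j : Fin k) (z : Fin n → ℝ) : ℝ :=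
  ∑ i, J (Function.update u j i) * z i

/-- In the telescoping sum over the slots, the factors other than slot j do not depend on the index
there and are at most 1 in absolute value. Averaging over that index leaves a row pairing. Thus
random rows detect any energy difference between two points. -/
theorem abs_meanEnergy_sub_le_rowPair (J : Tensor k n) {x y : Fin n → ℝ} (hx : ∀ i, |x i| ≤ 1)
    (hy : ∀ i, |y i| ≤ 1) :
    n * |J.meanEnergy x - J.meanEnergy y| ≤ ∑ u, ∑ j, |J.rowPair u j (x - y)| := by
  rw [meanEnergy_sub_eq, Finset.sum_comm (f := fun u j => |J.rowPair u j (x - y)|)]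
  refine (mul_le_mul_of_nonneg_left (Finset.abs_sum_le_sum_abs _ _) (Nat.cast_nonneg _)).trans ?_
  rw [Finset.mul_sum]
  refine Finset.sum_le_sum fun j _ => ?_
  rw [← abs_of_nonneg (Nat.cast_nonneg n : (0 : ℝ) ≤ n), ← abs_mul]
  have := sum_sum_update j (fun u : Fin k → Fin n => J u *
      ((x (u j) - y (u j)) * (∏ l with l < j, y (u l)) * ∏ l with j < l, x (u l)))
  rw [Fintype.card_fin] at this
  rw [← this]
  refine (Finset.abs_sum_le_sum_abs _ _).trans (Finset.sum_le_sum fun u _ => ?_)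
  have e : ∑ v, J (Function.update u j v) * ((x (Function.update u j v j) -
      y (Function.update u j v j)) * (∏ l with l < j, y (Function.update u j v l)) *
      ∏ l with j < l, x (Function.update u j v l)) =
      J.rowPair u j (x - y) * ((∏ l with l < j, y (u l)) * ∏ l with j < l, x (u l)) := by
    rw [rowPair, Finset.sum_mul]
    refine Finset.sum_congr rfl fun v _ => ?_
    have h1 : ∏ l with l < j, y (Function.update u j v l) = ∏ l with l < j, y (u l) := by
      refine Finset.prod_congr rfl fun l hl => ?_
      rw [Function.update_of_ne (Finset.mem_filter.1 hl).2.ne]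
    have h2 : ∏ l with j < l, x (Function.update u j v l) = ∏ l with j < l, x (u l) := by
      refine Finset.prod_congr rfl fun l hl => ?_
      rw [Function.update_of_ne (Finset.mem_filter.1 hl).2.ne']
    rw [h1, h2, Function.update_self, Pi.sub_apply]
    ring
  rw [e, abs_mul, abs_mul]
  have h1 := abs_prod_le_one (Finset.univ.filter (· < j)) (fun l => hy (u l))
  have h2 := abs_prod_le_one (Finset.univ.filter (j < ·)) (fun l => hx (u l))
  have h3 := mul_le_one₀ h1 (abs_nonneg _) h2
  nlinarith [abs_nonneg (J.rowPair u j (x - y))]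

/-- A sup-norm Lipschitz bound, needed only for rounding the means to a grid. -/
theorem abs_meanEnergy_sub_le (J : Tensor k n) {x y : Fin n → ℝ} (hx : ∀ i, |x i| ≤ 1)
    (hy : ∀ i, |y i| ≤ 1) {d : ℝ} (hd : ∀ i, |x i - y i| ≤ d) :
    |J.meanEnergy x - J.meanEnergy y| ≤ k * J.l1Norm * d := by
  rw [meanEnergy_sub_eq]
  refine (Finset.abs_sum_le_sum_abs _ _).trans ?_
  have : ∀ j ∈ (Finset.univ : Finset (Fin k)), |∑ u : Fin k → Fin n, J u *
      ((x (u j) - y (u j)) * (∏ l with l < j, y (u l)) * ∏ l with j < l, x (u l))| ≤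
      J.l1Norm * d := by
    intro j _
    refine (Finset.abs_sum_le_sum_abs _ _).trans ?_
    rw [l1Norm, Finset.sum_mul]
    refine Finset.sum_le_sum fun u _ => ?_
    rw [abs_mul, abs_mul, abs_mul]
    have h1 := abs_prod_le_one (Finset.univ.filter (· < j)) (fun l => hy (u l))
    have h2 := abs_prod_le_one (Finset.univ.filter (j < ·)) (fun l => hx (u l))
    have h0 : 0 ≤ d := (abs_nonneg _).trans (hd (u j))
    gcongr
    calc _ ≤ d * 1 * 1 := by gcongr; exact hd (u j)
      _ = d := by ring
  refine (Finset.sum_le_sum this).trans ?_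
  simp [mul_assoc]

theorem abs_meanEnergy_le (J : Tensor k n) {x : Fin n → ℝ} (hx : ∀ i, |x i| ≤ 1) :
    |J.meanEnergy x| ≤ J.l1Norm := by
  refine (Finset.abs_sum_le_sum_abs _ _).trans (Finset.sum_le_sum fun u _ => ?_)
  rw [abs_mul]
  exact mul_le_of_le_one_right (abs_nonneg _) (abs_prod_le_one _ fun l => hx (u l))

theorem l1Norm_nonneg (J : Tensor k n) : 0 ≤ J.l1Norm := Finset.sum_nonneg fun _ _ => abs_nonneg _

theorem IsDense.abs_le {J : Tensor k n} {Δ : ℝ} (h : J.IsDense Δ) (hΔ : 0 < Δ)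
    (u : Fin k → Fin n) : |J u| ≤ J.l1Norm / (Δ * (n : ℝ) ^ k) := by
  have h1 : |J u| ≤ J.linftyNorm := norm_le_pi_norm J u
  have h2 : Δ * J.linftyNorm ≤ J.l1Norm / (n : ℝ) ^ k := h
  rw [mul_comm Δ, ← div_div, le_div_iff₀ hΔ]
  nlinarith

/-- One factor |J u| is bounded by density and the other is summed. This second moment controls the
variance of a random row and is the source of the factor 1/Δ in the number of rounds. -/
theorem IsDense.sum_sq_le {J : Tensor k n} {Δ : ℝ} (h : J.IsDense Δ) (hΔ : 0 < Δ) :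
    ∑ u, J u ^ 2 ≤ J.l1Norm ^ 2 / (Δ * (n : ℝ) ^ k) := by
  have : ∀ u ∈ (Finset.univ : Finset (Fin k → Fin n)), J u ^ 2 ≤
      |J u| * (J.l1Norm / (Δ * (n : ℝ) ^ k)) := by
    intro u _
    rw [← sq_abs, sq]
    exact mul_le_mul_of_nonneg_left (h.abs_le hΔ u) (abs_nonneg _)
  refine (Finset.sum_le_sum this).trans ?_
  rw [← Finset.sum_mul, ← l1Norm, sq, mul_div_assoc]

theorem partitionFunction_pos (J : Tensor k n) : 0 < J.partitionFunction :=
  Finset.sum_pos (fun _ _ => Real.exp_pos _) Finset.univ_nonempty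

theorem abs_log_partitionFunction_sub_le (J : Tensor k n) :
    |Real.log J.partitionFunction - n * Real.log 2| ≤ J.l1Norm := by
  have hb : ∀ X : Fin n → ℤˣ, |J.energy X| ≤ J.l1Norm := fun X =>
    J.abs_meanEnergy_le fun i => (abs_spin X i).le
  have hc : (Fintype.card (Fin n → ℤˣ) : ℝ) = 2 ^ n := by simp
  have h1 : J.partitionFunction ≤ 2 ^ n * Real.exp J.l1Norm := by
    rw [← hc, ← nsmul_eq_mul]
    exact Finset.sum_le_card_nsmul _ _ _ fun X _ => Real.exp_le_exp.2 (abs_le.1 (hb X)).2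
  have h2 : 2 ^ n * Real.exp (-J.l1Norm) ≤ J.partitionFunction := by
    rw [← hc, ← nsmul_eq_mul]
    exact Finset.card_nsmul_le_sum _ _ _ fun X _ => Real.exp_le_exp.2 (abs_le.1 (hb X)).1
  have h3 := Real.log_le_log J.partitionFunction_pos h1
  have h4 := Real.log_le_log (by positivity) h2
  rw [Real.log_mul (by positivity) (Real.exp_pos _).ne', Real.log_pow, Real.log_exp] at h3 h4
  rw [_root_.abs_le]
  constructor <;> linarith

/-! ### Product measures -/

/-- The probability of a configuration under the product measure with the means `x`. -/
def prodProb (x : Fin n → ℝ) (X : Fin n → ℤˣ) : ℝ := ∏ i, (1 + spin X i * x i) / 2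

theorem prodProb_nonneg {x : Fin n → ℝ} (hx : ∀ i, |x i| ≤ 1) (X : Fin n → ℤˣ) :
    0 ≤ prodProb x X := by
  refine Finset.prod_nonneg fun i _ => ?_
  have h1 := abs_mul (spin X i) (x i)
  rw [abs_spin, one_mul] at h1
  have := (abs_le.1 (h1.trans_le (hx i))).1
  linarith

theorem sum_units (f : ℤˣ → ℝ) : ∑ b, f b = f 1 + f (-1) := by
  rw [show (Finset.univ : Finset ℤˣ) = {1, -1} from rfl, Finset.sum_pair (by decide)]

theorem sum_prodProb_mul_prod (x : Fin n → ℝ) (f : Fin n → ℤˣ → ℝ) :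
    ∑ X, prodProb x X * ∏ i, f i (X i) =
      ∏ i, ((1 + x i) / 2 * f i 1 + (1 - x i) / 2 * f i (-1)) := by
  have := Finset.prod_univ_sum (fun _ : Fin n => (Finset.univ : Finset ℤˣ))
    (fun i b => (1 + ((b : ℤ) : ℝ) * x i) / 2 * f i b)
  rw [Fintype.piFinset_univ] at this
  simp only [prodProb, ← Finset.prod_mul_distrib, spin]
  rw [← this]
  refine Finset.prod_congr rfl fun i _ => ?_
  rw [sum_units]
  push_cast
  ring

theorem sum_prodProb (x : Fin n → ℝ) : ∑ X, prodProb x X = 1 := by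
  have := sum_prodProb_mul_prod x (fun _ _ => 1)
  simp only [Finset.prod_const_one, mul_one] at this
  rw [this]
  exact Finset.prod_eq_one fun i _ => by ring

theorem sum_prodProb_mul_apply (x : Fin n → ℝ) (i : Fin n) (f : ℤˣ → ℝ) :
    ∑ X, prodProb x X * f (X i) = (1 + x i) / 2 * f 1 + (1 - x i) / 2 * f (-1) := by
  have := sum_prodProb_mul_prod x (fun l b => if l = i then f b else 1)
  simp only [Finset.prod_ite_eq', Finset.mem_univ, if_true] at this
  rw [this, Finset.prod_eq_single i]
  · simp
  · intro l _ hl; simp only [hl, if_false]; ring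
  · simp

/-- Independence factorizes the expectation only when the nodes are distinct; a repeated node would
give a squared spin instead of a squared mean. -/
theorem sum_prodProb_mul_prod_spin (x : Fin n → ℝ) {u : Fin k → Fin n}
    (hu : Function.Injective u) :
    ∑ X, prodProb x X * ∏ j, spin X (u j) = ∏ j, x (u j) := by
  have := sum_prodProb_mul_prod x
    (fun l b => if l ∈ Finset.univ.image u then ((b : ℤ) : ℝ) else 1)
  have e : ∀ y : Fin n → ℝ, ∏ l, (if l ∈ Finset.univ.image u then y l else 1) = ∏ j, y (u j) := by
    intro y
    rw [Finset.prod_ite_mem, Finset.univ_inter, Finset.prod_image (fun a _ b _ h => hu h)]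
  have h1 : ∀ X : Fin n → ℤˣ, ∏ l, (if l ∈ Finset.univ.image u then ((X l : ℤ) : ℝ) else 1) =
      ∏ j, spin X (u j) := fun X => e (spin X)
  simp only [h1] at this
  rw [this, ← e x]
  refine Finset.prod_congr rfl fun l _ => ?_
  split_ifs <;> push_cast <;> ring

theorem sum_prodProb_mul_log (x : Fin n → ℝ) :
    ∑ X, prodProb x X * Real.log (prodProb x X) = - ∑ i, spinEntropy (x i) := by
  have h : ∀ X : Fin n → ℤˣ, prodProb x X * Real.log (prodProb x X) =
      ∑ i, prodProb x X * Real.log ((1 + ((X i : ℤ) : ℝ) * x i) / 2) := by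
    intro X
    rw [← Finset.mul_sum]
    -- The logarithm of the product splits only if no factor vanishes; otherwise both sides are 0.
    by_cases h0 : prodProb x X = 0
    · simp [h0]
    · rw [prodProb] at h0
      rw [prodProb, Real.log_prod]
      · rfl
      · exact fun i hi => Finset.prod_ne_zero_iff.1 h0 i hi
  simp only [h]
  rw [Finset.sum_comm, ← Finset.sum_neg_distrib]
  refine Finset.sum_congr rfl fun i _ => ?_
  rw [sum_prodProb_mul_apply x i (fun b => Real.log ((1 + ((b : ℤ) : ℝ) * x i) / 2)), spinEntropy,
    Real.negMulLog, Real.negMulLog]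
  push_cast
  ring_nf

/-- Union bound over pairs of slots: resampling slot a makes it collide with slot b for just one of
the n values. -/
theorem card_not_injective_le :
    n * ∑ u : Fin k → Fin n, (if Function.Injective u then (0 : ℝ) else 1) ≤ k ^ 2 * n ^ k := by
  classical
  have h1 : ∀ u : Fin k → Fin n, (if Function.Injective u then (0 : ℝ) else 1) ≤
      ∑ a, ∑ b, if a ≠ b ∧ u a = u b then 1 else 0 := by
    intro u
    split_ifs with h
    · exact Finset.sum_nonneg fun a _ => Finset.sum_nonneg fun b _ => by split_ifs <;> norm_num
    · rw [Function.not_injective_iff] at h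
      obtain ⟨a, b, hab, hne⟩ := h
      refine le_trans ?_ (Finset.single_le_sum (fun a _ => Finset.sum_nonneg fun b _ => by
        split_ifs <;> norm_num) (Finset.mem_univ a))
      refine le_trans ?_ (Finset.single_le_sum (fun b _ => by
        split_ifs <;> norm_num) (Finset.mem_univ b))
      simp [hab, hne]
  have h2 : ∀ a b : Fin k, n * ∑ u : Fin k → Fin n, (if a ≠ b ∧ u a = u b then (1 : ℝ) else 0)
      ≤ n ^ k := by
    intro a b
    have := sum_sum_update a (fun u : Fin k → Fin n => if a ≠ b ∧ u a = u b then (1 : ℝ) else 0)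
    rw [Fintype.card_fin] at this
    rw [← this]
    have h3 : ∀ u : Fin k → Fin n, ∑ v, (if a ≠ b ∧ Function.update u a v a =
        Function.update u a v b then (1 : ℝ) else 0) ≤ 1 := by
      intro u
      by_cases hab : a = b
      · simp [hab]
      · simp [hab, Function.update_of_ne (Ne.symm hab)]
    refine (Finset.sum_le_sum fun u _ => h3 u).trans ?_
    simp
  calc n * ∑ u : Fin k → Fin n, (if Function.Injective u then (0 : ℝ) else 1)
      ≤ n * ∑ u : Fin k → Fin n, ∑ a, ∑ b, (if a ≠ b ∧ u a = u b then (1 : ℝ) else 0) := by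
        gcongr with u _; exact h1 u
    _ = ∑ a, ∑ b, n * ∑ u : Fin k → Fin n, (if a ≠ b ∧ u a = u b then (1 : ℝ) else 0) := by
        rw [Finset.sum_comm, Finset.mul_sum]
        refine Finset.sum_congr rfl fun a _ => ?_
        rw [Finset.sum_comm, Finset.mul_sum]
    _ ≤ ∑ a : Fin k, ∑ b : Fin k, (n : ℝ) ^ k := by
        gcongr with a _ b _; exact h2 a b
    _ = k ^ 2 * n ^ k := by simp; ring

/-- The mean-field free energy is a lower bound of the free energy, up to the contribution of the
entries with repeated indices. -/
theorem meanEnergy_add_spinEntropy_le {J : Tensor k n} {Δ : ℝ} (h : J.IsDense Δ) (hΔ : 0 < Δ)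
    (hn : 0 < n) {x : Fin n → ℝ} (hx : ∀ i, |x i| ≤ 1) :
    J.meanEnergy x + ∑ i, spinEntropy (x i) ≤
      Real.log J.partitionFunction + 2 * k ^ 2 * J.l1Norm / (Δ * n) := by
  classical
  have hn' : (0 : ℝ) < n := by exact_mod_cast hn
  -- Gibbs' inequality for the product measure against the weights exp J(X): its expected energy
  -- plus its entropy is at most log Z.
  have h1 := sum_mul_log_sub_log_le (prodProb_nonneg hx) (sum_prodProb x)
    (w := fun X => Real.exp (J.energy X)) (fun X => Real.exp_pos _)
  simp only [Real.log_exp, mul_sub, Finset.sum_sub_distrib] at h1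
  rw [sum_prodProb_mul_log x, sub_neg_eq_add] at h1
  have h2 : ∑ X, prodProb x X * J.energy X =
      ∑ u, J u * ∑ X, prodProb x X * ∏ j, spin X (u j) := by
    simp only [energy_eq, meanEnergy, Finset.mul_sum]
    rw [Finset.sum_comm]
    exact Finset.sum_congr rfl fun u _ => Finset.sum_congr rfl fun X _ => by ring
  -- Only tuples with a repeated index contribute to the difference, each at most 2|J u|; density
  -- bounds the entry and `card_not_injective_le` their number.
  have h3 : |∑ X, prodProb x X * J.energy X - J.meanEnergy x| ≤
      2 * k ^ 2 * J.l1Norm / (Δ * n) := by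
    rw [h2, meanEnergy, ← Finset.sum_sub_distrib]
    refine (Finset.abs_sum_le_sum_abs _ _).trans ?_
    have h4 : ∀ u ∈ (Finset.univ : Finset (Fin k → Fin n)),
        |J u * ∑ X, prodProb x X * ∏ j, spin X (u j) - J u * ∏ j, x (u j)| ≤
        2 * (J.l1Norm / (Δ * (n : ℝ) ^ k)) * (if Function.Injective u then 0 else 1) := by
      intro u _
      split_ifs with hu
      · rw [sum_prodProb_mul_prod_spin x hu]; simp
      · rw [← mul_sub, abs_mul, mul_one, mul_comm]
        gcongr
        · refine (abs_sub _ _).trans ?_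
          have h5 := abs_prod_le_one Finset.univ (fun j => hx (u j))
          have h6 : |∑ X, prodProb x X * ∏ j, spin X (u j)| ≤ 1 := by
            refine (Finset.abs_sum_le_sum_abs _ _).trans ?_
            rw [← sum_prodProb x]
            refine Finset.sum_le_sum fun X _ => ?_
            rw [abs_mul, abs_of_nonneg (prodProb_nonneg hx X)]
            exact mul_le_of_le_one_right (prodProb_nonneg hx X)
              (abs_prod_le_one _ fun j => (abs_spin X (u j)).le)
          linarith
        · exact h.abs_le hΔ u
    refine (Finset.sum_le_sum h4).trans ?_
    rw [← Finset.mul_sum]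
    have h7 := card_not_injective_le (k := k) (n := n)
    have h8 : 2 * k ^ 2 * J.l1Norm / (Δ * n) =
        2 * (J.l1Norm / (Δ * (n : ℝ) ^ k)) * (k ^ 2 * n ^ k / n) := by
      field_simp
    rw [h8]
    have := J.l1Norm_nonneg
    gcongr
    rw [le_div_iff₀ hn', mul_comm]
    convert h7
  have h9 := (_root_.abs_le.1 h3).1
  rw [partitionFunction]
  linarith

end Tensor

namespace Tensor

variable {k n : ℕ}

/-! ### The sampled fields -/

/-- The sign encoded by a bit. -/
def bitSign (b : Fin 2) : ℝ := 1 - 2 * (b : ℕ)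

theorem bitSign_sq (b : Fin 2) : bitSign b ^ 2 = 1 := by
  fin_cases b <;> norm_num [bitSign]

/-- The signed and scaled sum of the rows of `J` through `u`. -/
def fieldStep (J : Tensor k n) (u : Fin k → Fin n) (s : Fin k → Fin 2) (i : Fin n) : ℝ :=
  (n : ℝ) ^ (k - 1) * ∑ j, bitSign (s j) * J (Function.update u j i)

/-- The sum of the first `τ` signed rows. -/
def field (J : Tensor k n) (τ : ℕ) (u : ℕ → Fin k → Fin n) (s : ℕ → Fin k → Fin 2) (i : Fin n) : ℝ :=
  ∑ r ∈ Finset.range τ, J.fieldStep (u r) (s r) i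

/-- The truncated mean-field free energy. -/
def freeEnergy (J : Tensor k n) (L : ℕ) (x : Fin n → ℝ) : ℝ :=
  J.meanEnergy x + ∑ i, truncEntropy L (x i)

/-- The regularized best response to the field `S`. -/
def response (L : ℕ) (c : ℝ) (S : Fin n → ℝ) (i : Fin n) : ℝ := optMean L c (S i)

theorem abs_response_le (L : ℕ) (c : ℝ) (S : Fin n → ℝ) (i : Fin n) : |response L c S i| ≤ 1 :=
  abs_optMean_le _ _ _

/-- The signs of the pairings of the rows through `u` with `z`. -/
def signOf (J : Tensor k n) (u : Fin k → Fin n) (z : Fin n → ℝ) (j : Fin k) : Fin 2 :=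
  if 0 ≤ J.rowPair u j z then 0 else 1

theorem bitSign_signOf_mul (J : Tensor k n) (u : Fin k → Fin n) (z : Fin n → ℝ) (j : Fin k) :
    bitSign (J.signOf u z j) * J.rowPair u j z = |J.rowPair u j z| := by
  unfold signOf
  split_ifs with h
  · simp [bitSign, abs_of_nonneg h]
  · rw [abs_of_neg (not_le.1 h)]; norm_num [bitSign]

/-- With the signs pointing towards z, a step of the field gains the absolute value of every row
pairing. -/
theorem sum_fieldStep_mul (J : Tensor k n) (u : Fin k → Fin n) (z : Fin n → ℝ) :
    ∑ i, J.fieldStep u (J.signOf u z) i * z i = (n : ℝ) ^ (k - 1) * ∑ j, |J.rowPair u j z| := by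
  have h : ∀ j ∈ (Finset.univ : Finset (Fin k)), |J.rowPair u j z| =
      ∑ i, bitSign (J.signOf u z j) * (J (Function.update u j i) * z i) := by
    intro j _
    rw [← bitSign_signOf_mul, ← Finset.mul_sum, rowPair]
  rw [Finset.sum_congr rfl h]
  simp only [fieldStep, Finset.mul_sum, Finset.sum_mul]
  rw [Finset.sum_comm]
  exact Finset.sum_congr rfl fun j _ => Finset.sum_congr rfl fun i _ => by ring

/-- The field when the signs are chosen such that they point from the current response to `X`. -/
def adaptField (J : Tensor k n) (L : ℕ) (β : ℝ) (u : ℕ → Fin k → Fin n) (X : Fin n → ℝ) :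
    ℕ → Fin n → ℝ
  | 0 => 0
  | r + 1 => adaptField J L β u X r +
      J.fieldStep (u r) (J.signOf (u r) (X - response L (β + r + 1) (adaptField J L β u X r)))

/-- The signs that point from the current response to `X`. -/
def adaptSign (J : Tensor k n) (L : ℕ) (β : ℝ) (u : ℕ → Fin k → Fin n) (X : Fin n → ℝ) (r : ℕ) :
    Fin k → Fin 2 :=
  J.signOf (u r) (X - response L (β + r + 1) (J.adaptField L β u X r))

/-- Although the signs depend on X and on the past, the resulting field is one of those given by kτ
fixed bits. Hence random bits can hit it, and describing it costs only kτ bits. -/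
theorem adaptField_eq (J : Tensor k n) (L : ℕ) (β : ℝ) (u : ℕ → Fin k → Fin n) (X : Fin n → ℝ)
    (τ : ℕ) : J.adaptField L β u X τ = J.field τ u (J.adaptSign L β u X) := by
  induction τ with
  | zero => funext i; simp [adaptField, field]
  | succ r ih =>
    funext i
    rw [field, Finset.sum_range_succ, ← field, ← ih]
    rfl

/-- The field at time τ ignores the rows from τ on, so the row of the next step is independent of
it. -/
theorem adaptField_congr (J : Tensor k n) (L : ℕ) (β : ℝ) {u u' : ℕ → Fin k → Fin n}
    (X : Fin n → ℝ) {τ : ℕ} (h : ∀ r < τ, u r = u' r) :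
    J.adaptField L β u X τ = J.adaptField L β u' X τ := by
  induction τ with
  | zero => rfl
  | succ r ih =>
    rw [adaptField, adaptField, ih fun r hr => h r (by omega), h r (by omega)]

theorem field_congr (J : Tensor k n) {τ : ℕ} {u : ℕ → Fin k → Fin n}
    {s s' : ℕ → Fin k → Fin 2} (h : ∀ r < τ, s r = s' r) : J.field τ u s = J.field τ u s' := by
  funext i
  exact Finset.sum_congr rfl fun r hr => by rw [h r (Finset.mem_range.1 hr)]

/-- One round of follow-the-regularized-leader: smoothness gives ⟨g, x⟩ plus a quadratic term, the
growth of the regularization gives the entropy of x, and ⟨g, X - x⟩ is the gain of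
`sum_fieldStep_mul`. The initial field 0 contributes βn. -/
theorem optValue_adaptField_le (J : Tensor k n) {L : ℕ} (hL : 1 ≤ L) {β : ℝ} (hβ : 0 ≤ β)
    (u : ℕ → Fin k → Fin n) (X : Fin n → ℝ) (T : ℕ) :
    ∑ i, optValue L (β + T) (J.adaptField L β u X T i) - ∑ i, J.adaptField L β u X T i * X i ≤
      β * n + ∑ τ ∈ Finset.range T,
        (∑ i, truncEntropy L (response L (β + τ + 1) (J.adaptField L β u X τ) i) -
          (n : ℝ) ^ (k - 1) *
            ∑ j, |J.rowPair (u τ) j (X - response L (β + τ + 1) (J.adaptField L β u X τ))| +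
          (∑ i, J.fieldStep (u τ) (J.adaptSign L β u X τ) i ^ 2) / (β + τ + 1)) := by
  induction T with
  | zero =>
    have : ∑ i : Fin n, optValue L β 0 ≤ ∑ i : Fin n, β :=
      Finset.sum_le_sum fun i _ => optValue_zero_le L hβ
    simp only [Finset.sum_const, Finset.card_univ, Fintype.card_fin, nsmul_eq_mul] at this
    simp [adaptField]
    linarith
  | succ r ih =>
    rw [Finset.sum_range_succ, ← sum_fieldStep_mul]
    have hc : 0 < β + r + 1 := by positivity
    set S := J.adaptField L β u X r
    set x := response L (β + r + 1) S with hx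
    have hs : J.adaptSign L β u X r = J.signOf (u r) (X - x) := rfl
    rw [hs]
    set g := J.fieldStep (u r) (J.signOf (u r) (X - x))
    have hS : J.adaptField L β u X (r + 1) = S + g := rfl
    have h1 : ∀ i, optValue L (β + (r + 1 : ℕ)) ((S + g) i) ≤
        optValue L (β + r) (S i) + truncEntropy L (x i) + g i * x i + g i ^ 2 / (β + r + 1) := by
      intro i
      have h2 := optValue_add_le hL hc (S i) (g i)
      have h3 := optValue_le_optValue_sub_one L (β + r + 1) (S i)
      rw [add_sub_cancel_right] at h3
      have e : β + ((r + 1 : ℕ) : ℝ) = β + r + 1 := by push_cast; ring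
      rw [e, Pi.add_apply]
      simp only [hx, response]
      linarith
    have h4 := Finset.sum_le_sum fun i (_ : i ∈ Finset.univ) => h1 i
    simp only [Finset.sum_add_distrib] at h4
    rw [hS]
    simp only [Pi.add_apply, add_mul, Pi.sub_apply, mul_sub, Finset.sum_add_distrib,
      Finset.sum_sub_distrib, ← Finset.sum_div] at h4 ih ⊢
    linarith

/-- Cauchy–Schwarz over the k slots, so the bound does not depend on the signs, and hence not on how
they were chosen. -/
theorem sum_fieldStep_sq_le (J : Tensor k n) (u : Fin k → Fin n) (s : Fin k → Fin 2) :
    ∑ i, J.fieldStep u s i ^ 2 ≤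
      ((n : ℝ) ^ (k - 1)) ^ 2 * (k * ∑ j, ∑ i, J (Function.update u j i) ^ 2) := by
  rw [Finset.sum_comm, Finset.mul_sum, Finset.mul_sum]
  refine Finset.sum_le_sum fun i _ => ?_
  rw [fieldStep, mul_pow]
  gcongr
  have := sq_sum_le_card_mul_sum_sq (s := Finset.univ)
    (f := fun j => bitSign (s j) * J (Function.update u j i))
  simpa [mul_pow, bitSign_sq] using this

theorem sum_sum_row_sq (J : Tensor k n) :
    ∑ u : Fin k → Fin n, ∑ j, ∑ i, J (Function.update u j i) ^ 2 = k * (n * ∑ u, J u ^ 2) := by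
  rw [Finset.sum_comm]
  have : ∀ j ∈ (Finset.univ : Finset (Fin k)), ∑ u : Fin k → Fin n, ∑ i,
      J (Function.update u j i) ^ 2 = n * ∑ u, J u ^ 2 := by
    intro j _
    have := sum_sum_update j (fun u : Fin k → Fin n => J u ^ 2)
    rw [Fintype.card_fin] at this
    exact this
  rw [Finset.sum_congr rfl this]
  simp

/-! ### The Gibbs measure -/

/-- The Gibbs measure. -/
def gibbs (J : Tensor k n) (X : Fin n → ℤˣ) : ℝ := Real.exp (J.energy X) / J.partitionFunction

theorem gibbs_nonneg (J : Tensor k n) (X : Fin n → ℤˣ) : 0 ≤ J.gibbs X :=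
  div_nonneg (Real.exp_pos _).le J.partitionFunction_pos.le

theorem sum_gibbs (J : Tensor k n) : ∑ X, J.gibbs X = 1 := by
  simp only [gibbs]
  rw [← Finset.sum_div]
  exact div_self J.partitionFunction_pos.ne'

/-- The entropy of the Gibbs measure. -/
def gibbsEntropy (J : Tensor k n) : ℝ := -∑ X, J.gibbs X * Real.log (J.gibbs X)

theorem gibbsEntropy_nonneg (J : Tensor k n) : 0 ≤ J.gibbsEntropy := by
  rw [gibbsEntropy, ← Finset.sum_neg_distrib]
  refine Finset.sum_nonneg fun X _ => ?_
  rw [neg_nonneg]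
  refine mul_nonpos_of_nonneg_of_nonpos (J.gibbs_nonneg X)
    (Real.log_nonpos (J.gibbs_nonneg X) ?_)
  rw [← J.sum_gibbs]
  exact Finset.single_le_sum (fun X _ => J.gibbs_nonneg X) (Finset.mem_univ X)

/-- The equality case of the variational principle. -/
theorem log_partitionFunction_eq (J : Tensor k n) :
    Real.log J.partitionFunction = ∑ X, J.gibbs X * J.energy X + J.gibbsEntropy := by
  have : ∀ X, J.gibbs X * Real.log (J.gibbs X) =
      J.gibbs X * J.energy X - J.gibbs X * Real.log J.partitionFunction := by
    intro X
    rw [gibbs, Real.log_div (Real.exp_pos _).ne' J.partitionFunction_pos.ne', Real.log_exp]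
    ring
  rw [gibbsEntropy, Finset.sum_congr rfl fun X _ => this X, Finset.sum_sub_distrib,
    ← Finset.sum_mul, sum_gibbs]
  ring

theorem sum_exp_sum_mul_spin (h : Fin n → ℝ) :
    ∑ X : Fin n → ℤˣ, Real.exp (∑ i, h i * spin X i) =
      ∏ i, (Real.exp (h i) + Real.exp (-h i)) := by
  have := Finset.prod_univ_sum (fun _ : Fin n => (Finset.univ : Finset ℤˣ))
    (fun i b => Real.exp (h i * ((b : ℤ) : ℝ)))
  rw [Fintype.piFinset_univ] at this
  simp only [Real.exp_sum, spin]
  rw [← this]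
  refine Finset.prod_congr rfl fun i _ => ?_
  rw [sum_units]
  simp

/-- Extension of a finite sequence to a periodic one. -/
def seqOf {α : Type*} {T : ℕ} [NeZero T] (f : Fin T → α) (r : ℕ) : α := f (Fin.ofNat T r)

theorem seqOf_of_lt {α : Type*} {T : ℕ} [NeZero T] (f : Fin T → α) {r : ℕ} (hr : r < T) :
    seqOf f r = f ⟨r, hr⟩ := by
  rw [seqOf]; congr 1; ext; simp [Nat.mod_eq_of_lt hr]

theorem seqOf_update {α : Type*} {T : ℕ} [NeZero T] (f : Fin T → α) (t : Fin T) (a : α) {r : ℕ}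
    (hr : r < t) : seqOf (Function.update f t a) r = seqOf f r := by
  rw [seqOf_of_lt _ (hr.trans t.2), seqOf_of_lt _ (hr.trans t.2), Function.update_of_ne]
  intro h
  rw [← h] at hr
  exact lt_irrefl _ hr

theorem seqOf_fin {α : Type*} {T : ℕ} [NeZero T] (f : Fin T → α) (t : Fin T) : seqOf f t = f t :=
  seqOf_of_lt f t.2

/-- The entropy of the Gibbs measure is at most the logarithm of the number of sign sequences plus
the expected code length for the product measures given by the fields. -/
theorem gibbsEntropy_le (J : Tensor k n) {L : ℕ} (hL : 1 ≤ L) {β : ℝ} (hβ : 0 ≤ β)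
    (T : ℕ) [NeZero T] (u : ℕ → Fin k → Fin n) :
    J.gibbsEntropy ≤ k * T + n / L + (∑ X, J.gibbs X *
      (∑ i, optValue L (β + T) (J.adaptField L β u (spin X) T i) -
        ∑ i, J.adaptField L β u (spin X) T i * spin X i)) / (β + T) := by
  have hT : (0 : ℝ) < T := by exact_mod_cast Nat.pos_of_ne_zero (NeZero.ne T)
  have hc : 0 < β + T := by positivity
  -- the code length of `X` in terms of a field `S`
  set ℓ : (Fin n → ℝ) → (Fin n → ℤˣ) → ℝ := fun S X =>
    ∑ i, S i / (β + T) * spin X i - ∑ i, (optValue L (β + T) (S i) / (β + T) + 1 / L) with hℓ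
  -- A Kraft inequality for a fixed field: the quantity in `ℓ` overestimates the logarithm of the
  -- normalizer.
  have h1 : ∀ S : Fin n → ℝ, ∑ X, Real.exp (ℓ S X) ≤ 1 := by
    intro S
    simp only [hℓ, Real.exp_sub]
    rw [← Finset.sum_div, sum_exp_sum_mul_spin, Real.exp_sum, div_le_one (by positivity)]
    refine Finset.prod_le_prod (fun i _ => by positivity) fun i _ => ?_
    rw [← Real.log_le_iff_le_exp (by positivity)]
    exact log_exp_add_exp_neg_le hL hc (S i)
  -- The field now depends on X, but only through kT sign bits, so the sum is at most the total over
  -- all sign sequences.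
  have h2 : ∑ X, Real.exp (ℓ (J.adaptField L β u (spin X) T) X) ≤ 2 ^ (k * T) := by
    have h3 : ∀ X, Real.exp (ℓ (J.adaptField L β u (spin X) T) X) ≤
        ∑ s : Fin T → Fin k → Fin 2, Real.exp (ℓ (J.field T u (seqOf s)) X) := by
      intro X
      refine le_trans (le_of_eq ?_) (Finset.single_le_sum (fun s _ => (Real.exp_pos _).le)
        (Finset.mem_univ (fun r : Fin T => J.adaptSign L β u (spin X) r)))
      rw [adaptField_eq, field_congr J (fun r hr => (seqOf_of_lt
        (fun r : Fin T => J.adaptSign L β u (spin X) r) hr).symm)]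
    refine (Finset.sum_le_sum fun X _ => h3 X).trans ?_
    rw [Finset.sum_comm]
    refine (Finset.sum_le_sum fun s _ => h1 _).trans ?_
    simp [pow_mul]
  have h4 := sum_mul_log_sub_log_le J.gibbs_nonneg J.sum_gibbs
    (w := fun X => Real.exp (ℓ (J.adaptField L β u (spin X) T) X)) (fun X => Real.exp_pos _)
  have h5 : Real.log (∑ X, Real.exp (ℓ (J.adaptField L β u (spin X) T) X)) ≤ k * T := by
    refine (Real.log_le_log (Finset.sum_pos (fun X _ => Real.exp_pos _)
      Finset.univ_nonempty) h2).trans ?_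
    rw [Real.log_pow]
    have : Real.log 2 ≤ 1 := by linarith [Real.log_two_lt_d9]
    push_cast
    exact mul_le_of_le_one_right (by positivity) this
  simp only [Real.log_exp, mul_sub, Finset.sum_sub_distrib] at h4
  have h6 : ∀ X, J.gibbs X * ℓ (J.adaptField L β u (spin X) T) X =
      -(J.gibbs X * (∑ i, optValue L (β + T) (J.adaptField L β u (spin X) T i) -
        ∑ i, J.adaptField L β u (spin X) T i * spin X i)) / (β + T) - J.gibbs X * (n / L) := by
    intro X
    simp only [hℓ, Finset.sum_add_distrib, ← Finset.sum_div, div_mul_eq_mul_div]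
    simp only [Finset.sum_const, Finset.card_univ, Fintype.card_fin, nsmul_eq_mul]
    field_simp
    ring
  rw [Finset.sum_congr rfl fun X _ => h6 X, Finset.sum_sub_distrib, ← Finset.sum_mul, sum_gibbs,
    ← Finset.sum_div, Finset.sum_neg_distrib] at h4
  rw [gibbsEntropy]
  rw [neg_div] at h4
  linarith

/-- The average over the random rows, the random time, and a Gibbs configuration that supplies the
signs, of the free energy of the response. -/
theorem le_sum_freeEnergy {J : Tensor k n} (hk : 0 < k) (hn : 0 < n) {Δ : ℝ} (hJ : J.IsDense Δ)
    (hΔ : 0 < Δ) {L : ℕ} (hL : 1 ≤ L) {β B : ℝ} (hβ : 0 ≤ β) (hB0 : 0 ≤ B)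
    (hB : k ^ 2 * J.l1Norm ^ 2 / (Δ * n) ≤ B * β) (T : ℕ) [NeZero T] :
    (Fintype.card (Fin T → Fin k → Fin n) : ℝ) *
      (T * Real.log J.partitionFunction - (β + T) * (k * T + n / L) - β * n - T * B) ≤
    ∑ τ ∈ Finset.range T, ∑ u : Fin T → Fin k → Fin n, ∑ X, J.gibbs X *
      J.freeEnergy L (response L (β + τ + 1) (J.adaptField L β (seqOf u) (spin X) τ)) := by
  have hT : (0 : ℝ) < T := by exact_mod_cast Nat.pos_of_ne_zero (NeZero.ne T)
  have hc : 0 < β + T := by positivity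
  have hn' : (0 : ℝ) < n := by exact_mod_cast hn
  set N : ℝ := (Fintype.card (Fin T → Fin k → Fin n) : ℝ) with hN
  have hpow : (n : ℝ) ^ k = n ^ (k - 1) * n := by rw [← pow_succ]; congr 1; omega
  have hU : (Fintype.card (Fin k → Fin n) : ℝ) = (n : ℝ) ^ k := by simp
  -- resampling of the row at time `τ`
  have hres : ∀ (τ : Fin T) (f : (Fin k → Fin n) → (Fin T → Fin k → Fin n) → ℝ),
      (∀ v w u, f v (Function.update u τ w) = f v u) →
      (n : ℝ) ^ k * ∑ u : Fin T → Fin k → Fin n, f (u τ) u = ∑ u : Fin T → Fin k → Fin n, ∑ v, f v u := by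
    intro τ f hf
    have := sum_sum_update τ (fun u : Fin T → Fin k → Fin n => f (u τ) u)
    rw [hU] at this
    rw [← this]
    simp only [Function.update_self, hf]
  have hupd : ∀ (τ : Fin T) (X : Fin n → ℝ) (w : Fin k → Fin n) (u : Fin T → Fin k → Fin n),
      J.adaptField L β (seqOf (Function.update u τ w)) X τ = J.adaptField L β (seqOf u) X τ :=
    fun τ X w u => J.adaptField_congr L β X fun r hr => seqOf_update u τ w hr
  -- the gain of a step
  have hgain : ∀ (X : Fin n → ℤˣ) (τ : Fin T), ∑ u : Fin T → Fin k → Fin n,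
      (J.energy X - J.meanEnergy (response L (β + τ + 1) (J.adaptField L β (seqOf u) (spin X) τ))) ≤
      ∑ u : Fin T → Fin k → Fin n, (n : ℝ) ^ (k - 1) * ∑ j, |J.rowPair (seqOf u τ) j
        (spin X - response L (β + τ + 1) (J.adaptField L β (seqOf u) (spin X) τ))| := by
    intro X τ
    have h1 := hres τ (fun v u => (n : ℝ) ^ (k - 1) * ∑ j, |J.rowPair v j
        (spin X - response L (β + τ + 1) (J.adaptField L β (seqOf u) (spin X) τ))|)
      (fun v w u => by simp only [hupd])
    simp only [seqOf_fin]
    refine le_of_mul_le_mul_left ?_ (pow_pos hn' k)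
    rw [h1, Finset.mul_sum]
    refine Finset.sum_le_sum fun u _ => ?_
    rw [← Finset.mul_sum, hpow, mul_assoc]
    refine mul_le_mul_of_nonneg_left ?_ (by positivity)
    refine le_trans ?_ (J.abs_meanEnergy_sub_le_rowPair (fun i => (abs_spin X i).le)
      (fun i => abs_response_le L _ _ i))
    exact mul_le_mul_of_nonneg_left (le_abs_self _) hn'.le
  -- the variance of a step
  have hvar : ∀ (X : Fin n → ℤˣ) (τ : Fin T), ∑ u : Fin T → Fin k → Fin n,
      (∑ i, J.fieldStep (seqOf u τ) (J.adaptSign L β (seqOf u) (spin X) τ) i ^ 2) / (β + τ + 1) ≤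
      N * B := by
    intro X τ
    -- For the zero tensor β may vanish; the summand 1 keeps the denominator positive.
    have hcτ : 0 < β + τ + 1 := by positivity
    have h1 := hres τ (fun v _ => ((n : ℝ) ^ (k - 1)) ^ 2 *
      (k * ∑ j, ∑ i, J (Function.update v j i) ^ 2)) (fun v w u => rfl)
    have h2 : (n : ℝ) ^ k * ∑ u : Fin T → Fin k → Fin n,
        (∑ i, J.fieldStep (seqOf u τ) (J.adaptSign L β (seqOf u) (spin X) τ) i ^ 2) ≤
        (n : ℝ) ^ k * (N * (k ^ 2 * J.l1Norm ^ 2 / (Δ * n))) := by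
      refine (mul_le_mul_of_nonneg_left (Finset.sum_le_sum fun u _ =>
        J.sum_fieldStep_sq_le _ _) (by positivity)).trans ?_
      simp only [seqOf_fin]
      rw [h1]
      rw [Finset.sum_const, Finset.card_univ, nsmul_eq_mul, ← hN, ← Finset.mul_sum,
        ← Finset.mul_sum, sum_sum_row_sq]
      have h3 := hJ.sum_sq_le hΔ
      have h4 : (n : ℝ) ^ k * (N * (k ^ 2 * J.l1Norm ^ 2 / (Δ * n))) =
          N * (((n : ℝ) ^ (k - 1)) ^ 2 * (k * (k * (n * (J.l1Norm ^ 2 / (Δ * n ^ k)))))) := by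
        rw [hpow]; field_simp
      rw [h4]
      gcongr
    have h5 := le_of_mul_le_mul_left h2 (pow_pos hn' k)
    rw [← Finset.sum_div, div_le_iff₀ hcτ, mul_assoc]
    refine h5.trans (mul_le_mul_of_nonneg_left (hB.trans ?_) (Nat.cast_nonneg _))
    gcongr
    have : (0 : ℝ) ≤ τ := Nat.cast_nonneg _
    linarith
  -- summing the potential inequality
  have hsum : ∀ X : Fin n → ℤˣ, ∑ u : Fin T → Fin k → Fin n,
      (∑ i, optValue L (β + T) (J.adaptField L β (seqOf u) (spin X) T i) -
        ∑ i, J.adaptField L β (seqOf u) (spin X) T i * spin X i) ≤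
      N * (β * n) + (∑ τ ∈ Finset.range T, ∑ u : Fin T → Fin k → Fin n,
        J.freeEnergy L (response L (β + τ + 1) (J.adaptField L β (seqOf u) (spin X) τ))) -
        N * (T * J.energy X) + N * (T * B) := by
    intro X
    refine (Finset.sum_le_sum fun u _ =>
      J.optValue_adaptField_le hL hβ (seqOf u) (spin X) T).trans ?_
    rw [Finset.sum_add_distrib, Finset.sum_comm]
    have h1 : ∀ τ ∈ Finset.range T, ∑ u : Fin T → Fin k → Fin n,
        (∑ i, truncEntropy L (response L (β + τ + 1) (J.adaptField L β (seqOf u) (spin X) τ) i) -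
          (n : ℝ) ^ (k - 1) * ∑ j, |J.rowPair (seqOf u τ) j
            (spin X - response L (β + τ + 1) (J.adaptField L β (seqOf u) (spin X) τ))| +
          (∑ i, J.fieldStep (seqOf u τ) (J.adaptSign L β (seqOf u) (spin X) τ) i ^ 2) /
            (β + τ + 1)) ≤
        (∑ u : Fin T → Fin k → Fin n,
          J.freeEnergy L (response L (β + τ + 1) (J.adaptField L β (seqOf u) (spin X) τ))) -
          N * J.energy X + N * B := by
      intro τ hτ
      have h2 := hgain X ⟨τ, Finset.mem_range.1 hτ⟩
      have h3 := hvar X ⟨τ, Finset.mem_range.1 hτ⟩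
      simp only [freeEnergy, Finset.sum_add_distrib, Finset.sum_sub_distrib] at h2 h3 ⊢
      simp only [Finset.sum_const, Finset.card_univ, nsmul_eq_mul, ← hN] at h2 ⊢
      linarith
    have h4 := Finset.sum_le_sum h1
    simp only [Finset.sum_add_distrib, Finset.sum_sub_distrib] at h4
    simp only [Finset.sum_const, Finset.card_univ, Finset.card_range, nsmul_eq_mul, ← hN] at h4 ⊢
    simp only [Finset.sum_add_distrib, Finset.sum_sub_distrib]
    linarith
  -- The entropy bound holds for every choice of the rows and is summed over all of them.
  have hent : N * ((β + T) * (J.gibbsEntropy - (k * T + n / L))) ≤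
      ∑ X, J.gibbs X * ∑ u : Fin T → Fin k → Fin n,
      (∑ i, optValue L (β + T) (J.adaptField L β (seqOf u) (spin X) T i) -
        ∑ i, J.adaptField L β (seqOf u) (spin X) T i * spin X i) := by
    simp only [Finset.mul_sum (s := (Finset.univ : Finset (Fin T → Fin k → Fin n)))]
    rw [Finset.sum_comm]
    have : N * ((β + T) * (J.gibbsEntropy - (k * T + n / L))) =
        ∑ u : Fin T → Fin k → Fin n, (β + T) * (J.gibbsEntropy - (k * T + n / L)) := by
      simp only [Finset.sum_const, Finset.card_univ, nsmul_eq_mul, ← hN]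
    rw [this]
    refine Finset.sum_le_sum fun u _ => ?_
    have h1 := J.gibbsEntropy_le hL hβ T (seqOf u)
    rw [mul_comm, ← le_div_iff₀ hc]
    linarith
  have hfin := hent.trans (Finset.sum_le_sum fun X _ =>
    mul_le_mul_of_nonneg_left (hsum X) (J.gibbs_nonneg X))
  have hswap : ∑ τ ∈ Finset.range T, ∑ u : Fin T → Fin k → Fin n, ∑ X, J.gibbs X *
      J.freeEnergy L (response L (β + τ + 1) (J.adaptField L β (seqOf u) (spin X) τ)) =
      ∑ X, J.gibbs X * ∑ τ ∈ Finset.range T, ∑ u : Fin T → Fin k → Fin n,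
      J.freeEnergy L (response L (β + τ + 1) (J.adaptField L β (seqOf u) (spin X) τ)) := by
    simp only [Finset.mul_sum]
    symm
    rw [Finset.sum_comm]
    exact Finset.sum_congr rfl fun τ _ => Finset.sum_comm
  rw [hswap]
  simp only [mul_sub, mul_add, Finset.sum_add_distrib, Finset.sum_sub_distrib] at hfin ⊢
  simp only [← Finset.sum_mul, sum_gibbs, one_mul] at hfin
  have hE : ∑ X, J.gibbs X * (N * (T * J.energy X)) = N * (T * ∑ X, J.gibbs X * J.energy X) := by
    simp only [Finset.mul_sum]
    exact Finset.sum_congr rfl fun X _ => by ring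
  rw [hE] at hfin
  rw [log_partitionFunction_eq]
  -- The potential carries the weight β + T, but T copies of the Gibbs entropy suffice; the other β
  -- are nonnegative and dropped.
  have h0 : 0 ≤ N * (β * J.gibbsEntropy) :=
    mul_nonneg (Nat.cast_nonneg _) (mul_nonneg hβ J.gibbsEntropy_nonneg)
  nlinarith

/-- The bits for which the response at time `τ` is good, counted over all rows and times. -/
theorem card_good_ge {J : Tensor k n} (hk : 0 < k) (hn : 0 < n) {Δ : ℝ} (hJ : J.IsDense Δ)
    (hΔ : 0 < Δ) {L : ℕ} (hL : 1 ≤ L) {β B : ℝ} (hβ : 0 ≤ β) (hB0 : 0 ≤ B)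
    (hB : k ^ 2 * J.l1Norm ^ 2 / (Δ * n) ≤ B * β) (T : ℕ) [NeZero T] {e₁ e₂ θ : ℝ}
    (he₁ : (β + T) * (k * T + n / L) + β * n + T * B ≤ T * e₁)
    (he₂ : 2 * k ^ 2 * J.l1Norm / (Δ * n) ≤ e₂)
    (hθ : 2 * (e₁ + e₂) ≤ θ + e₂) (hθ0 : 0 < θ + e₂) :
    (T : ℝ) * Fintype.card (Fin T → Fin k → Fin n) / 2 ≤
      ∑ τ ∈ Finset.range T, ∑ u : Fin T → Fin k → Fin n, ∑ s : Fin T → Fin k → Fin 2,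
        if Real.log J.partitionFunction - θ ≤
          J.freeEnergy L (response L (β + τ + 1) (J.field τ (seqOf u) (seqOf s))) then 1 else 0 := by
  have h1 := le_sum_freeEnergy hk hn hJ hΔ hL hβ hB0 hB T
  set N : ℝ := (Fintype.card (Fin T → Fin k → Fin n) : ℝ) with hN
  set Z := Real.log J.partitionFunction with hZ
  have hF : ∀ x : Fin n → ℝ, (∀ i, |x i| ≤ 1) → J.freeEnergy L x ≤ Z + e₂ := by
    intro x hx
    have h2 := meanEnergy_add_spinEntropy_le hJ hΔ hn hx
    have h3 := Finset.sum_le_sum fun i (_ : i ∈ Finset.univ) => truncEntropy_le_spinEntropy L (hx i)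
    rw [freeEnergy]
    linarith
  -- For fixed time and rows, a Gibbs average above log Z - θ forces at least one good sign
  -- sequence. The excess is at most θ + e₂, so it is bounded by θ + e₂ times the number of good
  -- sequences.
  have h2 : ∀ τ ∈ Finset.range T, ∀ u ∈ (Finset.univ : Finset (Fin T → Fin k → Fin n)),
      ∑ X, J.gibbs X * J.freeEnergy L
        (response L (β + τ + 1) (J.adaptField L β (seqOf u) (spin X) τ)) ≤
      (Z - θ) + (θ + e₂) * ∑ s : Fin T → Fin k → Fin 2,
        if Z - θ ≤ J.freeEnergy L (response L (β + τ + 1) (J.field τ (seqOf u) (seqOf s)))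
          then (1 : ℝ) else 0 := by
    intro τ hτ u _
    rw [Finset.mem_range] at hτ
    have h3 : ∀ X, J.freeEnergy L
        (response L (β + τ + 1) (J.adaptField L β (seqOf u) (spin X) τ)) ≤
        (Z - θ) + (θ + e₂) * ∑ s : Fin T → Fin k → Fin 2,
        if Z - θ ≤ J.freeEnergy L (response L (β + τ + 1) (J.field τ (seqOf u) (seqOf s)))
          then (1 : ℝ) else 0 := by
      intro X
      by_cases hX : Z - θ ≤ J.freeEnergy L
        (response L (β + τ + 1) (J.adaptField L β (seqOf u) (spin X) τ))
      · have h4 := hF _ (abs_response_le L (β + τ + 1) (J.adaptField L β (seqOf u) (spin X) τ))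
        have h5 : (1 : ℝ) ≤ ∑ s : Fin T → Fin k → Fin 2,
            if Z - θ ≤ J.freeEnergy L (response L (β + τ + 1) (J.field τ (seqOf u) (seqOf s)))
              then (1 : ℝ) else 0 := by
          refine le_trans (le_of_eq ?_) (Finset.single_le_sum (fun s _ => by
            split_ifs <;> norm_num)
            (Finset.mem_univ (fun r : Fin T => J.adaptSign L β (seqOf u) (spin X) r)))
          rw [if_pos]
          rw [adaptField_eq] at hX
          rwa [field_congr J fun r hr => seqOf_of_lt _ (hr.trans hτ)]
        nlinarith
      · have h5 : (0 : ℝ) ≤ ∑ s : Fin T → Fin k → Fin 2,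
            if Z - θ ≤ J.freeEnergy L (response L (β + τ + 1) (J.field τ (seqOf u) (seqOf s)))
              then (1 : ℝ) else 0 := Finset.sum_nonneg fun s _ => by split_ifs <;> norm_num
        nlinarith
    refine (Finset.sum_le_sum fun X _ =>
      mul_le_mul_of_nonneg_left (h3 X) (J.gibbs_nonneg X)).trans ?_
    rw [← Finset.sum_mul, sum_gibbs, one_mul]
  have h3 := h1.trans (Finset.sum_le_sum fun τ hτ => Finset.sum_le_sum (h2 τ hτ))
  simp only [Finset.sum_add_distrib, ← Finset.mul_sum] at h3
  simp only [Finset.sum_const, Finset.card_univ, Finset.card_range, nsmul_eq_mul, ← hN] at h3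
  have hN0 : 0 ≤ N := Nat.cast_nonneg _
  have h4 := mul_le_mul_of_nonneg_left he₁ hN0
  have h5 := mul_le_mul_of_nonneg_left hθ (mul_nonneg (Nat.cast_nonneg T : (0 : ℝ) ≤ T) hN0)
  refine le_of_mul_le_mul_left ?_ hθ0
  nlinarith

end Tensor

namespace RealRAM

variable {k n : ℕ}

/-! ### Rules for success probabilities and for deterministic program fragments -/

theorem stepN_add (J : Tensor k n) (s t : ℕ) (c : Config k) :
    stepN J (s + t) c = (stepN J s c).bind (stepN J t) := by
  induction s generalizing c with
  | zero => simp [stepN]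
  | succ s ih =>
    rw [Nat.succ_add, stepN, stepN, PMF.bind_bind]
    congr 1
    funext c'
    exact ih c'

theorem stepN_halted (J : Tensor k n) (t : ℕ) (σ : State) :
    stepN J t (([] : List (Prog k)), σ) = PMF.pure ([], σ) := by
  induction t with
  | zero => rfl
  | succ t ih => rw [stepN, step, PMF.pure_bind, ih]

/-- The probability that after `t` steps from `c` the machine has halted with an output in `S`. -/
def winProb (J : Tensor k n) (S : Set ℝ) (c : Config k) (t : ℕ) : ℝ≥0∞ :=
  (stepN J t c).toOuterMeasure {c | c.1 = [] ∧ c.2.output ∈ S}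

theorem winProb_le_one (J : Tensor k n) (S : Set ℝ) (c : Config k) (t : ℕ) :
    winProb J S c t ≤ 1 := by
  rw [winProb, ← (stepN J t c).tsum_coe, PMF.toOuterMeasure_apply]
  exact ENNReal.tsum_le_tsum fun a => Set.indicator_le_self _ _ _

/-- Every run from `c` halts within `t` steps, and the output is in `S` with probability at
least `q`. -/
def Wins (J : Tensor k n) (S : Set ℝ) (c : Config k) (t : ℕ) (q : ℝ) : Prop :=
  (∀ c' ∈ (stepN J t c).support, c'.1 = []) ∧ q ≤ (winProb J S c t).toReal

/-- For q ≤ 0 nothing is claimed about the output, which covers the unsuccessful outcomes. -/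
theorem Wins.halted (J : Tensor k n) {S : Set ℝ} {σ : State} {q : ℝ}
    (h : 0 < q → q ≤ 1 ∧ σ.output ∈ S) : Wins J S ([], σ) 0 q := by
  refine ⟨fun c' hc => ?_, ?_⟩
  · rw [stepN, PMF.mem_support_pure_iff] at hc
    rw [hc]
  · by_cases hq : 0 < q
    · obtain ⟨h1, h2⟩ := h hq
      rw [winProb, stepN, PMF.toOuterMeasure_pure_apply, if_pos ⟨rfl, h2⟩]
      simpa using h1
    · exact (not_lt.1 hq).trans ENNReal.toReal_nonneg

theorem Wins.mono_prob {J : Tensor k n} {S : Set ℝ} {c : Config k} {t : ℕ} {q q' : ℝ}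
    (h : Wins J S c t q) (hq : q' ≤ q) : Wins J S c t q' := ⟨h.1, hq.trans h.2⟩

/-- Halted configurations are fixed, so waiting longer changes nothing. This aligns branches with
different running times. -/
theorem Wins.mono {J : Tensor k n} {S : Set ℝ} {c : Config k} {t t' : ℕ} {q : ℝ}
    (h : Wins J S c t q) (ht : t ≤ t') : Wins J S c t' q := by
  obtain ⟨s, rfl⟩ := Nat.exists_eq_add_of_le ht
  have : stepN J (t + s) c = stepN J t c := by
    rw [stepN_add]
    conv_rhs => rw [← PMF.bind_pure (stepN J t c)]
    ext a
    rw [PMF.bind_apply, PMF.bind_apply]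
    refine tsum_congr fun c' => ?_
    by_cases hc : c' ∈ (stepN J t c).support
    · obtain ⟨K, σ⟩ := c'
      obtain rfl : K = [] := h.1 _ hc
      rw [stepN_halted]
    · rw [PMF.mem_support_iff, not_not] at hc
      rw [hc, zero_mul, zero_mul]
  rw [Wins, winProb, this]
  exact h

theorem Wins.of_pure {J : Tensor k n} {S : Set ℝ} {c c' : Config k} {s t : ℕ} {q : ℝ}
    (hc : stepN J s c = PMF.pure c') (h : Wins J S c' t q) : Wins J S c (s + t) q := by
  rw [Wins, winProb, stepN_add, hc, PMF.pure_bind]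
  exact h

theorem Wins.of_step {J : Tensor k n} {S : Set ℝ} {c c' : Config k} {t : ℕ} {q : ℝ}
    (hc : step J c = PMF.pure c') (h : Wins J S c' t q) : Wins J S c (t + 1) q := by
  rw [Wins, winProb, stepN, hc, PMF.pure_bind]
  exact h

/-- The success probability of a draw is the average over its outcomes; the bound may depend on the
outcome, the time bound may not. -/
theorem Wins.rand {J : Tensor k n} {S : Set ℝ} {K : List (Prog k)} {σ : State} {a : ℕ}
    {i e : NExpr} {t m : ℕ} (hm : e.eval σ = m) {q : ℕ → ℝ}
    (h : ∀ v ≤ m, Wins J S (K, σ.setNat a (i.eval σ) v) t (q v)) :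
    Wins J S (.rand a i e :: K, σ) (t + 1) ((∑ v ∈ Finset.range (m + 1), q v) / (m + 1)) := by
  subst hm
  have e1 : stepN J (t + 1) (.rand a i e :: K, σ) =
      (PMF.uniformOfFintype (Fin (e.eval σ + 1))).bind
        (fun v => stepN J t (K, σ.setNat a (i.eval σ) v.val)) := by
    rw [stepN, step, PMF.bind_map]
    rfl
  refine ⟨fun c' hc => ?_, ?_⟩
  · rw [e1, PMF.mem_support_bind_iff] at hc
    obtain ⟨v, -, hv⟩ := hc
    exact (h v (by omega)).1 c' hv
  · rw [winProb, e1, PMF.toOuterMeasure_bind_apply, tsum_fintype, ENNReal.toReal_sum]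
    · rw [Finset.sum_range, Finset.sum_div]
      refine Finset.sum_le_sum fun v _ => ?_
      rw [ENNReal.toReal_mul, PMF.uniformOfFintype_apply, Fintype.card_fin, ENNReal.toReal_inv,
        div_eq_inv_mul]
      have := (h v (by omega)).2
      have e2 : (((e.eval σ + 1 : ℕ) : ℝ≥0∞)).toReal = (e.eval σ : ℝ) + 1 := by
        rw [ENNReal.toReal_natCast]; push_cast; rfl
      rw [e2]
      exact mul_le_mul_of_nonneg_left this (by positivity)
    · intro v _
      refine ENNReal.mul_ne_top (PMF.apply_ne_top _ _) ?_
      exact ((winProb_le_one J S _ t).trans_lt ENNReal.one_lt_top).ne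

theorem Wins.seq {J : Tensor k n} {S : Set ℝ} {K : List (Prog k)} {σ : State} {p p' : Prog k}
    {t : ℕ} {q : ℝ} (h : Wins J S (p :: p' :: K, σ) t q) :
    Wins J S (.seq p p' :: K, σ) (t + 1) q := Wins.of_step rfl h

theorem Wins.loop_true {J : Tensor k n} {S : Set ℝ} {K : List (Prog k)} {σ : State} {b : BExpr k}
    {p : Prog k} {t : ℕ} {q : ℝ} (hb : b.eval J σ = true)
    (h : Wins J S (p :: .loop b p :: K, σ) t q) : Wins J S (.loop b p :: K, σ) (t + 1) q :=
  Wins.of_step (by rw [step, if_pos hb]) h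

theorem Wins.loop_false {J : Tensor k n} {S : Set ℝ} {K : List (Prog k)} {σ : State} {b : BExpr k}
    {p : Prog k} {t : ℕ} {q : ℝ} (hb : b.eval J σ = false)
    (h : Wins J S (K, σ) t q) : Wins J S (.loop b p :: K, σ) (t + 1) q :=
  Wins.of_step (by rw [step, hb, if_neg (by simp)]) h

/-- Without random draws, `p` leads from `σ` within `B` steps to a state with the property
`Post`. -/
def Exec (J : Tensor k n) (B : ℕ) (p : Prog k) (σ : State) (Post : State → Prop) : Prop :=
  ∃ t ≤ B, ∃ σ', Post σ' ∧ ∀ K, stepN J t (p :: K, σ) = PMF.pure (K, σ')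

theorem Wins.exec {J : Tensor k n} {S : Set ℝ} {K : List (Prog k)} {σ : State} {p : Prog k}
    {B t : ℕ} {q : ℝ} {Post : State → Prop} (hp : Exec J B p σ Post)
    (h : ∀ σ', Post σ' → Wins J S (K, σ') t q) : Wins J S (p :: K, σ) (B + t) q := by
  obtain ⟨s, hs, σ', h1, h2⟩ := hp
  exact (Wins.of_pure (h2 K) (h σ' h1)).mono (by omega)

theorem Exec.mono {J : Tensor k n} {B B' : ℕ} {p : Prog k} {σ : State} {Post Post' : State → Prop}
    (h : Exec J B p σ Post) (hB : B ≤ B') (hP : ∀ σ', Post σ' → Post' σ') :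
    Exec J B' p σ Post' := by
  obtain ⟨t, ht, σ', h1, h2⟩ := h
  exact ⟨t, ht.trans hB, σ', hP _ h1, h2⟩

theorem Exec.skip (J : Tensor k n) {σ : State} {Post : State → Prop} (h : Post σ) :
    Exec J 1 .skip σ Post :=
  ⟨1, le_rfl, σ, h, fun K => by rw [stepN, step, PMF.pure_bind]; rfl⟩

theorem Exec.setNat (J : Tensor k n) {σ : State} {a : ℕ} {i e : NExpr} {Post : State → Prop}
    (h : Post (σ.setNat a (i.eval σ) (e.eval σ))) : Exec J 1 (.setNat a i e) σ Post :=
  ⟨1, le_rfl, _, h, fun K => by rw [stepN, step, PMF.pure_bind]; rfl⟩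

theorem Exec.setReal (J : Tensor k n) {σ : State} {a : ℕ} {i : NExpr} {e : RExpr k}
    {Post : State → Prop} (h : Post (σ.setReal a (i.eval σ) (e.eval J σ))) :
    Exec J 1 (.setReal a i e) σ Post :=
  ⟨1, le_rfl, _, h, fun K => by rw [stepN, step, PMF.pure_bind]; rfl⟩

theorem Exec.seq {J : Tensor k n} {σ : State} {p q : Prog k} {B₁ B₂ : ℕ}
    {Mid Post : State → Prop} (h1 : Exec J B₁ p σ Mid) (h2 : ∀ σ', Mid σ' → Exec J B₂ q σ' Post) :
    Exec J (B₁ + B₂ + 1) (.seq p q) σ Post := by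
  obtain ⟨t1, ht1, σ1, hm, e1⟩ := h1
  obtain ⟨t2, ht2, σ2, hp, e2⟩ := h2 σ1 hm
  refine ⟨t1 + t2 + 1, by omega, σ2, hp, fun K => ?_⟩
  rw [stepN, step, PMF.pure_bind, stepN_add, e1, PMF.pure_bind, e2]

theorem Exec.ite {J : Tensor k n} {σ : State} {b : BExpr k} {p q : Prog k} {B : ℕ}
    {Post : State → Prop} (h1 : b.eval J σ = true → Exec J B p σ Post)
    (h2 : b.eval J σ = false → Exec J B q σ Post) :
    Exec J (B + 1) (.ite b p q) σ Post := by
  cases hb : b.eval J σ with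
  | true =>
    obtain ⟨t, ht, σ', hp, e⟩ := h1 hb
    refine ⟨t + 1, by omega, σ', hp, fun K => ?_⟩
    rw [stepN, step, PMF.pure_bind, if_pos hb, e]
  | false =>
    obtain ⟨t, ht, σ', hp, e⟩ := h2 hb
    refine ⟨t + 1, by omega, σ', hp, fun K => ?_⟩
    rw [stepN, step, PMF.pure_bind, hb, if_neg (by simp), e]

theorem Exec.loop {J : Tensor k n} {b : BExpr k} {p : Prog k} {B : ℕ} (Inv : ℕ → State → Prop)
    (m : ℕ) {σ : State} (h0 : Inv 0 σ)
    (ht : ∀ i < m, ∀ σ', Inv i σ' → b.eval J σ' = true ∧ Exec J B p σ' (Inv (i + 1)))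
    (hf : ∀ σ', Inv m σ' → b.eval J σ' = false) :
    Exec J (m * (B + 1) + 1) (.loop b p) σ (Inv m) := by
  induction m generalizing Inv σ with
  | zero =>
    refine ⟨1, by omega, σ, h0, fun K => ?_⟩
    rw [stepN, step, PMF.pure_bind, hf σ h0, if_neg (by simp)]
    rfl
  | succ m ih =>
    obtain ⟨hb, t, htB, σ1, h1, e1⟩ := ht 0 (by omega) σ h0
    -- After one passage the remaining loop satisfies the same hypotheses with the shifted
    -- invariant.
    obtain ⟨t2, ht2, σ2, h2, e2⟩ := ih (fun i => Inv (i + 1)) h1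
      (fun i hi σ' h => ht (i + 1) (by omega) σ' h) hf
    refine ⟨t + t2 + 1, by rw [Nat.succ_mul]; omega, σ2, h2, fun K => ?_⟩
    rw [stepN, step, PMF.pure_bind, if_pos hb, stepN_add, e1, PMF.pure_bind, e2]

/-! ### Memory access -/

@[simp] theorem State.setNat_nat_same (σ : State) (a i v j : ℕ) :
    (σ.setNat a i v).nat a j = if j = i then v else σ.nat a j := by
  simp [State.setNat, Function.update_apply]

@[simp] theorem State.setNat_nat_ne (σ : State) {a b : ℕ} (h : b ≠ a) (i v : ℕ) :
    (σ.setNat a i v).nat b = σ.nat b := by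
  simp [State.setNat, h]

@[simp] theorem State.setNat_real (σ : State) (a i v : ℕ) : (σ.setNat a i v).real = σ.real := rfl

@[simp] theorem State.setReal_real_same (σ : State) (a i : ℕ) (v : ℝ) (j : ℕ) :
    (σ.setReal a i v).real a j = if j = i then v else σ.real a j := by
  simp [State.setReal, Function.update_apply]

@[simp] theorem State.setReal_real_ne (σ : State) {a b : ℕ} (h : b ≠ a) (i : ℕ) (v : ℝ) :
    (σ.setReal a i v).real b = σ.real b := by
  simp [State.setReal, h]

@[simp] theorem State.setReal_nat (σ : State) (a i : ℕ) (v : ℝ) :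
    (σ.setReal a i v).nat = σ.nat := rfl

/-- `σ'` differs from `σ` at most in the arrays `A` of natural numbers and `B` of real numbers. -/
def Frame (A B : Finset ℕ) (σ σ' : State) : Prop :=
  (∀ a ∉ A, σ'.nat a = σ.nat a) ∧ ∀ b ∉ B, σ'.real b = σ.real b

theorem Frame.refl (A B : Finset ℕ) (σ : State) : Frame A B σ σ := ⟨fun _ _ => rfl, fun _ _ => rfl⟩

theorem Frame.trans {A B : Finset ℕ} {σ σ' σ'' : State} (h : Frame A B σ σ')
    (h' : Frame A B σ' σ'') : Frame A B σ σ'' :=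
  ⟨fun a ha => (h'.1 a ha).trans (h.1 a ha), fun b hb => (h'.2 b hb).trans (h.2 b hb)⟩

theorem Frame.mono {A B A' B' : Finset ℕ} {σ σ' : State} (h : Frame A B σ σ') (hA : A ⊆ A')
    (hB : B ⊆ B') : Frame A' B' σ σ' :=
  ⟨fun a ha => h.1 a fun h => ha (hA h), fun b hb => h.2 b fun h => hb (hB h)⟩

theorem Frame.setNat {A B : Finset ℕ} {σ σ' : State} (h : Frame A B σ σ') {a : ℕ} (ha : a ∈ A)
    (i v : ℕ) : Frame A B σ (σ'.setNat a i v) :=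
  ⟨fun b hb => by
    rw [State.setNat_nat_ne _ (by rintro rfl; exact hb ha), h.1 b hb], fun b hb => h.2 b hb⟩

theorem Frame.setReal {A B : Finset ℕ} {σ σ' : State} (h : Frame A B σ σ') {b : ℕ} (hb : b ∈ B)
    (i : ℕ) (v : ℝ) : Frame A B σ (σ'.setReal b i v) :=
  ⟨fun a ha => h.1 a ha, fun a ha => by
    rw [State.setReal_real_ne _ (by rintro rfl; exact ha hb), h.2 a ha]⟩

/-! ### Counting loops -/

/-- `for (cell c of the array a) from 0 while below e do body`. -/
def forN (a c : ℕ) (e : NExpr) (body : Prog k) : Prog k :=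
  .seq (.setNat a (.const c) (.const 0))
    (.loop (.natLt (.cell a (.const c)) e)
      (.seq body (.setNat a (.const c) (.add (.cell a (.const c)) (.const 1)))))

/-- The invariant is stated with the counter already advanced; the body must leave the counter
unchanged, and the bound of the loop is reevaluated at every test. -/
theorem Exec.forN {J : Tensor k n} {a c : ℕ} {e : NExpr} {body : Prog k} {B : ℕ}
    (Inv : ℕ → State → Prop) (m : ℕ) {σ : State} (h0 : Inv 0 (σ.setNat a c 0))
    (hm : ∀ i ≤ m, ∀ σ', Inv i σ' → e.eval σ' = m)
    (hb : ∀ i < m, ∀ σ', Inv i σ' → σ'.nat a c = i →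
      Exec J B body σ' (fun σ'' => σ''.nat a c = i ∧ Inv (i + 1) (σ''.setNat a c (i + 1)))) :
    Exec J (m * (B + 3) + 3) (forN a c e body) σ (Inv m) := by
  have h1 := Exec.loop (J := J) (b := .natLt (.cell a (.const c)) e)
    (p := .seq body (.setNat a (.const c) (.add (.cell a (.const c)) (.const 1)))) (B := B + 2)
    (fun i σ' => Inv i σ' ∧ σ'.nat a c = i) m (σ := σ.setNat a c 0) ⟨h0, by simp⟩
    (fun i hi σ' h => ⟨by simp [BExpr.eval, NExpr.eval, h.2, hm i hi.le σ' h.1, hi],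
      (Exec.seq (hb i hi σ' h.1 h.2) (fun σ'' h' => Exec.setNat J (by
        simp only [NExpr.eval, h'.1]
        exact ⟨h'.2, by simp⟩))).mono (by omega) (fun _ h => h)⟩)
    (fun σ' h => by simp [BExpr.eval, NExpr.eval, h.2, hm m le_rfl σ' h.1])
  refine (Exec.seq (Mid := fun σ' => σ' = σ.setNat a c 0) (Exec.setNat J rfl)
    (fun σ' h => ?_)).mono (B := 1 + (m * (B + 2 + 1) + 1) + 1) (by
      rw [show B + 2 + 1 = B + 3 from rfl]; omega) (fun _ h => h)
  rw [h]
  exact h1.mono le_rfl fun _ h => h.1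

/-! ### Nested loops over all tuples of nodes -/

/-- The loops over the first `d` indices, which are stored in the cells of the array `a`; the
number of nodes is in cell `0` of the array `0`. -/
def nest (a : ℕ) (body : Prog k) : ℕ → Prog k
  | 0 => body
  | d + 1 => forN a d (.cell 0 (.const 0)) (nest a body d)

/-- Induction on the number of inner loops: the indices from d on are frozen to w, and the
accumulator receives the sum over the tuples that agree with w there. -/
theorem exec_nest {J : Tensor k n} {a acc : ℕ} (ha : a ≠ 0) {body : Prog k} {b : ℕ}
    {R : Finset ℕ} {f : (Fin k → Fin n) → ℝ} {σ₀ : State} (hσ₀ : σ₀.nat 0 0 = n)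
    (hbody : ∀ σ (u : Fin k → Fin n), Frame {a} R σ₀ σ → (∀ j : Fin k, σ.nat a j = u j) →
      Exec J b body σ fun σ' => Frame ∅ R σ σ' ∧ σ'.real acc 0 = σ.real acc 0 + f u)
    (hn : 0 < n) {d : ℕ} (hd : d ≤ k) {σ : State} (hF : Frame {a} R σ₀ σ) (w : Fin k → Fin n)
    (hw : ∀ j : Fin k, d ≤ j → σ.nat a j = w j) :
    Exec J (n ^ d * (b + 6 * d)) (nest a body d) σ fun σ' => Frame {a} R σ₀ σ' ∧
      (∀ j : ℕ, d ≤ j → σ'.nat a j = σ.nat a j) ∧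
      σ'.real acc 0 = σ.real acc 0 + ∑ u : Fin k → Fin n, if ∀ j : Fin k, d ≤ j → u j = w j
        then f u else 0 := by
  induction d generalizing σ w with
  | zero =>
    refine (hbody σ w hF fun j => hw j (Nat.zero_le _)).mono (by simp) fun σ' h => ⟨?_, ?_, ?_⟩
    · exact hF.trans (h.1.mono (by simp) subset_rfl)
    · intro j _; rw [h.1.1 a (by simp)]
    · rw [h.2, Finset.sum_eq_single w]
      · simp
      · intro u _ hu
        rw [if_neg]
        intro h
        exact hu (funext fun j => h j (Nat.zero_le _))
      · simp
  | succ d ih =>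
    -- The tuples with index d below m + 1 split into those with index below m and those with index
    -- m.
    have hsum : ∀ m ≤ n, ∀ i : Fin n, m = i →
        (∑ u : Fin k → Fin n, if ∀ j : Fin k, d + 1 ≤ j → u j = w j then
          (if u ⟨d, hd⟩ < m then f u else 0) else 0) +
        (∑ u : Fin k → Fin n, if ∀ j : Fin k, d ≤ j → u j = Function.update w ⟨d, hd⟩ i j
          then f u else 0) =
        ∑ u : Fin k → Fin n, if ∀ j : Fin k, d + 1 ≤ j → u j = w j then
          (if u ⟨d, hd⟩ < m + 1 then f u else 0) else 0 := by
      intro m hm i hi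
      rw [← Finset.sum_add_distrib]
      refine Finset.sum_congr rfl fun u _ => ?_
      have e : (∀ j : Fin k, d ≤ j → u j = Function.update w ⟨d, hd⟩ i j) ↔
          (∀ j : Fin k, d + 1 ≤ j → u j = w j) ∧ (u ⟨d, hd⟩ : ℕ) = m := by
        constructor
        · intro h
          refine ⟨fun j hj => ?_, ?_⟩
          · rw [h j (by omega), Function.update_of_ne]
            rintro rfl; simp at hj
          · have := h ⟨d, hd⟩ le_rfl
            rw [Function.update_self] at this
            rw [this, hi]
        · rintro ⟨h1, h2⟩ j hj
          by_cases hjd : j = ⟨d, hd⟩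
          · subst hjd
            rw [Function.update_self]
            exact Fin.ext (h2.trans hi)
          · rw [Function.update_of_ne hjd]
            refine h1 j ?_
            have : (j : ℕ) ≠ d := fun h => hjd (Fin.ext h)
            omega
      by_cases h1 : ∀ j : Fin k, d + 1 ≤ j → u j = w j
      · rw [if_pos h1, if_pos h1]
        by_cases h2 : (u ⟨d, hd⟩ : ℕ) = m
        · rw [if_pos (e.2 ⟨h1, h2⟩), if_neg (by omega), if_pos (by omega), zero_add]
        · have : ((u ⟨d, hd⟩ : ℕ) < m) ↔ ((u ⟨d, hd⟩ : ℕ) < m + 1) := by omega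
          rw [if_neg (fun h => h2 (e.1 h).2), add_zero]
          simp only [this]
      · rw [if_neg h1, if_neg h1, if_neg (fun h => h1 (e.1 h).1), add_zero]
    have hInv := Exec.forN (J := J) (a := a) (c := d) (e := .cell 0 (.const 0))
      (body := nest a body d) (B := n ^ d * (b + 6 * d))
      (fun m σ' => Frame {a} R σ₀ σ' ∧ (∀ j : ℕ, d + 1 ≤ j → σ'.nat a j = σ.nat a j) ∧
        σ'.real acc 0 = σ.real acc 0 + ∑ u : Fin k → Fin n,
          if ∀ j : Fin k, d + 1 ≤ j → u j = w j then
            (if u ⟨d, hd⟩ < m then f u else 0) else 0) n (σ := σ)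
      ⟨hF.setNat (by simp) _ _, fun j hj => by
        rw [State.setNat_nat_same, if_neg (by omega)], by simp⟩
      (fun i _ σ' h => by rw [NExpr.eval, NExpr.eval, h.1.1 0 (by simpa using ha.symm), hσ₀])
      (fun m hm σ' h hc => by
        obtain ⟨h1, h2, h3⟩ := h
        refine (ih (by omega) h1 (Function.update w ⟨d, hd⟩ ⟨m, hm⟩) (fun j hj => ?_)).mono le_rfl
          fun σ'' h' => ?_
        · by_cases hjd : j = ⟨d, hd⟩
          · subst hjd
            rw [Function.update_self]
            exact hc
          · rw [Function.update_of_ne hjd]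
            have : (j : ℕ) ≠ d := fun h => hjd (Fin.ext h)
            rw [h2 j (by omega), hw j (by omega)]
        · obtain ⟨g1, g2, g3⟩ := h'
          refine ⟨by rw [g2 d le_rfl, hc], g1.setNat (by simp) _ _, fun j hj => ?_, ?_⟩
          · rw [State.setNat_nat_same, if_neg (by omega), g2 j (by omega), h2 j hj]
          · rw [State.setNat_real, g3, h3, add_assoc, hsum m hm.le ⟨m, hm⟩ rfl])
    refine hInv.mono ?_ fun σ' h => ⟨h.1, h.2.1, ?_⟩
    · have : 1 ≤ n ^ d := Nat.one_le_pow _ _ hn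
      have h2 : n ^ (d + 1) * (b + 6 * (d + 1)) =
          n * (n ^ d * (b + 6 * d)) + 6 * (n * n ^ d) := by ring
      rw [h2]
      have h3 : n ≤ n * n ^ d := Nat.le_mul_of_pos_right n this
      nlinarith
    · rw [h.2.2]
      simp

theorem exec_nest_all {J : Tensor k n} {a acc : ℕ} (ha : a ≠ 0) {body : Prog k} {b : ℕ}
    {R : Finset ℕ} {f : (Fin k → Fin n) → ℝ} {σ : State} (hσ : σ.nat 0 0 = n)
    (hbody : ∀ σ' (u : Fin k → Fin n), Frame {a} R σ σ' → (∀ j : Fin k, σ'.nat a j = u j) →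
      Exec J b body σ' fun σ'' => Frame ∅ R σ' σ'' ∧ σ''.real acc 0 = σ'.real acc 0 + f u)
    (hn : 0 < n) :
    Exec J (n ^ k * (b + 6 * k)) (nest a body k) σ fun σ' => Frame {a} R σ σ' ∧
      σ'.real acc 0 = σ.real acc 0 + ∑ u : Fin k → Fin n, f u := by
  refine (exec_nest ha hσ hbody hn le_rfl (Frame.refl _ _ _) (fun _ => ⟨0, hn⟩)
    (fun j hj => absurd hj (by omega))).mono le_rfl fun σ' h => ⟨h.1, ?_⟩
  rw [h.2.2]
  congr 1
  refine Finset.sum_congr rfl fun u _ => ?_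
  rw [if_pos fun j hj => absurd hj (by omega)]

end RealRAM

namespace RealRAM

variable {k n : ℕ}

theorem Exec.seq_setNat {J : Tensor k n} {σ : State} {a : ℕ} {i e : NExpr} {q : Prog k} {B : ℕ}
    {Post : State → Prop} (h : Exec J B q (σ.setNat a (i.eval σ) (e.eval σ)) Post) :
    Exec J (B + 2) (.seq (.setNat a i e) q) σ Post :=
  (Exec.seq (Exec.setNat J (Post := fun σ' => σ' = σ.setNat a (i.eval σ) (e.eval σ)) rfl)
    (fun σ' h' => by rw [h']; exact h)).mono (by omega) fun _ h => h

theorem Exec.seq_setReal {J : Tensor k n} {σ : State} {a : ℕ} {i : NExpr} {e : RExpr k}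
    {q : Prog k} {B : ℕ} {Post : State → Prop}
    (h : Exec J B q (σ.setReal a (i.eval σ) (e.eval J σ)) Post) :
    Exec J (B + 2) (.seq (.setReal a i e) q) σ Post :=
  (Exec.seq (Exec.setReal J (Post := fun σ' => σ' = σ.setReal a (i.eval σ) (e.eval J σ)) rfl)
    (fun σ' h' => by rw [h']; exact h)).mono (by omega) fun _ h => h

/-! ### Compound expressions -/

/-- Cell `0` of an array of natural numbers, used as a variable. -/
def NExpr.var (a : ℕ) : NExpr := .cell a (.const 0)

/-- Cell `0` of an array of real numbers, used as a variable. -/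
def RExpr.var (a : ℕ) : RExpr k := .cell a (.const 0)

@[simp] theorem NExpr.eval_var (σ : State) (a : ℕ) : (NExpr.var a).eval σ = σ.nat a 0 := rfl

@[simp] theorem RExpr.eval_var (J : Tensor k n) (σ : State) (a : ℕ) :
    (RExpr.var a : RExpr k).eval J σ = σ.real a 0 := rfl

/-- The power `e ^ m`. -/
def NExpr.pow (e : NExpr) : ℕ → NExpr
  | 0 => .const 1
  | m + 1 => .mul (NExpr.pow e m) e

theorem NExpr.eval_pow (σ : State) (e : NExpr) (m : ℕ) : (e.pow m).eval σ = e.eval σ ^ m := by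
  induction m with
  | zero => rfl
  | succ m ih => rw [NExpr.pow, NExpr.eval, ih, pow_succ]

/-- The sum of a family of expressions. -/
def RExpr.sum (f : Fin k → RExpr k) : RExpr k :=
  (List.finRange k).foldr (fun j e => .add (f j) e) (.ofNat (.const 0))

theorem RExpr.eval_sum (J : Tensor k n) (σ : State) (f : Fin k → RExpr k) :
    (RExpr.sum f).eval J σ = ∑ j, (f j).eval J σ := by
  rw [Fin.sum_univ_def, RExpr.sum]
  induction List.finRange k with
  | nil => simp [RExpr.eval, NExpr.eval]
  | cons j l ih => simp [RExpr.eval, ih]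

/-- The product of a family of expressions. -/
def RExpr.prod (f : Fin k → RExpr k) : RExpr k :=
  (List.finRange k).foldr (fun j e => .mul (f j) e) (.ofNat (.const 1))

theorem RExpr.eval_prod (J : Tensor k n) (σ : State) (f : Fin k → RExpr k) :
    (RExpr.prod f).eval J σ = ∏ j, (f j).eval J σ := by
  rw [Fin.prod_univ_def, RExpr.prod]
  induction List.finRange k with
  | nil => simp [RExpr.eval, NExpr.eval]
  | cons j l ih => simp [RExpr.eval, ih]

theorem probeValue_fin (J : Tensor k n) (i : Fin k → ℕ) (u : Fin k → Fin n)
    (h : ∀ j, i j = u j) : probeValue J i = J u := by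
  rw [probeValue, dif_pos fun j => by rw [h j]; exact (u j).2]
  congr 1
  funext j
  exact Fin.ext (h j)

/-! ### The evaluation of a sample

The number of nodes is in array `0` of the natural numbers, the sampled nodes and bits are in the
arrays `1` and `2`, the number of rounds is in array `3`, and the time in array `4`. Of the arrays
of real numbers, array `2` holds the regularization, array `3` the table of the entropies, array `5`
the means, and array `8` the best value so far. -/

/-- The point of the grid with the number `g`. -/
def gridPoint (g : NExpr) : RExpr k :=
  .sub (.div (.ofNat g) (.ofNat (.mul (.var 3) (.var 3)))) (.ofNat (.const 1))

/-- The value of the regularized linear function at a point of the grid. -/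
def gridValue (g : NExpr) : RExpr k :=
  -- The stored field lacks the factor n^(k-1) of `Tensor.fieldStep`, which is restored here.
  .add (.mul (.mul (.ofNat ((NExpr.var 0).pow (k - 1))) (.var 4)) (gridPoint g))
    (.mul (.add (.add (.var 2) (.ofNat (.var 4))) (.ofNat (.const 1))) (.cell 3 g))

/-- The number of points of the grid. -/
def gridSize : NExpr := .add (.mul (.const 2) (.mul (.var 3) (.var 3))) (.const 1)

/-- The signed sum of the entries, at the current node, of the rows of the current round. -/
def roundField : RExpr k :=
  .sum fun j => .mul
    (.sub (.ofNat (.const 1)) (.mul (.ofNat (.const 2))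
      (.ofNat (.cell 2 (.add (.const j) (.mul (.const k) (.var 7)))))))
    (.probe fun l => if l = j then .var 6 else .cell 1 (.add (.const l) (.mul (.const k) (.var 7))))

/-- The field at the current node. -/
def fieldProg : Prog k :=
  .seq (.setReal 4 (.const 0) (.ofNat (.const 0)))
    (forN 7 0 (.var 4) (.setReal 4 (.const 0) (.add (.var 4) roundField)))

/-- A grid point that maximizes the regularized linear function at the current field. -/
def searchProg : Prog k :=
  .seq (.setNat 9 (.const 0) (.const 0))
    (forN 8 0 gridSize (.ite (.realLt (gridValue (.var 9)) (gridValue (.var 8)))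
      (.setNat 9 (.const 0) (.var 8)) .skip))

/-- The best response of the current node, whose entropy is added to the total entropy. -/
def nodeProg : Prog k :=
  .seq fieldProg (.seq searchProg (.seq (.setReal 5 (.var 6) (gridPoint (.var 9)))
    (.setReal 6 (.const 0) (.add (.var 6) (.cell 3 (.var 9))))))

/-- The best responses of all nodes, and their total entropy. -/
def entropyProg : Prog k :=
  .seq (.setReal 6 (.const 0) (.ofNat (.const 0))) (forN 6 0 (.var 0) nodeProg)

/-- Add the term of the mean energy at the current tuple of nodes. -/
def energyBody : Prog k :=
  .setReal 7 (.const 0) (.add (.var 7) (.mul (.probe fun j => .cell 13 (.const j))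
    (.prod fun j => .cell 5 (.cell 13 (.const j)))))

/-- Evaluate the free energy at the response to the sample, and keep the maximum over the trials. -/
def evalProg : Prog k :=
  .seq entropyProg (.seq (.setReal 7 (.const 0) (.ofNat (.const 0)))
    (.seq (nest 13 energyBody k)
      (.ite (.realLt (.var 8) (.add (.var 7) (.var 6)))
        (.setReal 8 (.const 0) (.add (.var 7) (.var 6))) .skip)))

/-- The memory holds the parameters and the table of entropies. -/
structure Ready (n T : ℕ) (β : ℝ) (σ : State) : Prop where
  nodes : σ.nat 0 0 = n
  rounds : σ.nat 3 0 = T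
  reg : σ.real 2 0 = β
  table : ∀ g ≤ 2 * (T * T),
    σ.real 3 g = truncEntropy T ((g : ℝ) / ((T : ℝ) * T) - 1)

theorem Ready.frame {n T : ℕ} {β : ℝ} {σ σ' : State} (h : Ready n T β σ) {A B : Finset ℕ}
    (hF : Frame A B σ σ') (h0 : 0 ∉ A) (h3 : 3 ∉ A) (h2 : 2 ∉ B) (h3' : 3 ∉ B) :
    Ready n T β σ' where
  nodes := by rw [hF.1 0 h0, h.nodes]
  rounds := by rw [hF.1 3 h3, h.rounds]
  reg := by rw [hF.2 2 h2, h.reg]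
  table g hg := by rw [hF.2 3 h3', h.table g hg]

/-- The memory holds a sample. -/
structure Sampled (τ : ℕ) (u : ℕ → Fin k → Fin n) (s : ℕ → Fin k → Fin 2) (σ : State) : Prop where
  time : σ.nat 4 0 = τ
  node : ∀ r < τ, ∀ l : Fin k, σ.nat 1 (l + k * r) = u r l
  bit : ∀ r < τ, ∀ l : Fin k, σ.nat 2 (l + k * r) = s r l

theorem Sampled.frame {τ : ℕ} {u : ℕ → Fin k → Fin n} {s : ℕ → Fin k → Fin 2} {σ σ' : State}
    (h : Sampled τ u s σ) {A B : Finset ℕ} (hF : Frame A B σ σ') (h1 : 1 ∉ A) (h2 : 2 ∉ A)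
    (h4 : 4 ∉ A) : Sampled τ u s σ' where
  time := by rw [hF.1 4 h4, h.time]
  node r hr l := by rw [hF.1 1 h1, h.node r hr l]
  bit r hr l := by rw [hF.1 2 h2, h.bit r hr l]

theorem eval_roundField (J : Tensor k n) {τ : ℕ} {u : ℕ → Fin k → Fin n}
    {s : ℕ → Fin k → Fin 2} {σ : State} (h : Sampled τ u s σ) {r : ℕ} (hr : r < τ)
    (hr' : σ.nat 7 0 = r) (i : Fin n) (hi : σ.nat 6 0 = i) :
    (roundField : RExpr k).eval J σ =
      ∑ j, Tensor.bitSign (s r j) * J (Function.update (u r) j i) := by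
  rw [roundField, RExpr.eval_sum]
  refine Finset.sum_congr rfl fun j _ => ?_
  have h1 := h.bit r hr j
  simp only [RExpr.eval, NExpr.eval, NExpr.eval_var, hr', h1, Tensor.bitSign, Nat.cast_one,
    Nat.cast_ofNat]
  congr 1
  refine probeValue_fin J _ _ fun l => ?_
  by_cases hl : l = j
  · subst hl; simp [hi]
  · rw [if_neg hl, Function.update_of_ne hl]
    simp [NExpr.eval, hr', h.node r hr l]

theorem exec_fieldProg (J : Tensor k n) {τ : ℕ} {u : ℕ → Fin k → Fin n}
    {s : ℕ → Fin k → Fin 2} {σ : State} (h : Sampled τ u s σ) (i : Fin n) (hi : σ.nat 6 0 = i) :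
    Exec J (4 * τ + 5) fieldProg σ fun σ' => Frame {7} {4} σ σ' ∧
      (n : ℝ) ^ (k - 1) * σ'.real 4 0 = J.field τ u s i := by
  refine (Exec.seq_setReal (Exec.forN (fun m σ' => Frame {7} {4} σ σ' ∧
    σ'.real 4 0 = ∑ r ∈ Finset.range m, ∑ j, Tensor.bitSign (s r j) *
      J (Function.update (u r) j i)) τ ?_ ?_ ?_ (B := 1))).mono (by omega) ?_
  · refine ⟨((Frame.refl _ _ _).setReal (by simp) _ _).setNat (by simp) _ _, ?_⟩
    simp [RExpr.eval, NExpr.eval]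
  · rintro m - σ' ⟨hF, -⟩
    rw [NExpr.eval_var, hF.1 4 (by simp), h.time]
  · rintro m hm σ' ⟨hF, hS⟩ hc
    refine Exec.setReal J ⟨by simpa using hc, (hF.setReal (by simp) _ _).setNat (by simp) _ _, ?_⟩
    have h' := h.frame hF (by simp) (by simp) (by simp)
    rw [State.setNat_real]
    simp only [RExpr.eval, NExpr.eval, RExpr.eval_var, State.setReal_real_same, if_true]
    rw [eval_roundField J h' hm hc i (by rw [hF.1 6 (by simp), hi]), hS, Finset.sum_range_succ]
  · rintro σ' ⟨hF, hS⟩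
    refine ⟨hF, ?_⟩
    rw [hS, Tensor.field, Finset.mul_sum]
    rfl

theorem eval_gridPoint (J : Tensor k n) {T : ℕ} {σ : State} (hT : σ.nat 3 0 = T) (g : NExpr) :
    (gridPoint g : RExpr k).eval J σ = (g.eval σ : ℝ) / ((T : ℝ) * T) - 1 := by
  simp [gridPoint, RExpr.eval, NExpr.eval, hT]

theorem eval_gridValue (J : Tensor k n) {T : ℕ} {β : ℝ} {σ : State} (h : Ready n T β σ) {τ : ℕ}
    (hτ : σ.nat 4 0 = τ) (g : NExpr) (hg : g.eval σ ≤ 2 * (T * T)) :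
    (gridValue g : RExpr k).eval J σ = ((n : ℝ) ^ (k - 1) * σ.real 4 0) *
      ((g.eval σ : ℝ) / ((T : ℝ) * T) - 1) + (β + τ + 1) *
      truncEntropy T ((g.eval σ : ℝ) / ((T : ℝ) * T) - 1) := by
  have h1 := h.table _ hg
  simp only [gridValue, RExpr.eval, eval_gridPoint J h.rounds, NExpr.eval_pow, NExpr.eval_var,
    RExpr.eval_var, NExpr.eval, h.nodes, h.reg, hτ, h1]
  push_cast
  rfl

theorem exec_searchProg (J : Tensor k n) {T : ℕ} {β : ℝ} {σ : State} (h : Ready n T β σ) {τ : ℕ}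
    (hτ : σ.nat 4 0 = τ) {S : ℝ} (hS : (n : ℝ) ^ (k - 1) * σ.real 4 0 = S) :
    Exec J (10 * (T * T) + 10) searchProg σ fun σ' => Frame {8, 9} ∅ σ σ' ∧
      σ'.nat 9 0 ≤ 2 * (T * T) ∧ ∀ g : ℕ, g ≤ 2 * (T * T) →
      S * ((g : ℝ) / ((T : ℝ) * T) - 1) + (β + τ + 1) * truncEntropy T ((g : ℝ) / ((T : ℝ) * T) - 1) ≤
        S * ((σ'.nat 9 0 : ℝ) / ((T : ℝ) * T) - 1) +
          (β + τ + 1) * truncEntropy T ((σ'.nat 9 0 : ℝ) / ((T : ℝ) * T) - 1) := by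
  have hgs : ∀ σ', Frame {8, 9} ∅ σ σ' → gridSize.eval σ' = 2 * (T * T) + 1 := by
    intro σ' hF
    simp [gridSize, NExpr.eval, (h.frame hF (by simp) (by simp) (by simp) (by simp)).rounds]
  refine (Exec.seq_setNat (Exec.forN (fun m σ' => Frame {8, 9} ∅ σ σ' ∧
      σ'.nat 9 0 ≤ 2 * (T * T) ∧ ∀ g : ℕ, g < m →
      S * ((g : ℝ) / ((T : ℝ) * T) - 1) + (β + τ + 1) * truncEntropy T ((g : ℝ) / ((T : ℝ) * T) - 1) ≤
        S * ((σ'.nat 9 0 : ℝ) / ((T : ℝ) * T) - 1) +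
          (β + τ + 1) * truncEntropy T ((σ'.nat 9 0 : ℝ) / ((T : ℝ) * T) - 1))
      (2 * (T * T) + 1) ?_ ?_ ?_ (B := 2))).mono (by omega) ?_
  · refine ⟨((Frame.refl _ _ _).setNat (by simp) _ _).setNat (by simp) _ _, ?_, ?_⟩
    · simp [NExpr.eval]
    · intro g hg; omega
  · rintro m - σ' ⟨hF, -⟩
    exact hgs σ' hF
  · rintro m hm σ' ⟨hF, hb, hmax⟩ hc
    have hR := h.frame hF (by simp) (by simp) (by simp) (by simp)
    have hτ' : σ'.nat 4 0 = τ := by rw [hF.1 4 (by simp), hτ]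
    have hS' : (n : ℝ) ^ (k - 1) * σ'.real 4 0 = S := by rw [hF.2 4 (by simp), hS]
    have hv9 := eval_gridValue J hR hτ' (.var 9) hb
    have hv8 := eval_gridValue J hR hτ' (.var 8) (by rw [NExpr.eval_var, hc]; omega)
    simp only [NExpr.eval_var, hS'] at hv9 hv8
    rw [hc] at hv8
    refine Exec.ite (fun ht => Exec.setNat J ⟨?_, ?_, ?_, ?_⟩)
      (fun hf => Exec.skip J ⟨hc, ?_, ?_, ?_⟩)
    · simpa using hc
    · exact (hF.setNat (by simp) _ _).setNat (by simp) _ _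
    · simp [NExpr.eval, hc]; omega
    · rw [BExpr.eval, decide_eq_true_eq, hv9, hv8] at ht
      have e : ((σ'.setNat 9 ((NExpr.const 0).eval σ') ((NExpr.var 8).eval σ')).setNat 8 0
          (m + 1)).nat 9 0 = m := by simp [NExpr.eval, hc]
      rw [e]
      intro g hg
      rcases Nat.lt_succ_iff_lt_or_eq.1 hg with hg' | hg'
      · exact (hmax g hg').trans ht.le
      · rw [hg']
    · exact hF.setNat (by simp) _ _
    · simpa using hb
    · rw [BExpr.eval, decide_eq_false_iff_not, hv9, hv8, not_lt] at hf
      have e : (σ'.setNat 8 0 (m + 1)).nat 9 0 = σ'.nat 9 0 := by simp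
      rw [e]
      intro g hg
      rcases Nat.lt_succ_iff_lt_or_eq.1 hg with hg' | hg'
      · exact hmax g hg'
      · rw [hg']; exact hf
  · rintro σ' ⟨hF, hb, hmax⟩
    exact ⟨hF, hb, fun g hg => hmax g (by omega)⟩

theorem exec_nodeProg (J : Tensor k n) {T : ℕ} (hT : 1 ≤ T) {β : ℝ} (hβ : 0 ≤ β) {σ : State}
    (h : Ready n T β σ) {τ : ℕ} {u : ℕ → Fin k → Fin n} {s : ℕ → Fin k → Fin 2}
    (hs : Sampled τ u s σ) (i : Fin n) (hi : σ.nat 6 0 = i) :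
    Exec J (4 * τ + 10 * (T * T) + 20) nodeProg σ fun σ' => Frame {7, 8, 9} {4, 5, 6} σ σ' ∧
      ∃ x : ℝ, |x| ≤ 1 ∧ |x - Tensor.response T (β + τ + 1) (J.field τ u s) i| ≤ 1 / ((T : ℝ) * T) ∧
        (∀ j, σ'.real 5 j = if j = i then x else σ.real 5 j) ∧
        σ'.real 6 0 = σ.real 6 0 + truncEntropy T x := by
  have hT' : (0 : ℝ) < T := by exact_mod_cast hT
  refine (Exec.seq (exec_fieldProg J hs i hi) fun σ₁ ⟨hF₁, hS⟩ =>
    Exec.seq (exec_searchProg J (τ := τ) (h.frame hF₁ (by simp) (by simp) (by simp) (by simp))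
      (by rw [hF₁.1 4 (by simp), hs.time]) hS) fun σ₂ ⟨hF₂, hb, hmax⟩ =>
    Exec.seq_setReal (Exec.setReal J ?_)).mono (by omega) fun _ h => h
  have hF : Frame {7, 8, 9} {4, 5, 6} σ σ₂ :=
    (hF₁.mono (by decide) (by decide)).trans (hF₂.mono (by decide) (by decide))
  have hR := h.frame hF (by simp) (by simp) (by simp) (by simp)
  refine ⟨(hF.setReal (by simp) _ _).setReal (by simp) _ _,
    (σ₂.nat 9 0 : ℝ) / ((T : ℝ) * T) - 1, ?_, ?_, ?_, ?_⟩
  · have h1 : (σ₂.nat 9 0 : ℝ) / ((T : ℝ) * T) ≤ 2 := by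
      rw [div_le_iff₀ (by positivity)]; exact_mod_cast hb
    have h2 : 0 ≤ (σ₂.nat 9 0 : ℝ) / ((T : ℝ) * T) := by positivity
    rw [abs_le]; constructor <;> linarith
  · have := abs_sub_optMean_le hT (c := β + τ + 1) (by positivity) (J.field τ u s i)
      (Nat.mul_pos hT hT) hb (by simpa only [Nat.cast_mul] using hmax)
    simpa only [Nat.cast_mul, Tensor.response] using this
  · intro j
    rw [State.setReal_real_ne _ (by decide), State.setReal_real_same, eval_gridPoint J hR.rounds,
      NExpr.eval_var, NExpr.eval_var, hF.1 6 (by simp), hi, hF₂.2 5 (by simp), hF₁.2 5 (by simp)]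
  · simp only [RExpr.eval, NExpr.eval, State.setReal_real_same, RExpr.eval_var, NExpr.eval_var,
      if_true, State.setReal_nat]
    rw [State.setReal_real_ne _ (by decide), State.setReal_real_ne _ (by decide), hR.table _ hb,
      hF₂.2 6 (by simp), hF₁.2 6 (by simp)]

theorem exec_entropyProg (J : Tensor k n) {T : ℕ} (hT : 1 ≤ T) {β : ℝ} (hβ : 0 ≤ β) {σ : State}
    (h : Ready n T β σ) {τ : ℕ} {u : ℕ → Fin k → Fin n} {s : ℕ → Fin k → Fin 2}
    (hs : Sampled τ u s σ) :
    Exec J (n * (4 * τ + 10 * (T * T) + 23) + 5) entropyProg σ fun σ' =>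
      Frame {6, 7, 8, 9} {4, 5, 6} σ σ' ∧
      ∃ x : Fin n → ℝ, (∀ i, |x i| ≤ 1) ∧
        (∀ i, |x i - Tensor.response T (β + τ + 1) (J.field τ u s) i| ≤ 1 / ((T : ℝ) * T)) ∧
        (∀ i : Fin n, σ'.real 5 i = x i) ∧ σ'.real 6 0 = ∑ i, truncEntropy T (x i) := by
  refine (Exec.seq_setReal (Exec.forN (fun m σ' => Frame {6, 7, 8, 9} {4, 5, 6} σ σ' ∧
      (∀ i : Fin n, (i : ℕ) < m → |σ'.real 5 i| ≤ 1 ∧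
        |σ'.real 5 i - Tensor.response T (β + τ + 1) (J.field τ u s) i| ≤ 1 / ((T : ℝ) * T)) ∧
      σ'.real 6 0 = ∑ i ∈ Finset.range m, truncEntropy T (σ'.real 5 i)) n ?_ ?_ ?_
      (B := 4 * τ + 10 * (T * T) + 20))).mono (by
        rw [show 4 * τ + 10 * (T * T) + 20 + 3 = 4 * τ + 10 * (T * T) + 23 from rfl]) ?_
  · refine ⟨((Frame.refl _ _ _).setReal (by simp) _ _).setNat (by simp) _ _, ?_, ?_⟩
    · intro i hi; omega
    · simp [NExpr.eval, RExpr.eval]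
  · rintro m - σ' ⟨hF, -⟩
    rw [NExpr.eval_var, hF.1 0 (by simp), h.nodes]
  · rintro m hm σ' ⟨hF, hx, hH⟩ hc
    refine (exec_nodeProg J hT hβ (h.frame hF (by simp) (by simp) (by simp) (by simp))
      (hs.frame hF (by simp) (by simp) (by simp)) ⟨m, hm⟩ hc).mono le_rfl ?_
    rintro σ'' ⟨hF', x, hx1, hx2, hx5, hx6⟩
    refine ⟨by rw [hF'.1 6 (by simp), hc],
      (hF.trans (hF'.mono (by decide) (by decide))).setNat (by simp) _ _, ?_, ?_⟩
    · intro i hi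
      rw [State.setNat_real, hx5]
      by_cases him : (i : ℕ) = m
      · obtain rfl : i = ⟨m, hm⟩ := Fin.ext him
        rw [if_pos rfl]
        exact ⟨hx1, hx2⟩
      · rw [if_neg him]
        exact hx i (by omega)
    · rw [State.setNat_real, hx6, hH, Finset.sum_range_succ, hx5, if_pos rfl]
      congr 1
      refine Finset.sum_congr rfl fun i hi => ?_
      rw [Finset.mem_range] at hi
      rw [hx5, if_neg (by simp; omega)]
  · rintro σ' ⟨hF, hx, hH⟩
    refine ⟨hF, fun i => σ'.real 5 i, fun i => (hx i i.2).1, fun i => (hx i i.2).2,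
      fun i => rfl, ?_⟩
    rw [hH, Finset.sum_range]

theorem exec_evalProg (J : Tensor k n) (hn : 0 < n) {T : ℕ} (hT : 1 ≤ T) {β : ℝ} (hβ : 0 ≤ β)
    {σ : State} (h : Ready n T β σ) {τ : ℕ} {u : ℕ → Fin k → Fin n} {s : ℕ → Fin k → Fin 2}
    (hs : Sampled τ u s σ) :
    Exec J (n * (4 * τ + 10 * (T * T) + 23) + n ^ k * (1 + 6 * k) + 20) evalProg σ fun σ' =>
      Frame {6, 7, 8, 9, 13} {4, 5, 6, 7, 8} σ σ' ∧
      ∃ x : Fin n → ℝ, (∀ i, |x i| ≤ 1) ∧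
        (∀ i, |x i - Tensor.response T (β + τ + 1) (J.field τ u s) i| ≤ 1 / ((T : ℝ) * T)) ∧
        σ'.real 8 0 = max (σ.real 8 0) (J.freeEnergy T x) := by
  refine (Exec.seq (exec_entropyProg J hT hβ h hs) fun σ₁ ⟨hF₁, x, hx1, hx2, hx5, hx6⟩ =>
    Exec.seq_setReal (Exec.seq (exec_nest_all (n := n) (R := {7}) (acc := 7) (b := 1)
      (f := fun v => J v * ∏ j, x (v j)) (by decide) ?_ ?_ hn)
      fun σ₂ ⟨hF₂, hE⟩ => Exec.ite (B := 1) (fun ht => Exec.setReal J ?_) fun hf => Exec.skip J ?_)).mono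
      (by omega) fun _ h => h
  · rw [State.setReal_nat, hF₁.1 0 (by simp), h.nodes]
  · intro σ' v hF hv
    refine Exec.setReal J ⟨(Frame.refl _ _ _).setReal (by simp) _ _, ?_⟩
    simp only [RExpr.eval, NExpr.eval, RExpr.eval_prod, RExpr.eval_var, State.setReal_real_same,
      if_true]
    rw [probeValue_fin J _ v hv]
    congr 2
    refine Finset.prod_congr rfl fun j _ => ?_
    rw [hv, hF.2 5 (by simp), State.setReal_real_ne _ (by decide), hx5]
  all_goals
    have hE' : σ₂.real 7 0 = J.meanEnergy x := by
      rw [hE]; simp [RExpr.eval, NExpr.eval, Tensor.meanEnergy]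
    have hF₃ : Frame {6, 7, 8, 9, 13} {4, 5, 6, 7, 8} σ σ₂ :=
      ((hF₁.mono (by decide) (by decide)).setReal (by simp) _ _).trans
        (hF₂.mono (by decide) (by decide))
    have hH : σ₂.real 6 0 = ∑ i, truncEntropy T (x i) := by
      rw [hF₂.2 6 (by simp), State.setReal_real_ne _ (by decide), hx6]
    have h8 : σ₂.real 8 0 = σ.real 8 0 := by
      rw [hF₂.2 8 (by simp), State.setReal_real_ne _ (by decide), hF₁.2 8 (by simp)]
  · simp only [BExpr.eval, RExpr.eval, RExpr.eval_var, hE', hH, h8, decide_eq_true_eq] at ht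
    refine ⟨hF₃.setReal (by simp) _ _, x, hx1, hx2, ?_⟩
    simp only [RExpr.eval, NExpr.eval, RExpr.eval_var, hE', hH, State.setReal_real_same, if_true]
    exact (max_eq_right ht.le).symm
  · simp only [BExpr.eval, RExpr.eval, RExpr.eval_var, hE', hH, h8, decide_eq_false_iff_not,
      not_lt] at hf
    exact ⟨hF₃, x, hx1, hx2, by rw [h8]; exact (max_eq_left hf).symm⟩

end RealRAM

namespace RealRAM

variable {k n : ℕ}

/-! ### Averages over samples -/

/-- The average of `f` over the arrays that arise from `U` and `B` when the cells `o, …, o + m - 1`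
are overwritten by elements of `{0, …, n - 1}` and by bits. -/
def sampleAvg (n : ℕ) (f : (ℕ → ℕ) → (ℕ → ℕ) → ℝ) : ℕ → ℕ → (ℕ → ℕ) → (ℕ → ℕ) → ℝ
  | 0, _, U, B => f U B
  | m + 1, o, U, B => (∑ v ∈ Finset.range n, (∑ b ∈ Finset.range 2,
      sampleAvg n f m (o + 1) (Function.update U o v) (Function.update B o b)) / 2) / n

/-- The array `U` with the cells `o, …, o + m - 1` overwritten. -/
def overwrite {m : ℕ} (o : ℕ) (w : Fin m → ℕ) (U : ℕ → ℕ) (j : ℕ) : ℕ :=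
  if h : o ≤ j ∧ j - o < m then w ⟨j - o, h.2⟩ else U j

theorem overwrite_update {m : ℕ} (o v : ℕ) (w : Fin m → ℕ) (U : ℕ → ℕ) :
    overwrite (o + 1) w (Function.update U o v) =
      overwrite o (Fin.cons v w : Fin (m + 1) → ℕ) U := by
  funext j
  unfold overwrite
  by_cases h1 : o + 1 ≤ j ∧ j - (o + 1) < m
  · rw [dif_pos h1, dif_pos (by omega)]
    have : (⟨j - o, by omega⟩ : Fin (m + 1)) = Fin.succ ⟨j - (o + 1), h1.2⟩ := by
      ext; simp; omega
    rw [this, Fin.cons_succ]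
  · rw [dif_neg h1]
    by_cases h2 : j = o
    · subst h2
      rw [dif_pos (by omega), Function.update_self]
      have : (⟨j - j, by omega⟩ : Fin (m + 1)) = 0 := by ext; simp
      rw [this, Fin.cons_zero]
    · rw [dif_neg (by omega), Function.update_of_ne h2]

/-- Successive uniform draws amount to one uniform element of the product. -/
theorem sampleAvg_eq (n : ℕ) (f : (ℕ → ℕ) → (ℕ → ℕ) → ℝ) (m o : ℕ) (U B : ℕ → ℕ) :
    sampleAvg n f m o U B = (∑ ω : Fin m → Fin n × Fin 2,
      f (overwrite o (fun j => ((ω j).1 : ℕ)) U) (overwrite o (fun j => ((ω j).2 : ℕ)) B)) /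
      (2 * n) ^ m := by
  induction m generalizing o U B with
  | zero =>
    have h : ∀ (w : Fin 0 → ℕ) (U : ℕ → ℕ), overwrite o w U = U := by
      intro w U; funext j; simp [overwrite]
    simp [sampleAvg, h]
  | succ m ih =>
    rw [sampleAvg, ← Equiv.sum_comp (Fin.consEquiv fun _ : Fin (m + 1) => Fin n × Fin 2),
      Fintype.sum_prod_type, Fintype.sum_prod_type, Finset.sum_range]
    simp only [Finset.sum_range, ih, Finset.sum_div]
    refine Finset.sum_congr rfl fun v _ => Finset.sum_congr rfl fun b _ =>
      Finset.sum_congr rfl fun ω _ => ?_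
    rw [overwrite_update, overwrite_update]
    have h1 : ∀ (g : Fin n × Fin 2 → ℕ), (Fin.cons (g (v, b)) (fun j => g (ω j)) : Fin (m + 1) → ℕ) =
        fun j => g ((Fin.consEquiv fun _ : Fin (m + 1) => Fin n × Fin 2) ((v, b), ω) j) := by
      intro g
      funext j
      refine Fin.cases ?_ (fun j => ?_) j <;> simp [Fin.consEquiv]
    rw [← h1 fun p => (p.1 : ℕ), ← h1 fun p => (p.2 : ℕ), div_div, div_div]
    congr 1

/-- Pairs of families of nodes and bits as sequences of draws. -/
def sampleEquiv (k n T : ℕ) :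
    (Fin T → Fin k → Fin n) × (Fin T → Fin k → Fin 2) ≃ (Fin (T * k) → Fin n × Fin 2) where
  toFun p m := (p.1 (finProdFinEquiv.symm m).1 (finProdFinEquiv.symm m).2,
    p.2 (finProdFinEquiv.symm m).1 (finProdFinEquiv.symm m).2)
  invFun ω := (fun r l => (ω (finProdFinEquiv (r, l))).1, fun r l => (ω (finProdFinEquiv (r, l))).2)
  left_inv p := by simp [-finProdFinEquiv_symm_apply]
  right_inv ω := by simp [-finProdFinEquiv_symm_apply]

theorem overwrite_finProd {T : ℕ} (w : Fin (T * k) → ℕ) (U : ℕ → ℕ) (r : Fin T) (l : Fin k) :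
    overwrite 0 w U (l + k * r) = w (finProdFinEquiv (r, l)) := by
  have h : (l : ℕ) + k * r < T * k := (finProdFinEquiv (r, l)).2
  rw [overwrite, dif_pos (by simpa using h)]
  rfl

/-- The arrays `U` and `B` hold the nodes `u` and the bits `s`. -/
def Holds {T : ℕ} (u : Fin T → Fin k → Fin n) (s : Fin T → Fin k → Fin 2) (U B : ℕ → ℕ) : Prop :=
  ∀ (r : Fin T) (l : Fin k), U (l + k * r) = u r l ∧ B (l + k * r) = s r l

theorem le_sampleAvg {T : ℕ} {f : (ℕ → ℕ) → (ℕ → ℕ) → ℝ}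
    {g : (Fin T → Fin k → Fin n) → (Fin T → Fin k → Fin 2) → ℝ}
    (h : ∀ u s U B, Holds u s U B → g u s ≤ f U B) (U B : ℕ → ℕ) :
    (∑ u, ∑ s, g u s) / (2 * n) ^ (T * k) ≤ sampleAvg n f (T * k) 0 U B := by
  rw [sampleAvg_eq, ← Equiv.sum_comp (sampleEquiv k n T), Fintype.sum_prod_type]
  gcongr with u _ s _
  refine h u s _ _ fun r l => ⟨?_, ?_⟩ <;>
  · rw [overwrite_finProd]
    simp [sampleEquiv, -finProdFinEquiv_symm_apply]

/-! ### Sampling -/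

/-- Draw a node and a bit. -/
def sampleBody : Prog k :=
  .seq (.seq (.rand 1 (.var 5) (.sub (.var 0) (.const 1))) (.rand 2 (.var 5) (.const 1)))
    (.setNat 5 (.const 0) (.add (.cell 5 (.const 0)) (.const 1)))

/-- Draw the nodes and the bits of all rounds. -/
def sampleProg : Prog k :=
  .seq (.setNat 5 (.const 0) (.const 0))
    (.loop (.natLt (.var 5) (.mul (.var 3) (.const k))) sampleBody)

theorem Wins.rand_range {J : Tensor k n} {S : Set ℝ} {K : List (Prog k)} {σ : State} {a : ℕ}
    {i e : NExpr} {t m : ℕ} (hm : e.eval σ + 1 = m) {q : ℕ → ℝ}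
    (h : ∀ v < m, Wins J S (K, σ.setNat a (i.eval σ) v) t (q v)) :
    Wins J S (.rand a i e :: K, σ) (t + 1) ((∑ v ∈ Finset.range m, q v) / m) := by
  subst hm
  have := Wins.rand (i := i) rfl fun v hv => h v (Nat.lt_succ_of_le hv)
  rwa [Nat.cast_succ]

theorem setNat_nat_eq_update (σ : State) (a i v : ℕ) :
    (σ.setNat a i v).nat a = Function.update (σ.nat a) i v := by
  simp [State.setNat]

/-- Cell 5 counts the draws already made; each passage contributes one average over nodes and one
over bits, matching the recursion of `sampleAvg`. -/
theorem wins_sampleLoop {J : Tensor k n} {S : Set ℝ} {K : List (Prog k)} {T t : ℕ} (hn : 0 < n)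
    (f : (ℕ → ℕ) → (ℕ → ℕ) → ℝ) (m : ℕ) {σ : State} (h0 : σ.nat 0 0 = n) (h3 : σ.nat 3 0 = T)
    (hm : σ.nat 5 0 + m = T * k) (hv : ∀ j < σ.nat 5 0, σ.nat 1 j < n ∧ σ.nat 2 j < 2)
    (h : ∀ σ', Frame {1, 2, 5} ∅ σ σ' → (∀ j < T * k, σ'.nat 1 j < n ∧ σ'.nat 2 j < 2) →
      Wins J S (K, σ') t (f (σ'.nat 1) (σ'.nat 2))) :
    Wins J S (.loop (.natLt (.var 5) (.mul (.var 3) (.const k))) sampleBody :: K, σ)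
      (t + (6 * m + 1)) (sampleAvg n f m (σ.nat 5 0) (σ.nat 1) (σ.nat 2)) := by
  induction m generalizing σ with
  | zero =>
    refine Wins.loop_false (t := t) ?_ (h σ (Frame.refl _ _ _) fun j hj => hv j (by omega))
    simp [BExpr.eval, NExpr.eval, h3]; omega
  | succ m ih =>
    have e : t + (6 * (m + 1) + 1) = (t + (6 * m + 1)) + 1 + 1 + 1 + 1 + 1 + 1 := by ring
    rw [e]
    refine Wins.loop_true (by simp [BExpr.eval, NExpr.eval, h3]; omega) (Wins.seq (Wins.seq ?_))
    rw [sampleAvg]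
    refine Wins.rand_range (by simp [NExpr.eval, h0]; omega) fun v hvn => ?_
    refine Wins.rand_range (m := 2) (by simp [NExpr.eval]) fun b hb => ?_
    refine Wins.of_step rfl ?_
    simp only [NExpr.eval, NExpr.eval_var]
    set σ' := ((σ.setNat 1 (σ.nat 5 0) v).setNat 2
      ((σ.setNat 1 (σ.nat 5 0) v).nat 5 0) b) with hσ'
    have e5 : σ'.nat 5 0 = σ.nat 5 0 := by simp [hσ']
    have hF : Frame {1, 2, 5} ∅ σ (σ'.setNat 5 0 (σ'.nat 5 0 + 1)) :=
      (((Frame.refl _ _ _).setNat (by simp) _ _).setNat (by simp) _ _).setNat (by simp) _ _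
    have e1 : (σ'.setNat 5 0 (σ'.nat 5 0 + 1)).nat 1 = Function.update (σ.nat 1) (σ.nat 5 0) v := by
      rw [State.setNat_nat_ne _ (by decide), hσ', State.setNat_nat_ne _ (by decide),
        setNat_nat_eq_update]
    have e2 : (σ'.setNat 5 0 (σ'.nat 5 0 + 1)).nat 2 = Function.update (σ.nat 2) (σ.nat 5 0) b := by
      rw [State.setNat_nat_ne _ (by decide), hσ', setNat_nat_eq_update]
      simp
    have := ih (σ := σ'.setNat 5 0 (σ'.nat 5 0 + 1)) (by rw [hF.1 0 (by simp), h0])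
      (by rw [hF.1 3 (by simp), h3]) (by simp [e5]; omega) ?_
      (fun σ'' hF' => h σ'' (hF.trans hF'))
    · rw [e1, e2] at this
      simpa [e5] using this
    · intro j hj
      rw [e1, e2]
      simp only [State.setNat_nat_same, if_true, e5] at hj
      by_cases hjo : j = σ.nat 5 0
      · subst hjo; simp [hvn, hb]
      · rw [Function.update_of_ne hjo, Function.update_of_ne hjo]
        exact hv j (by omega)

theorem wins_sampleProg {J : Tensor k n} {S : Set ℝ} {K : List (Prog k)} {T t : ℕ} (hn : 0 < n)
    (g : (Fin T → Fin k → Fin n) → (Fin T → Fin k → Fin 2) → ℝ) {σ : State}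
    (h0 : σ.nat 0 0 = n) (h3 : σ.nat 3 0 = T)
    (h : ∀ σ' u s, Frame {1, 2, 5} ∅ σ σ' → Holds u s (σ'.nat 1) (σ'.nat 2) →
      Wins J S (K, σ') t (g u s)) :
    Wins J S (sampleProg :: K, σ) (t + (6 * (T * k) + 3))
      ((∑ u, ∑ s, g u s) / (2 * n) ^ (T * k)) := by
  classical
  -- the arrays determine the sample
  have huniq : ∀ u s u' s' U B, Holds (n := n) (T := T) (k := k) u s U B → Holds u' s' U B →
      u = u' ∧ s = s' := by
    intro u s u' s' U B h1 h2
    constructor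
    · funext r l; exact Fin.ext ((h1 r l).1.symm.trans (h2 r l).1)
    · funext r l; exact Fin.ext ((h1 r l).2.symm.trans (h2 r l).2)
  -- The loop rule needs a function of the raw arrays; the arrays determine the sample they hold, so
  -- `g` transfers by choice.
  set f : (ℕ → ℕ) → (ℕ → ℕ) → ℝ := fun U B =>
    if h : ∃ p : (Fin T → Fin k → Fin n) × (Fin T → Fin k → Fin 2), Holds p.1 p.2 U B then
      g h.choose.1 h.choose.2 else 0 with hf
  have hfg : ∀ u s U B, Holds u s U B → g u s = f U B := by
    intro u s U B hH
    have hex : ∃ p : (Fin T → Fin k → Fin n) × (Fin T → Fin k → Fin 2), Holds p.1 p.2 U B :=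
      ⟨(u, s), hH⟩
    obtain ⟨e1, e2⟩ := huniq _ _ _ _ _ _ hH hex.choose_spec
    rw [hf]
    simp only [dif_pos hex]
    rw [← e1, ← e2]
  have e : t + (6 * (T * k) + 3) = t + (6 * (T * k) + 1) + 1 + 1 := by ring
  rw [e]
  refine Wins.seq (Wins.of_step rfl ?_)
  have hF : Frame {1, 2, 5} ∅ σ (σ.setNat 5 0 0) := (Frame.refl _ _ _).setNat (by simp) _ _
  have := wins_sampleLoop (J := J) (S := S) (K := K) (T := T) (t := t) hn f (T * k)
    (σ := σ.setNat 5 0 0) (by simpa using h0) (by simpa using h3) (by simp) (by simp) ?_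
  · refine Wins.mono_prob this ?_
    rw [State.setNat_nat_same, if_pos rfl]
    exact le_sampleAvg (fun u s U B hH => (hfg u s U B hH).le) _ _
  · intro σ' hF' hv
    have hidx : ∀ (r : Fin T) (l : Fin k), (l : ℕ) + k * r < T * k :=
      fun r l => (finProdFinEquiv (r, l)).2
    have hH : Holds (fun r l => ⟨σ'.nat 1 (l + k * r), (hv _ (hidx r l)).1⟩)
      (fun r l => ⟨σ'.nat 2 (l + k * r), (hv _ (hidx r l)).2⟩) (σ'.nat 1) (σ'.nat 2) :=
      fun r l => ⟨rfl, rfl⟩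
    rw [← hfg _ _ _ _ hH]
    exact h σ' _ _ (hF.trans hF') hH

/-! ### Trials -/

/-- Draw the number of rounds that are played and the sample, and evaluate the response. -/
def trialProg : Prog k :=
  -- The time is uniform in {0, …, T - 1}. All T rounds are drawn whatever it is, so that the sample
  -- space does not depend on the time.
  .seq (.rand 4 (.const 0) (.sub (.var 3) (.const 1))) (.seq sampleProg evalProg)

/-- The number of steps of a trial. -/
def trialCost (k n T : ℕ) : ℕ :=
  6 * (T * k) + 6 + (n * (4 * T + 10 * (T * T) + 23) + n ^ k * (1 + 6 * k) + 20)

theorem wins_trialProg {J : Tensor k n} {S : Set ℝ} {K : List (Prog k)} {T t : ℕ} [NeZero T]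
    (hn : 0 < n) {β : ℝ} (hβ : 0 ≤ β)
    (g : ℕ → (Fin T → Fin k → Fin n) → (Fin T → Fin k → Fin 2) → ℝ) {σ : State}
    (hσ : Ready n T β σ)
    (h : ∀ σ' τ u s, τ < T → Frame {1, 2, 4, 5, 6, 7, 8, 9, 13} {4, 5, 6, 7, 8} σ σ' →
      (∃ x : Fin n → ℝ, (∀ i, |x i| ≤ 1) ∧
        (∀ i, |x i - Tensor.response T (β + τ + 1) (J.field τ (Tensor.seqOf u) (Tensor.seqOf s)) i|
          ≤ 1 / ((T : ℝ) * T)) ∧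
        σ'.real 8 0 = max (σ.real 8 0) (J.freeEnergy T x)) →
      Wins J S (K, σ') t (g τ u s)) :
    Wins J S (trialProg :: K, σ) (t + trialCost k n T)
      ((∑ τ ∈ Finset.range T, ((∑ u, ∑ s, g τ u s) / (2 * n) ^ (T * k))) / T) := by
  have hT : 1 ≤ T := Nat.one_le_iff_ne_zero.2 (NeZero.ne T)
  have e : t + trialCost k n T = ((n * (4 * T + 10 * (T * T) + 23) + n ^ k * (1 + 6 * k) + 20) + t) +
      (6 * (T * k) + 3) + 1 + 1 + 1 := by
    rw [trialCost]; omega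
  rw [e]
  refine Wins.seq (Wins.rand_range (by simp [NExpr.eval, hσ.rounds]; omega) fun τ hτ =>
    Wins.seq ?_)
  have hF₁ : Frame {1, 2, 4, 5, 6, 7, 8, 9, 13} {4, 5, 6, 7, 8} σ
    (σ.setNat 4 ((NExpr.const 0).eval σ) τ) := (Frame.refl _ _ _).setNat (by simp) _ _
  refine wins_sampleProg hn (g τ) (by simpa using hσ.nodes) (by simpa using hσ.rounds) ?_
  intro σ' u s hF hH
  have hF₂ := hF₁.trans (hF.mono (by decide) (by decide) :
    Frame {1, 2, 4, 5, 6, 7, 8, 9, 13} {4, 5, 6, 7, 8} _ _)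
  have hS : Sampled τ (Tensor.seqOf u) (Tensor.seqOf s) σ' := by
    refine ⟨?_, fun r hr l => ?_, fun r hr l => ?_⟩
    · rw [hF.1 4 (by simp)]; simp [NExpr.eval]
    · rw [Tensor.seqOf_of_lt u (hr.trans hτ)]; exact (hH ⟨r, hr.trans hτ⟩ l).1
    · rw [Tensor.seqOf_of_lt s (hr.trans hτ)]; exact (hH ⟨r, hr.trans hτ⟩ l).2
  refine Wins.exec ((exec_evalProg J hn hT hβ (hσ.frame hF₂ (by simp) (by simp) (by simp) (by simp))
    hS).mono (B' := n * (4 * T + 10 * (T * T) + 23) + n ^ k * (1 + 6 * k) + 20) ?_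
    (fun _ h => h)) ?_
  · gcongr
  · rintro σ'' ⟨hF₃, x, hx1, hx2, hx8⟩
    refine h σ'' τ u s hτ (hF₂.trans (hF₃.mono (by decide) (by decide))) ⟨x, hx1, hx2, ?_⟩
    rw [hx8, hF.2 8 (by simp), State.setNat_real]

/-- Repeat the trial. -/
def trialsProg : Prog k :=
  forN 10 0 (.var 11) trialProg

/-- A trial multiplies the failure probability by at most 1 - p. In the induction either no success
is assumed and the claim is 1 - (1 - p)^m, or the stored maximum is already good and any q ≤ 1 may
be claimed, since it never decreases. That it never exceeds `up` holds for every outcome. -/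
theorem wins_trialsProg {J : Tensor k n} {S : Set ℝ} {K : List (Prog k)} {T t N : ℕ} [NeZero T]
    (hn : 0 < n) {β : ℝ} (hβ : 0 ≤ β) {σ : State} (hσ : Ready n T β σ) (hN : σ.nat 11 0 = N)
    {lo up p d : ℝ} (hp1 : p ≤ 1)
    (hd : ∀ x y : Fin n → ℝ, (∀ i, |x i| ≤ 1) → (∀ i, |y i| ≤ 1) →
      (∀ i, |x i - y i| ≤ 1 / ((T : ℝ) * T)) → J.freeEnergy T y - d ≤ J.freeEnergy T x)
    (hup : ∀ x : Fin n → ℝ, (∀ i, |x i| ≤ 1) → J.freeEnergy T x ≤ up)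
    (hgood : p * (T * (2 * n) ^ (T * k)) ≤
      ∑ τ ∈ Finset.range T, ∑ u : Fin T → Fin k → Fin n, ∑ s : Fin T → Fin k → Fin 2,
        if lo ≤ J.freeEnergy T (Tensor.response T (β + τ + 1)
          (J.field τ (Tensor.seqOf u) (Tensor.seqOf s))) then 1 else 0)
    (h8 : σ.real 8 0 ≤ up)
    (h : ∀ σ' q, σ'.real 8 0 ≤ up → q ≤ 1 → (0 < q → lo - d ≤ σ'.real 8 0) →
      Wins J S (K, σ') t q) :
    Wins J S (trialsProg :: K, σ) (t + (N * (trialCost k n T + 3) + 3)) (1 - (1 - p) ^ N) := by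
  have hT : (0 : ℝ) < T := by exact_mod_cast Nat.pos_of_ne_zero (NeZero.ne T)
  have hn' : (0 : ℝ) < n := by exact_mod_cast hn
  set body : Prog k := .seq trialProg
    (.setNat 10 (.const 0) (.add (.cell 10 (.const 0)) (.const 1))) with hbody
  -- the loop with `m` trials left
  have key : ∀ m : ℕ, ∀ σ' : State, Ready n T β σ' → σ'.nat 11 0 = N → σ'.nat 10 0 + m = N →
      σ'.real 8 0 ≤ up → ∀ q : ℝ, (q ≤ 1 - (1 - p) ^ m ∨ (q ≤ 1 ∧ lo - d ≤ σ'.real 8 0)) →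
      Wins J S (.loop (.natLt (.cell 10 (.const 0)) (.var 11)) body :: K, σ')
        (t + (m * (trialCost k n T + 3) + 1)) q := by
    intro m
    induction m with
    | zero =>
      intro σ' hR h11 h10 hu q hq
      rw [zero_mul, zero_add]
      refine Wins.loop_false (by simp [BExpr.eval, NExpr.eval, h11]; omega) (h σ' q hu ?_ ?_)
      · rcases hq with hq | hq
        · simp at hq; linarith
        · exact hq.1
      · intro hq0
        rcases hq with hq | hq
        · simp at hq; linarith
        · exact hq.2
    | succ m ih =>
      intro σ' hR h11 h10 hu q hq
      have e : t + ((m + 1) * (trialCost k n T + 3) + 1) =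
          (t + (m * (trialCost k n T + 3) + 1) + 1) + trialCost k n T + 1 + 1 := by ring
      rw [e]
      refine Wins.loop_true (by simp [BExpr.eval, NExpr.eval, h11]; omega) (Wins.seq ?_)
      set q₀ : ℝ := 1 - (1 - p) ^ m with hq₀
      have hq₀1 : q₀ ≤ 1 := by
        have : 0 ≤ (1 - p) ^ m := pow_nonneg (by linarith) _
        linarith
      have hstep : ∀ (q' : ℕ → (Fin T → Fin k → Fin n) → (Fin T → Fin k → Fin 2) → ℝ),
          (∀ τ u s, q' τ u s ≤ q₀ ∨ (q' τ u s ≤ 1 ∧ (lo - d ≤ σ'.real 8 0 ∨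
            lo ≤ J.freeEnergy T (Tensor.response T (β + τ + 1)
              (J.field τ (Tensor.seqOf u) (Tensor.seqOf s)))))) →
          Wins J S (trialProg ::
            .setNat 10 (.const 0) (.add (.cell 10 (.const 0)) (.const 1)) ::
            .loop (.natLt (.cell 10 (.const 0)) (.var 11)) body :: K, σ')
            ((t + (m * (trialCost k n T + 3) + 1) + 1) + trialCost k n T)
            ((∑ τ ∈ Finset.range T, ((∑ u, ∑ s, q' τ u s) / (2 * n) ^ (T * k))) / T) := by
        intro q' hq'
        refine wins_trialProg hn hβ q' hR ?_
        rintro σ'' τ u s hτ hF ⟨x, hx1, hx2, hx8⟩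
        refine Wins.of_step rfl ?_
        have hx := hd x _ hx1 (fun i => Tensor.abs_response_le _ _ _ i) hx2
        refine ih _ ?_ ?_ ?_ ?_ _ ?_
        · exact (hR.frame hF (by simp) (by simp) (by simp) (by simp)).frame
            ((Frame.refl {10} ∅ _).setNat (by simp) _ _) (by simp) (by simp) (by simp) (by simp)
        · rw [State.setNat_nat_ne _ (by decide), hF.1 11 (by simp), h11]
        · simp only [NExpr.eval, State.setNat_nat_same, if_true, hF.1 10 (by simp)]
          omega
        · rw [State.setNat_real, hx8]
          exact max_le hu (hup x hx1)
        · rw [State.setNat_real, hx8]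
          rcases hq' τ u s with h1 | ⟨h1, h2 | h2⟩
          · exact Or.inl h1
          · exact Or.inr ⟨h1, h2.trans (le_max_left _ _)⟩
          · exact Or.inr ⟨h1, le_trans (by linarith) (le_max_right _ _)⟩
      have hcard : (∑ _u : Fin T → Fin k → Fin n, ∑ _s : Fin T → Fin k → Fin 2, (1 : ℝ)) =
          (2 * n) ^ (T * k) := by
        simp only [Finset.sum_const, Finset.card_univ, Fintype.card_fun, Fintype.card_fin,
          nsmul_eq_mul, mul_one]
        push_cast
        rw [← pow_mul, ← pow_mul, mul_pow, mul_comm k T]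
        ring
      rcases hq with hq | ⟨hq, hlo⟩
      -- A good sample makes the remaining success certain, any other leaves q₀; the average is at
      -- least q₀ + (1 - q₀)p.
      · refine Wins.mono_prob (hstep (fun τ u s => q₀ + (1 - q₀) * (if lo ≤ J.freeEnergy T
          (Tensor.response T (β + τ + 1) (J.field τ (Tensor.seqOf u) (Tensor.seqOf s)))
          then 1 else 0)) fun τ u s => ?_) ?_
        · split_ifs with hg
          · exact Or.inr ⟨by linarith, Or.inr hg⟩
          · left; linarith
        · have e1 : ∀ τ : ℕ, (∑ u : Fin T → Fin k → Fin n, ∑ s : Fin T → Fin k → Fin 2,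
              (q₀ + (1 - q₀) * (if lo ≤ J.freeEnergy T
              (Tensor.response T (β + τ + 1) (J.field τ (Tensor.seqOf u) (Tensor.seqOf s)))
              then (1 : ℝ) else 0))) = q₀ * (2 * n) ^ (T * k) + (1 - q₀) *
              ∑ u : Fin T → Fin k → Fin n, ∑ s : Fin T → Fin k → Fin 2,
              (if lo ≤ J.freeEnergy T
              (Tensor.response T (β + τ + 1) (J.field τ (Tensor.seqOf u) (Tensor.seqOf s)))
              then (1 : ℝ) else 0) := by
            intro τ
            rw [← hcard]
            simp only [Finset.sum_add_distrib, Finset.mul_sum, mul_one]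
          simp only [e1]
          rw [← Finset.sum_div, Finset.sum_add_distrib, ← Finset.mul_sum, Finset.sum_const,
            Finset.card_range, nsmul_eq_mul, le_div_iff₀ hT, le_div_iff₀ (by positivity)]
          have h1 := mul_le_mul_of_nonneg_left hgood (sub_nonneg.2 hq₀1)
          have h2 : q ≤ q₀ + (1 - q₀) * p := by
            rw [hq₀]; rw [pow_succ] at hq; linarith
          rw [Finset.mul_sum] at h1
          have h3 := mul_le_mul_of_nonneg_right h2
            (by positivity : (0 : ℝ) ≤ T * (2 * n) ^ (T * k))
          linarith
      · refine Wins.mono_prob (hstep (fun _ _ _ => q) fun τ u s => Or.inr ⟨hq, Or.inl hlo⟩) ?_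
        have e1 : (∑ u : Fin T → Fin k → Fin n, ∑ s : Fin T → Fin k → Fin 2, q) =
            q * (2 * n) ^ (T * k) := by
          rw [← hcard]
          simp only [Finset.mul_sum, mul_one]
        rw [e1, mul_div_cancel_right₀ _ (by positivity), Finset.sum_const, Finset.card_range,
          nsmul_eq_mul, mul_div_cancel_left₀ _ hT.ne']
  have e : t + (N * (trialCost k n T + 3) + 3) = t + (N * (trialCost k n T + 3) + 1) + 1 + 1 := by
    ring
  rw [e]
  refine Wins.seq (Wins.of_step rfl ?_)
  simp only [NExpr.eval]
  refine key N _ ?_ (by simpa using hN) (by simp) (by simpa using h8) _ (Or.inl le_rfl)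
  exact hσ.frame ((Frame.refl {10} ∅ _).setNat (by simp) _ _) (by simp) (by simp) (by simp)
    (by simp)

end RealRAM

namespace RealRAM

variable {k n : ℕ}

/-! ### The parameters of the algorithm -/

/-- Find the least number `T` of rounds with `c ≤ T ε² Δ`. -/
def roundsProg (c : ℕ) : Prog k :=
  .seq (.setNat 3 (.const 0) (.const 0))
    (.loop (.realLt (.mul (.ofNat (.var 3))
      (.mul (.mul (.cell 0 (.const 0)) (.cell 0 (.const 0))) (.cell 0 (.const 2)))) (.ofNat (.const c)))
      (.setNat 3 (.const 0) (.add (.var 3) (.const 1))))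

theorem exec_roundsProg (J : Tensor k n) {c T : ℕ} {σ : State}
    (h1 : ∀ i < T, (i : ℝ) * (σ.real 0 0 * σ.real 0 0 * σ.real 0 2) < c)
    (h2 : (c : ℝ) ≤ T * (σ.real 0 0 * σ.real 0 0 * σ.real 0 2)) :
    Exec J (2 * T + 3) (roundsProg c) σ fun σ' => Frame {3} ∅ σ σ' ∧ σ'.nat 3 0 = T := by
  refine (Exec.seq_setNat (Exec.loop (fun i σ' => Frame {3} ∅ σ σ' ∧ σ'.nat 3 0 = i) T
    ?_ ?_ ?_ (B := 1))).mono (by omega) fun _ h => h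
  · exact ⟨(Frame.refl _ _ _).setNat (by simp) _ _, by simp [NExpr.eval]⟩
  · rintro i hi σ' ⟨hF, hc⟩
    refine ⟨?_, Exec.setNat J ⟨hF.setNat (by simp) _ _, by simp [NExpr.eval, hc]⟩⟩
    simp only [BExpr.eval, RExpr.eval, NExpr.eval, NExpr.eval_var, hc, hF.2 0 (by simp),
      decide_eq_true_eq]
    exact h1 i hi
  · rintro σ' ⟨hF, hc⟩
    simp only [BExpr.eval, RExpr.eval, NExpr.eval, NExpr.eval_var, hc, hF.2 0 (by simp),
      decide_eq_false_iff_not, not_lt]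
    exact h2

/-- The number of trials: `2 ^ (k T + 1)` times the number of halvings that lead from `1` to a
number that is at most `δ`. -/
def countProg : Prog k :=
  .seq (.setNat 14 (.const 0) (.const 1))
    (.seq (forN 12 0 (.add (.mul (.const k) (.var 3)) (.const 1))
      (.setNat 14 (.const 0) (.mul (.const 2) (.var 14))))
    (.seq (.setNat 15 (.const 0) (.const 0))
    (.seq (.setReal 10 (.const 0) (.ofNat (.const 1)))
    (.seq (.loop (.realLt (.cell 0 (.const 1)) (.var 10))
      (.seq (.setReal 10 (.const 0) (.div (.var 10) (.ofNat (.const 2))))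
        (.setNat 15 (.const 0) (.add (.var 15) (.const 1)))))
    (.setNat 11 (.const 0) (.mul (.var 14) (.var 15)))))))

theorem exec_countProg (J : Tensor k n) {T R : ℕ} {σ : State} (hT : σ.nat 3 0 = T)
    (h1 : ∀ i < R, σ.real 0 1 < 1 / 2 ^ i) (h2 : 1 / 2 ^ R ≤ σ.real 0 1) :
    Exec J (4 * (k * T) + 4 * R + 18) countProg σ fun σ' =>
      Frame {11, 12, 14, 15} {10} σ σ' ∧ σ'.nat 11 0 = 2 ^ (k * T + 1) * R := by
  refine (Exec.seq_setNat (Exec.seq (Exec.forN (fun m σ' => Frame {11, 12, 14, 15} {10} σ σ' ∧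
    σ'.nat 14 0 = 2 ^ m) (k * T + 1) ?_ ?_ ?_ (B := 1)) fun σ₁ ⟨hF₁, h14⟩ =>
    Exec.seq_setNat (Exec.seq_setReal (Exec.seq (Exec.loop (fun i σ' =>
      Frame {11, 12, 14, 15} {10} σ σ' ∧ σ'.nat 14 0 = 2 ^ (k * T + 1) ∧ σ'.nat 15 0 = i ∧
        σ'.real 10 0 = 1 / 2 ^ i) R ?_ ?_ ?_ (B := 3)) fun σ₂ ⟨hF₂, h14', h15, h10⟩ =>
      Exec.setNat J ?_)))).mono (by omega) fun _ h => h
  · exact ⟨((Frame.refl _ _ _).setNat (by simp) _ _).setNat (by simp) _ _, by simp [NExpr.eval]⟩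
  · rintro i - σ' ⟨hF, -⟩
    simp [NExpr.eval, hF.1 3 (by simp), hT]
  · rintro i - σ' ⟨hF, h14⟩ hc
    refine Exec.setNat J ⟨by simpa using hc, (hF.setNat (by simp) _ _).setNat (by simp) _ _, ?_⟩
    simp [NExpr.eval, h14, pow_succ, mul_comm]
  · refine ⟨(hF₁.setNat (by simp) _ _).setReal (by simp) _ _, by simpa using h14,
      by simp [NExpr.eval], by simp [NExpr.eval, RExpr.eval]⟩
  · rintro i hi σ' ⟨hF, h14', h15, h10⟩
    refine ⟨?_, (Exec.seq_setReal (Exec.setNat J ⟨(hF.setReal (by simp) _ _).setNat (by simp) _ _,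
      ?_, ?_, ?_⟩)).mono le_rfl fun _ h => h⟩
    · simp only [BExpr.eval, RExpr.eval, NExpr.eval, RExpr.eval_var, h10, hF.2 0 (by simp),
        decide_eq_true_eq]
      exact h1 i hi
    · simpa using h14'
    · simp [NExpr.eval, h15]
    · simp only [State.setNat_real, NExpr.eval, RExpr.eval, RExpr.eval_var,
        State.setReal_real_same, if_true, h10, Nat.cast_ofNat]
      rw [pow_succ, div_div]
  · rintro σ' ⟨hF, -, -, h10⟩
    simp only [BExpr.eval, RExpr.eval, NExpr.eval, RExpr.eval_var, h10, hF.2 0 (by simp),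
      decide_eq_false_iff_not, not_lt]
    exact h2
  · exact ⟨hF₂.setNat (by simp) _ _, by simp [NExpr.eval, h14', h15]⟩

/-- The `ℓ¹` norm of the tensor. -/
def normProg : Prog k :=
  .seq (.setReal 1 (.const 0) (.ofNat (.const 0)))
    (nest 13 (.ite (.realLt (.ofNat (.const 0)) (.probe fun j => .cell 13 (.const j)))
      (.setReal 1 (.const 0) (.add (.var 1) (.probe fun j => .cell 13 (.const j))))
      (.setReal 1 (.const 0) (.sub (.var 1) (.probe fun j => .cell 13 (.const j))))) k)

theorem exec_normProg (J : Tensor k n) (hn : 0 < n) {σ : State} (h0 : σ.nat 0 0 = n) :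
    Exec J (n ^ k * (2 + 6 * k) + 2) normProg σ fun σ' =>
      Frame {13} {1} σ σ' ∧ σ'.real 1 0 = J.l1Norm := by
  refine (Exec.seq_setReal (exec_nest_all (n := n) (R := {1}) (acc := 1) (b := 2)
    (f := fun u => |J u|) (by decide) (by simpa using h0) ?_ hn)).mono le_rfl ?_
  · intro σ' u hF hu
    have hp : (RExpr.probe fun j : Fin k => .cell 13 (.const j)).eval J σ' = J u :=
      probeValue_fin J _ u hu
    refine Exec.ite (fun ht => Exec.setReal J ⟨(Frame.refl _ _ _).setReal (by simp) _ _, ?_⟩)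
      (fun hf => Exec.setReal J ⟨(Frame.refl _ _ _).setReal (by simp) _ _, ?_⟩)
    · rw [BExpr.eval, hp, decide_eq_true_eq] at ht
      simp only [RExpr.eval, NExpr.eval, Nat.cast_zero] at ht
      rw [RExpr.eval, hp, abs_of_pos ht]
      simp [NExpr.eval]
    · rw [BExpr.eval, hp, decide_eq_false_iff_not, not_lt] at hf
      simp only [RExpr.eval, NExpr.eval, Nat.cast_zero] at hf
      rw [RExpr.eval, hp, abs_of_nonpos hf]
      simp [NExpr.eval, sub_eq_add_neg]
  · rintro σ' ⟨hF, h1⟩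
    refine ⟨((Frame.refl _ _ _).setReal (by simp) _ _).trans hF, ?_⟩
    rw [h1]
    simp [RExpr.eval, NExpr.eval, Tensor.l1Norm]

/-- The table of the truncated entropies of the points of the grid. -/
def tableProg : Prog k :=
  forN 8 0 gridSize
    (.seq (.setReal 3 (.var 8) (.ofNat (.const 0))) (.seq (.setReal 9 (.const 0) (.ofNat (.const 1)))
      (forN 7 0 (.var 3)
        (.seq (.setReal 9 (.const 0) (.mul (.var 9) (.mul (gridPoint (.var 8)) (gridPoint (.var 8)))))
          (.setReal 3 (.var 8) (.add (.cell 3 (.var 8))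
            (.div (.sub (.ofNat (.const 1)) (.var 9)) (.mul (.ofNat (.add (.mul (.const 2) (.var 7)) (.const 2)))
              (.ofNat (.add (.mul (.const 2) (.var 7)) (.const 1)))))))))))

theorem exec_tableProg (J : Tensor k n) {T : ℕ} {σ : State} (hT : σ.nat 3 0 = T) :
    Exec J ((2 * (T * T) + 1) * (6 * T + 10) + 3) tableProg σ fun σ' =>
      Frame {7, 8} {3, 9} σ σ' ∧ ∀ g ≤ 2 * (T * T),
        σ'.real 3 g = truncEntropy T ((g : ℝ) / ((T : ℝ) * T) - 1) := by
  have hgs : ∀ σ', Frame {7, 8} {3, 9} σ σ' → gridSize.eval σ' = 2 * (T * T) + 1 := by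
    intro σ' hF
    simp [gridSize, NExpr.eval, hF.1 3 (by simp), hT]
  refine (Exec.forN (fun m σ' => Frame {7, 8} {3, 9} σ σ' ∧ ∀ g < m,
    σ'.real 3 g = truncEntropy T ((g : ℝ) / ((T : ℝ) * T) - 1)) (2 * (T * T) + 1) ?_ ?_ ?_
    (B := 6 * T + 7)).mono (by rw [show 6 * T + 7 + 3 = 6 * T + 10 from rfl]) ?_
  · exact ⟨(Frame.refl _ _ _).setNat (by simp) _ _, by simp⟩
  · rintro m - σ' ⟨hF, -⟩
    exact hgs σ' hF
  · rintro g hg σ' ⟨hF, htab⟩ hc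
    have h3 : σ'.nat 3 0 = T := by rw [hF.1 3 (by simp), hT]
    refine (Exec.seq_setReal (Exec.seq_setReal (Exec.forN (fun m σ'' =>
      Frame {7} {3, 9} σ' σ'' ∧ (∀ g' < g, σ''.real 3 g' = σ'.real 3 g') ∧
      σ''.real 3 g = truncEntropy m ((g : ℝ) / ((T : ℝ) * T) - 1) ∧
      σ''.real 9 0 = ((g : ℝ) / ((T : ℝ) * T) - 1) ^ (2 * m)) T ?_ ?_ ?_ (B := 3)))).mono
      (by omega) ?_
    · refine ⟨(((Frame.refl _ _ _).setReal (by simp) _ _).setReal (by simp) _ _).setNat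
        (by simp) _ _, ?_, ?_, ?_⟩
      · intro g' hg'
        rw [State.setNat_real, State.setReal_real_ne _ (by decide), State.setReal_real_same,
          NExpr.eval_var, hc, if_neg hg'.ne]
      · rw [State.setNat_real, State.setReal_real_ne _ (by decide), State.setReal_real_same,
          NExpr.eval_var, hc, if_pos rfl]
        simp [truncEntropy, NExpr.eval, RExpr.eval]
      · simp [NExpr.eval, RExpr.eval]
    · rintro m - σ'' ⟨hF', -⟩
      rw [NExpr.eval_var, hF'.1 3 (by simp), h3]
    · rintro m - σ'' ⟨hF', hlt, hH, hq⟩ hc'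
      have h8 : σ''.nat 8 0 = g := by rw [hF'.1 8 (by simp), hc]
      have h3' : σ''.nat 3 0 = T := by rw [hF'.1 3 (by simp), h3]
      refine (Exec.seq_setReal (Exec.setReal J ⟨by simpa using hc',
        ((hF'.setReal (by simp) _ _).setReal (by simp) _ _).setNat (by simp) _ _, ?_, ?_, ?_⟩)).mono
        le_rfl fun _ h => h
      · intro g' hg'
        rw [State.setNat_real, State.setReal_real_same, NExpr.eval_var, State.setReal_nat, h8,
          if_neg hg'.ne, State.setReal_real_ne _ (by decide), hlt g' hg']
      · rw [State.setNat_real, State.setReal_real_same, NExpr.eval_var, State.setReal_nat, h8,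
          if_pos rfl, truncEntropy, Finset.sum_range_succ, ← truncEntropy]
        simp only [RExpr.eval, RExpr.eval_var, NExpr.eval, NExpr.eval_var, State.setReal_nat,
          State.setReal_real_same, if_true, eval_gridPoint J h3', h8, hc', hq]
        rw [State.setReal_real_ne _ (by decide), hH]
        push_cast
        ring
      · rw [State.setNat_real, State.setReal_real_ne _ (by decide), State.setReal_real_same]
        simp only [RExpr.eval, RExpr.eval_var, NExpr.eval, NExpr.eval_var, if_true,
          eval_gridPoint J h3', h8, hq]
        ring
    · rintro σ'' ⟨hF', hlt, hH, -⟩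
      refine ⟨by rw [hF'.1 8 (by simp), hc],
        (hF.trans (hF'.mono (by decide) (by decide))).setNat (by simp) _ _, ?_⟩
      intro g' hg'
      rw [State.setNat_real]
      rcases Nat.lt_succ_iff_lt_or_eq.1 hg' with h | h
      · rw [hlt g' h, htab g' h]
      · rw [h, hH]
  · rintro σ' ⟨hF, htab⟩
    exact ⟨hF, fun g hg => htab g (by omega)⟩

/-! ### The algorithm -/

/-- Compute the parameters and the table. -/
def setupProg (c : ℕ) : Prog k :=
  .seq (roundsProg c) (.seq countProg (.seq normProg
    -- The regularization β = εT‖J‖₁/(16n), chosen so that the initial potential βn costs ε‖J‖₁/16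
    -- per round.
    (.seq (.setReal 2 (.const 0) (.div (.mul (.mul (.cell 0 (.const 0)) (.ofNat (.var 3))) (.var 1))
      (.mul (.ofNat (.const 16)) (.ofNat (.var 0)))))
    -- The running maximum starts at -‖J‖₁, which never exceeds log Z.
    (.seq tableProg (.setReal 8 (.const 0) (.sub (.ofNat (.const 0)) (.var 1)))))))

/-- The number of steps of the preparation. -/
def setupCost (k n T R : ℕ) : ℕ :=
  2 * T + 4 * (k * T) + 4 * R + n ^ k * (2 + 6 * k) + (2 * (T * T) + 1) * (6 * T + 10) + 33

theorem exec_setupProg (J : Tensor k n) (hn : 0 < n) {c T R : ℕ} {ε δ Δ : ℝ}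
    (h1 : ∀ i < T, (i : ℝ) * (ε * ε * Δ) < c) (h2 : (c : ℝ) ≤ T * (ε * ε * Δ))
    (h3 : ∀ i < R, δ < 1 / 2 ^ i) (h4 : 1 / 2 ^ R ≤ δ) :
    Exec J (setupCost k n T R) (setupProg c) (State.init n ε δ Δ) fun σ =>
      Ready n T (ε * T * J.l1Norm / (16 * n)) σ ∧ σ.nat 11 0 = 2 ^ (k * T + 1) * R ∧
      σ.real 8 0 = -J.l1Norm := by
  set σ := State.init n ε δ Δ with hσ
  have i0 : σ.nat 0 0 = n := by simp [hσ, State.init]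
  have r0 : σ.real 0 0 = ε := by simp [hσ, State.init]
  have r1 : σ.real 0 1 = δ := by simp [hσ, State.init]
  have r2 : σ.real 0 2 = Δ := by simp [hσ, State.init]
  refine (Exec.seq (exec_roundsProg J (c := c) (T := T) (by rw [r0, r2]; exact h1)
    (by rw [r0, r2]; exact h2)) fun σ₁ ⟨hF₁, hT₁⟩ =>
    Exec.seq (exec_countProg J (R := R) hT₁ (by rw [hF₁.2 0 (by simp), r1]; exact h3)
      (by rw [hF₁.2 0 (by simp), r1]; exact h4)) fun σ₂ ⟨hF₂, hN₂⟩ =>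
    Exec.seq (exec_normProg J hn (by rw [hF₂.1 0 (by simp), hF₁.1 0 (by simp), i0]))
      fun σ₃ ⟨hF₃, hM₃⟩ => Exec.seq_setReal (Exec.seq (exec_tableProg J (T := T) (by
        rw [State.setReal_nat, hF₃.1 3 (by simp), hF₂.1 3 (by simp), hT₁]))
      fun σ₄ ⟨hF₄, htab⟩ => Exec.setReal J ⟨⟨?_, ?_, ?_, ?_⟩, ?_, ?_⟩)).mono
      (by rw [setupCost]; omega) fun _ h => h
  · simp only [State.setReal_nat]
    rw [hF₄.1 0 (by simp), State.setReal_nat, hF₃.1 0 (by simp), hF₂.1 0 (by simp),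
      hF₁.1 0 (by simp), i0]
  · simp only [State.setReal_nat]
    rw [hF₄.1 3 (by simp), State.setReal_nat, hF₃.1 3 (by simp), hF₂.1 3 (by simp), hT₁]
  · rw [State.setReal_real_ne _ (by decide), hF₄.2 2 (by simp), State.setReal_real_same]
    simp only [RExpr.eval, NExpr.eval, RExpr.eval_var, NExpr.eval_var, if_true, hM₃,
      hF₃.1 0 (by simp), hF₂.1 0 (by simp), hF₁.1 0 (by simp), i0, hF₃.1 3 (by simp),
      hF₂.1 3 (by simp), hT₁, hF₃.2 0 (by simp), hF₂.2 0 (by simp), hF₁.2 0 (by simp), r0]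
    norm_num
  · intro g hg
    rw [State.setReal_real_ne _ (by decide), htab g hg]
  · rw [State.setReal_nat, hF₄.1 11 (by simp), State.setReal_nat, hF₃.1 11 (by simp), hN₂]
  · simp only [RExpr.eval, NExpr.eval, RExpr.eval_var, State.setReal_real_same, if_true]
    rw [hF₄.2 1 (by simp), State.setReal_real_ne _ (by decide), hM₃]
    simp

/-- The algorithm: for `ε < 1` the best value of many trials, and `0` otherwise. -/
def meanFieldProg (c : ℕ) : Prog k :=
  .ite (.realLt (.cell 0 (.const 0)) (.ofNat (.const 1)))
    (.seq (setupProg c) (.seq trialsProg (.setReal 0 (.const 0) (.var 8))))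
    (.setReal 0 (.const 0) (.ofNat (.const 0)))

/-- The number of steps of the algorithm. -/
def totalCost (k n T R : ℕ) : ℕ :=
  setupCost k n T R + (2 ^ (k * T + 1) * R * (trialCost k n T + 3)) + 7

theorem wins_meanFieldProg_of_one_le (J : Tensor k n) (c : ℕ) {ε δ Δ : ℝ} (hε : 1 ≤ ε)
    {S : Set ℝ} (hS : (0 : ℝ) ∈ S) :
    Wins J S ([meanFieldProg c], State.init n ε δ Δ) 2 1 := by
  refine Wins.of_step (c' := ([.setReal 0 (.const 0) (.ofNat (.const 0))], State.init n ε δ Δ))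
    ?_ (Wins.of_step rfl (Wins.halted J fun _ => ⟨le_rfl, ?_⟩))
  · rw [meanFieldProg, step, if_neg]
    simpa [BExpr.eval, RExpr.eval, NExpr.eval, State.init] using hε
  · simpa [State.output, RExpr.eval, NExpr.eval] using hS

theorem wins_meanFieldProg {J : Tensor k n} (hn : 0 < n) {c T R : ℕ} [NeZero T] {ε δ Δ : ℝ}
    (hε0 : 0 ≤ ε) (hε : ε < 1) (h1 : ∀ i < T, (i : ℝ) * (ε * ε * Δ) < c)
    (h2 : (c : ℝ) ≤ T * (ε * ε * Δ)) (h3 : ∀ i < R, δ < 1 / 2 ^ i) (h4 : 1 / 2 ^ R ≤ δ)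
    {lo up p d : ℝ} (hp1 : p ≤ 1)
    (hd : ∀ x y : Fin n → ℝ, (∀ i, |x i| ≤ 1) → (∀ i, |y i| ≤ 1) →
      (∀ i, |x i - y i| ≤ 1 / ((T : ℝ) * T)) → J.freeEnergy T y - d ≤ J.freeEnergy T x)
    (hup : ∀ x : Fin n → ℝ, (∀ i, |x i| ≤ 1) → J.freeEnergy T x ≤ up)
    (hgood : p * (T * (2 * n) ^ (T * k)) ≤
      ∑ τ ∈ Finset.range T, ∑ u : Fin T → Fin k → Fin n, ∑ s : Fin T → Fin k → Fin 2,
        if lo ≤ J.freeEnergy T (Tensor.response T (ε * T * J.l1Norm / (16 * n) + τ + 1)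
          (J.field τ (Tensor.seqOf u) (Tensor.seqOf s))) then 1 else 0)
    (h8 : -J.l1Norm ≤ up) {S : Set ℝ} (hS : ∀ y, lo - d ≤ y → y ≤ up → y ∈ S) :
    Wins J S ([meanFieldProg c], State.init n ε δ Δ) (totalCost k n T R)
      (1 - (1 - p) ^ (2 ^ (k * T + 1) * R)) := by
  have hβ : 0 ≤ ε * T * J.l1Norm / (16 * n) := by
    have := J.l1Norm_nonneg
    positivity
  have e : totalCost k n T R = setupCost k n T R +
      ((1 + (2 ^ (k * T + 1) * R * (trialCost k n T + 3) + 3)) + 1) + 1 + 1 := by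
    rw [totalCost]; ring
  rw [e]
  refine Wins.of_step (c' := ([.seq (setupProg c) (.seq trialsProg
    (.setReal 0 (.const 0) (.var 8)))], State.init n ε δ Δ)) ?_ (Wins.seq (Wins.exec
      (exec_setupProg J hn h1 h2 h3 h4) fun σ ⟨hR, hN, hB⟩ => Wins.seq ?_))
  · rw [meanFieldProg, step, if_pos]
    simpa [BExpr.eval, RExpr.eval, NExpr.eval, State.init] using hε
  · refine wins_trialsProg hn hβ hR hN hp1 hd hup hgood (by rw [hB]; exact h8) ?_
    intro σ' q hle hq1 hq
    refine Wins.of_step (t := 0) rfl (Wins.halted J fun hq0 => ⟨hq1, ?_⟩)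
    have : (σ'.setReal 0 ((NExpr.const 0).eval σ') ((RExpr.var 8 : RExpr k).eval J σ')).output =
        σ'.real 8 0 := by simp [State.output, NExpr.eval]
    rw [this]
    exact hS _ (hq hq0) hle

end RealRAM

namespace RealRAM

variable {k n : ℕ}

/-! ### Running time and number of trials -/

/-- Each monomial of the cost without the factor 2^(kT+1) divides `W`, and is hence at most `W`; the
rest is adding up coefficients. -/
theorem totalCost_le {k n T R : ℕ} (hk : 0 < k) (hn : 0 < n) (hT : 0 < T) (hR : 0 < R) :
    totalCost k n T R ≤ 2 ^ (k * T + 1) * (185 * (R * n ^ k * (k * T ^ 3))) := by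
  set W := R * n ^ k * (k * T ^ 3) with hW
  have hW0 : 0 < W := by positivity
  obtain ⟨m, rfl⟩ : ∃ m, k = m + 1 := ⟨k - 1, by omega⟩
  have m1 : 1 ≤ W := hW0
  have mT : T ≤ W := Nat.le_of_dvd hW0 ⟨R * n ^ (m + 1) * ((m + 1) * T ^ 2), by rw [hW]; ring⟩
  have mT2 : T * T ≤ W := Nat.le_of_dvd hW0 ⟨R * n ^ (m + 1) * ((m + 1) * T), by rw [hW]; ring⟩
  have mT3 : T * T * T ≤ W := Nat.le_of_dvd hW0 ⟨R * n ^ (m + 1) * (m + 1), by rw [hW]; ring⟩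
  have mkT : (m + 1) * T ≤ W := Nat.le_of_dvd hW0 ⟨R * n ^ (m + 1) * T ^ 2, by rw [hW]; ring⟩
  have mR : R ≤ W := Nat.le_of_dvd hW0 ⟨n ^ (m + 1) * ((m + 1) * T ^ 3), by rw [hW]; ring⟩
  have mX : n ^ (m + 1) ≤ W := Nat.le_of_dvd hW0 ⟨R * ((m + 1) * T ^ 3), by rw [hW]; ring⟩
  have mXk : n ^ (m + 1) * (m + 1) ≤ W := Nat.le_of_dvd hW0 ⟨R * T ^ 3, by rw [hW]; ring⟩
  have mn : n ≤ W := Nat.le_of_dvd hW0 ⟨R * n ^ m * ((m + 1) * T ^ 3), by rw [hW]; ring⟩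
  have mnT : n * T ≤ W := Nat.le_of_dvd hW0 ⟨R * n ^ m * ((m + 1) * T ^ 2), by rw [hW]; ring⟩
  have mnT2 : n * (T * T) ≤ W := Nat.le_of_dvd hW0 ⟨R * n ^ m * ((m + 1) * T), by rw [hW]; ring⟩
  have h1 : setupCost (m + 1) n T R ≤ 99 * W := by
    have : (2 * (T * T) + 1) * (6 * T + 10) = 12 * (T * T * T) + 20 * (T * T) + 6 * T + 10 := by
      ring
    rw [setupCost, this, mul_add (n ^ (m + 1))]
    have e : n ^ (m + 1) * (6 * (m + 1)) = 6 * (n ^ (m + 1) * (m + 1)) := by ring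
    rw [e]
    omega
  -- without the factor `R`
  set V := n ^ (m + 1) * ((m + 1) * T ^ 3) with hV
  have hV0 : 0 < V := by positivity
  have v1 : 1 ≤ V := hV0
  have vkT : (m + 1) * T ≤ V := Nat.le_of_dvd hV0 ⟨n ^ (m + 1) * T ^ 2, by rw [hV]; ring⟩
  have vX : n ^ (m + 1) ≤ V := Nat.le_of_dvd hV0 ⟨(m + 1) * T ^ 3, by rw [hV]⟩
  have vXk : n ^ (m + 1) * (m + 1) ≤ V := Nat.le_of_dvd hV0 ⟨T ^ 3, by rw [hV]; ring⟩
  have vn : n ≤ V := Nat.le_of_dvd hV0 ⟨n ^ m * ((m + 1) * T ^ 3), by rw [hV]; ring⟩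
  have vnT : n * T ≤ V := Nat.le_of_dvd hV0 ⟨n ^ m * ((m + 1) * T ^ 2), by rw [hV]; ring⟩
  have vnT2 : n * (T * T) ≤ V := Nat.le_of_dvd hV0 ⟨n ^ m * ((m + 1) * T), by rw [hV]; ring⟩
  have h2 : trialCost (m + 1) n T + 3 ≤ 79 * V := by
    have e1 : n * (4 * T + 10 * (T * T) + 23) = 4 * (n * T) + 10 * (n * (T * T)) + 23 * n := by ring
    have e2 : n ^ (m + 1) * (1 + 6 * (m + 1)) = n ^ (m + 1) + 6 * (n ^ (m + 1) * (m + 1)) := by ring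
    have e3 : 6 * (T * (m + 1)) = 6 * ((m + 1) * T) := by ring
    rw [trialCost, e1, e2, e3]
    omega
  have h3 : 1 ≤ 2 ^ ((m + 1) * T + 1) := Nat.one_le_two_pow
  have h4 : 2 ^ ((m + 1) * T + 1) * R * (trialCost (m + 1) n T + 3) ≤
      2 ^ ((m + 1) * T + 1) * (79 * W) := by
    have e : 2 ^ ((m + 1) * T + 1) * (79 * W) = 2 ^ ((m + 1) * T + 1) * R * (79 * V) := by
      rw [hW, hV]; ring
    rw [e]
    exact Nat.mul_le_mul_left _ h2
  have h5 : 99 * W + 7 * W ≤ 2 ^ ((m + 1) * T + 1) * (106 * W) := by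
    calc 99 * W + 7 * W = 1 * (106 * W) := by ring
      _ ≤ _ := Nat.mul_le_mul_right _ h3
  have h6 : 2 ^ ((m + 1) * T + 1) * (185 * W) =
      2 ^ ((m + 1) * T + 1) * (106 * W) + 2 ^ ((m + 1) * T + 1) * (79 * W) := by ring
  rw [totalCost, h6]
  omega

theorem exists_least_rounds {y c : ℝ} (hy : 0 < y) :
    ∃ T : ℕ, (∀ i < T, (i : ℝ) * y < c) ∧ c ≤ T * y := by
  classical
  have h : ∃ T : ℕ, c ≤ T * y := by
    obtain ⟨T, hT⟩ := exists_nat_ge (c / y)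
    exact ⟨T, (div_le_iff₀ hy).1 hT⟩
  exact ⟨Nat.find h, fun i hi => not_le.1 (Nat.find_min h hi), Nat.find_spec h⟩

theorem exists_least_halvings {δ : ℝ} (h0 : 0 < δ) (h1 : δ < 1) :
    ∃ R : ℕ, 0 < R ∧ (∀ i < R, δ < 1 / 2 ^ i) ∧ 1 / 2 ^ R ≤ δ ∧
      (R : ℝ) ≤ 2 * (1 + Real.log (1 / δ)) := by
  classical
  have h : ∃ R : ℕ, 1 / 2 ^ R ≤ δ := by
    obtain ⟨R, hR⟩ := exists_pow_lt_of_lt_one h0 (by norm_num : (1 / 2 : ℝ) < 1)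
    exact ⟨R, by rw [← one_div_pow]; exact hR.le⟩
  have hmin : ∀ i < Nat.find h, δ < 1 / 2 ^ i := fun i hi => not_le.1 (Nat.find_min h hi)
  have hpos : 0 < Nat.find h := by
    rw [Nat.find_pos]; simpa using h1
  refine ⟨Nat.find h, hpos, hmin, Nat.find_spec h, ?_⟩
  obtain ⟨r, hr⟩ := Nat.exists_eq_add_of_le' hpos
  have h2 := hmin r (by omega)
  rw [hr]
  -- Minimality gives δ < 2^(-r) with r = R - 1, and log 2 > 1/2 then yields the bound.
  have h3 : (r : ℝ) * Real.log 2 ≤ Real.log (1 / δ) := by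
    rw [← Real.log_pow]
    refine Real.log_le_log (by positivity) ?_
    rw [le_div_iff₀ h0]
    rw [lt_div_iff₀ (by positivity)] at h2
    linarith
  have h4 := Real.log_two_gt_d9
  have h5 : (0 : ℝ) ≤ r := Nat.cast_nonneg r
  push_cast
  nlinarith

/-- The polynomial factors in T and k are absorbed into powers of two, leaving the exponent (k+3)T +
k + 10, which is linear in x. -/
theorem totalCost_le_timeBound {k n T R A : ℕ} (hk : 0 < k) (hn : 0 < n) (hT : 0 < T) (hR : 0 < R)
    {x δ : ℝ} (hx : 1 ≤ x) (hTx : (T : ℝ) ≤ 256 * k ^ 2 * x + 1)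
    (hRδ : (R : ℝ) ≤ 2 * (1 + Real.log (1 / δ)))
    (hA : (k + 3) * (256 * k ^ 2) + 2 * k + 13 ≤ A) :
    (totalCost k n T R : ℝ) ≤ timeBound A x δ n k := by
  have h1 : (totalCost k n T R : ℝ) ≤
      2 ^ (k * T + 1) * (185 * (R * (n : ℝ) ^ k * (k * (T : ℝ) ^ 3))) := by
    exact_mod_cast totalCost_le hk hn hT hR
  have hT2 : (T : ℝ) ≤ 2 ^ T := by exact_mod_cast Nat.lt_two_pow_self.le
  have hk2 : (k : ℝ) ≤ 2 ^ k := by exact_mod_cast Nat.lt_two_pow_self.le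
  have hlog : 0 ≤ 1 + Real.log (1 / δ) := by
    have : (0 : ℝ) ≤ R := Nat.cast_nonneg R
    linarith
  have h2 : (2 : ℝ) ^ (k * T + 1) * (185 * (R * (n : ℝ) ^ k * (k * (T : ℝ) ^ 3))) ≤
      2 ^ (k * T + 1) * (2 ^ 8 * (2 * (1 + Real.log (1 / δ)) * (n : ℝ) ^ k *
        (2 ^ k * (2 ^ T) ^ 3))) := by
    gcongr
    norm_num
  have h3 : (2 : ℝ) ^ (k * T + 1) * (2 ^ 8 * (2 * (1 + Real.log (1 / δ)) * (n : ℝ) ^ k *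
        (2 ^ k * (2 ^ T) ^ 3))) =
      2 ^ ((k + 3) * T + k + 10) * (1 + Real.log (1 / δ)) * (n : ℝ) ^ k := by
    rw [← pow_mul]; ring
  -- Since x ≥ 1 and e < 3, the logarithmic factor of the time bound is at least 1, and no more is
  -- used of it.
  have hl : 1 ≤ Real.log (2 + x) := by
    rw [Real.le_log_iff_exp_le (by linarith)]
    linarith [Real.exp_one_lt_d9]
  have h4 : (((k + 3) * T + k + 10 : ℕ) : ℝ) ≤ (A : ℝ) * (1 + x * Real.log (2 + x) ^ A) := by
    have h5 : x ≤ x * Real.log (2 + x) ^ A :=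
      le_mul_of_one_le_right (by linarith) (one_le_pow₀ hl)
    have h6 : (((k + 3) * (256 * k ^ 2) + 2 * k + 13 : ℕ) : ℝ) ≤ A := by exact_mod_cast hA
    push_cast at h6 ⊢
    have h7 : ((k : ℝ) + 3) * T ≤ (k + 3) * (256 * k ^ 2 * x + 1) := by gcongr
    have h8 : ((k : ℝ) + 3) * (256 * k ^ 2 * x + 1) + k + 10 ≤
        ((k + 3) * (256 * k ^ 2) + 2 * k + 13) * (1 + x) := by
      have : 0 ≤ ((k : ℝ) + 3) * (256 * k ^ 2) + (2 * k + 13) * x := by positivity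
      linarith
    have h9 : (((k : ℝ) + 3) * (256 * k ^ 2) + 2 * k + 13) * (1 + x) ≤
        (A : ℝ) * (1 + x * Real.log (2 + x) ^ A) := by gcongr
    linarith
  refine (h1.trans h2).trans ?_
  have h5 : (2 : ℝ) ^ ((k + 3) * T + k + 10) ≤
      (2 : ℝ) ^ ((A : ℝ) * (1 + x * Real.log (2 + x) ^ A)) := by
    rw [← Real.rpow_natCast]
    exact Real.rpow_le_rpow_of_exponent_le (by norm_num) h4
  rw [h3, timeBound]
  gcongr

/-- A block of 2^m trials fails with probability at most 1/e ≤ 1/2, and there are R blocks. -/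
theorem one_sub_pow_le {δ : ℝ} (m : ℕ) {R : ℕ} (h : 1 / 2 ^ R ≤ δ) :
    (1 - 1 / 2 ^ m : ℝ) ^ (2 ^ m * R) ≤ δ := by
  have h0 : (0 : ℝ) ≤ 1 - 1 / 2 ^ m := by
    rw [sub_nonneg, div_le_one (by positivity)]
    exact one_le_pow₀ (by norm_num)
  have h1 : (1 - 1 / 2 ^ m : ℝ) ^ (2 ^ m) ≤ 1 / 2 := by
    have h2 : (1 - 1 / 2 ^ m : ℝ) ≤ Real.exp (-(1 / 2 ^ m)) := Real.one_sub_le_exp_neg _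
    calc (1 - 1 / 2 ^ m : ℝ) ^ (2 ^ m) ≤ Real.exp (-(1 / 2 ^ m)) ^ (2 ^ m) :=
        pow_le_pow_left₀ h0 h2 _
      _ = Real.exp (-1) := by
        rw [← Real.exp_nat_mul]
        congr 1
        push_cast
        field_simp
      _ ≤ 1 / 2 := by
        rw [Real.exp_neg, one_div]
        exact inv_anti₀ (by norm_num) (by linarith [Real.exp_one_gt_d9])
  rw [pow_mul]
  calc ((1 - 1 / 2 ^ m : ℝ) ^ (2 ^ m)) ^ R ≤ (1 / 2) ^ R :=
      pow_le_pow_left₀ (pow_nonneg h0 _) h1 _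
    _ = 1 / 2 ^ R := one_div_pow _ _
    _ ≤ δ := h

end RealRAM

/-! ### Estimates for the constants -/

/-- Of the exponential lower bound on n only the quadratic Taylor term is needed; 6/25 is a lower
bound of (log 2)²/2. -/
theorem natCast_ge_of_two_rpow_le {n : ℕ} {c x : ℝ} (hx : 0 ≤ c * x)
    (h : (2 : ℝ) ^ (c * x) ≤ n) : (c * x) ^ 2 * (6 / 25) ≤ n ∧ 1 ≤ (n : ℝ) := by
  rw [Real.rpow_def_of_pos (by norm_num)] at h
  have h1 : (0 : ℝ) ≤ Real.log 2 * (c * x) := by positivity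
  have h2 := Real.quadratic_le_exp_of_nonneg h1
  have h3 : (693 / 1000 : ℝ) ≤ Real.log 2 := by linarith [Real.log_two_gt_d9]
  have h4 : (c * x) ^ 2 * (12 / 25) ≤ (Real.log 2 * (c * x)) ^ 2 := by
    have h5 : (12 / 25 : ℝ) ≤ Real.log 2 ^ 2 := by nlinarith
    rw [mul_pow]
    linarith [mul_le_mul_of_nonneg_right h5 (sq_nonneg (c * x))]
  constructor <;> linarith [sq_nonneg (Real.log 2 * (c * x))]

theorem inv_sq_mul_bounds {ε Δ x : ℝ} (hε : 0 < ε) (hε1 : ε ≤ 1) (hΔ : 0 < Δ) (hΔ1 : Δ ≤ 1)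
    (hx : x = 1 / (ε ^ 2 * Δ)) : 1 ≤ ε * x ∧ 1 ≤ ε * Δ * x := by
  constructor
  · have : ε * x = 1 / (ε * Δ) := by rw [hx]; field_simp
    rw [this, le_div_iff₀ (by positivity), one_mul]
    exact mul_le_one₀ hε1 hΔ.le hΔ1
  · have : ε * Δ * x = 1 / ε := by rw [hx]; field_simp
    rw [this, le_div_iff₀ hε, one_mul]
    exact hε1

/-- The kT bits that describe the signs are negligible against εn. -/
theorem mul_rounds_le {k ε x T n : ℝ} (hx : 0 ≤ x) (hk : 3 ≤ k) (hε : 0 < ε) (hεx : 1 ≤ ε * x)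
    (hT : T ≤ 257 * k ^ 2 * x) (hn : 9600 * k ^ 4 * x ^ 2 ≤ n) : k * T ≤ ε * n / 16 := by
  have h1 : k * T ≤ k * (257 * k ^ 2 * x) := by gcongr
  have h2 : ε * (9600 * k ^ 4 * x ^ 2) ≤ ε * n := by gcongr
  have h3 : 9600 * k ^ 4 * x * 1 ≤ 9600 * k ^ 4 * x * (ε * x) := by gcongr
  have h4 : 3 * (k ^ 3 * x) ≤ k * (k ^ 3 * x) := by gcongr
  have h5 : 0 ≤ k ^ 3 * x := by positivity
  linarith

theorem density_error_le {k ε Δ x n M : ℝ} (hM : 0 ≤ M) (hk : 3 ≤ k) (hΔ : 0 < Δ) (hε : 0 < ε)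
    (hn0 : 0 < n) (hx : 1 ≤ x) (hx' : 1 ≤ ε * Δ * x) (hn : 9600 * k ^ 4 * x ^ 2 ≤ n) :
    2 * k ^ 2 * M / (Δ * n) ≤ ε * M / 16 := by
  have hk2 : 1 ≤ k ^ 2 := one_le_pow₀ (by linarith)
  rw [div_le_iff₀ (by positivity)]
  have h1 : ε * Δ * (9600 * k ^ 4 * x ^ 2) ≤ ε * Δ * n := by gcongr
  have h2 : 9600 * k ^ 4 * x * 1 ≤ 9600 * k ^ 4 * x * (ε * Δ * x) := by gcongr
  have h3 : k ^ 2 * 1 * 1 ≤ k ^ 2 * k ^ 2 * x := by gcongr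
  have h4 : 32 * k ^ 2 ≤ ε * Δ * n := by linarith
  linarith [mul_le_mul_of_nonneg_right h4 hM]

namespace Tensor

variable {k n : ℕ}

/-- The loss from replacing the exact response by a grid point. -/
theorem freeEnergy_sub_le (J : Tensor k n) (L : ℕ) {x y : Fin n → ℝ} (hx : ∀ i, |x i| ≤ 1)
    (hy : ∀ i, |y i| ≤ 1) {d : ℝ} (hd : ∀ i, |x i - y i| ≤ d) :
    J.freeEnergy L y - (k * J.l1Norm * d + n * (L * d)) ≤ J.freeEnergy L x := by
  have h1 := (_root_.abs_le.1 (J.abs_meanEnergy_sub_le hx hy hd)).1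
  have h2 : ∑ i, (truncEntropy L (y i) - truncEntropy L (x i)) ≤ ∑ _i : Fin n, L * d := by
    refine Finset.sum_le_sum fun i _ => ?_
    have h3 := (_root_.abs_le.1 (abs_truncEntropy_sub_le L (hx i) (hy i))).1
    have h4 : (L : ℝ) * |x i - y i| ≤ L * d := by gcongr; exact hd i
    linarith
  rw [Finset.sum_sub_distrib] at h2
  simp only [Finset.sum_const, Finset.card_univ, Fintype.card_fin, nsmul_eq_mul] at h2
  rw [freeEnergy, freeEnergy]
  linarith

theorem freeEnergy_le {J : Tensor k n} {Δ : ℝ} (h : J.IsDense Δ) (hΔ : 0 < Δ) (hn : 0 < n)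
    (L : ℕ) {x : Fin n → ℝ} (hx : ∀ i, |x i| ≤ 1) :
    J.freeEnergy L x ≤ Real.log J.partitionFunction + 2 * k ^ 2 * J.l1Norm / (Δ * n) := by
  have h1 := meanEnergy_add_spinEntropy_le h hΔ hn hx
  have h2 := Finset.sum_le_sum fun i (_ : i ∈ Finset.univ) => truncEntropy_le_spinEntropy L (hx i)
  rw [freeEnergy]
  linarith

theorem abs_log_partitionFunction_le (J : Tensor k n) :
    |Real.log J.partitionFunction| ≤ J.l1Norm + n ∧ -J.l1Norm ≤ Real.log J.partitionFunction := by
  have h1 := _root_.abs_le.1 J.abs_log_partitionFunction_sub_le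
  have h2 := Real.log_two_gt_d9
  have h3 := Real.log_two_lt_d9
  have h4 : (0 : ℝ) ≤ n := Nat.cast_nonneg n
  have h5 := J.l1Norm_nonneg
  have h6 : n * Real.log 2 ≤ n := mul_le_of_le_one_right h4 (by linarith)
  have h7 : 0 ≤ n * Real.log 2 := mul_nonneg h4 (by linarith)
  refine ⟨_root_.abs_le.2 ⟨?_, ?_⟩, ?_⟩ <;> linarith [h1.1, h1.2]

end Tensor

end

/-! ### The main theorem -/

set_option maxHeartbeats 2000000 in
theorem mainTheorem3 (k : ℕ) (hk : 3 ≤ k) :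
    ∃ (C : ℝ) (A : ℕ) (P : RealRAM.Prog k), 0 < C ∧
      ∀ ε δ Δ : ℝ, 0 < ε → 0 < δ → δ < 1 → 0 < Δ → Δ ≤ 1 →
        ∀ (n : ℕ) (J : Tensor k n), (2 : ℝ) ^ (C / (ε ^ 2 * Δ)) ≤ (n : ℝ) → J.IsDense Δ →
          ∃ T : ℕ, (T : ℝ) ≤ timeBound A (1 / (ε ^ 2 * Δ)) δ n k ∧
            RealRAM.HaltsWithin P J ε δ Δ T ∧
            ENNReal.ofReal (1 - δ) ≤ RealRAM.outputProb P J ε δ Δ T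
              {y | |y - Real.log J.partitionFunction| ≤ ε * (J.l1Norm + n)} := by
  have hk0 : 0 < k := by omega
  have hk' : (3 : ℝ) ≤ k := by exact_mod_cast hk
  -- The number of rounds is the least T with Tε²Δ ≥ 256k². The constant C = 200k² yields n ≥
  -- 9600k⁴x², as 200²·6/25 = 9600.
  refine ⟨200 * k ^ 2, (k + 3) * (256 * k ^ 2) + 2 * k + 13, RealRAM.meanFieldProg (256 * k ^ 2),
    by positivity, ?_⟩
  intro ε δ Δ hε hδ hδ1 hΔ hΔ1 n J hn hJ
  set x : ℝ := 1 / (ε ^ 2 * Δ) with hx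
  have hx0 : 0 < x := by positivity
  rw [← mul_one_div, ← hx] at hn
  obtain ⟨hnx, hn1⟩ := natCast_ge_of_two_rpow_le (by positivity) hn
  have hn0 : 0 < n := by exact_mod_cast lt_of_lt_of_le one_pos hn1
  set S : Set ℝ := {y | |y - Real.log J.partitionFunction| ≤ ε * (J.l1Norm + n)} with hS
  set M := J.l1Norm with hM
  have hM0 : 0 ≤ M := J.l1Norm_nonneg
  obtain ⟨hZ1, hZ2⟩ := J.abs_log_partitionFunction_le
  -- it suffices to bound the probability of success as a real number
  suffices h : ∃ (t : ℕ) (q : ℝ), (t : ℝ) ≤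
      timeBound ((k + 3) * (256 * k ^ 2) + 2 * k + 13) x δ n k ∧ 1 - δ ≤ q ∧
      RealRAM.Wins J S ([RealRAM.meanFieldProg (256 * k ^ 2)], RealRAM.State.init n ε δ Δ) t q by
    obtain ⟨t, q, ht, hq, hW⟩ := h
    refine ⟨t, ht, hW.1, ?_⟩
    refine ENNReal.ofReal_le_of_le_toReal (hq.trans ?_)
    exact hW.2
  -- For ε ≥ 1 the output 0 is accurate enough, because |log Z| ≤ ‖J‖₁ + n.
  by_cases hε1 : 1 ≤ ε
  · refine ⟨2, 1, ?_, by linarith, RealRAM.wins_meanFieldProg_of_one_le J _ hε1 ?_⟩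
    · have h1 : (0 : ℝ) ≤ Real.log (1 / δ) := Real.log_nonneg (by rw [le_div_iff₀ hδ]; linarith)
      have h2 : (1 : ℝ) ≤ (n : ℝ) ^ k := one_le_pow₀ hn1
      have h3 : (2 : ℝ) ≤ 2 ^ (((((k + 3) * (256 * k ^ 2) + 2 * k + 13 : ℕ) : ℝ)) *
          (1 + x * Real.log (2 + x) ^ ((k + 3) * (256 * k ^ 2) + 2 * k + 13))) := by
        have h4 : (0 : ℝ) ≤ Real.log (2 + x) := Real.log_nonneg (by linarith)
        conv_lhs => rw [← Real.rpow_one 2]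
        refine Real.rpow_le_rpow_of_exponent_le (by norm_num) ?_
        refine one_le_mul_of_one_le_of_one_le ?_ ?_
        · exact_mod_cast (by omega : 1 ≤ (k + 3) * (256 * k ^ 2) + 2 * k + 13)
        · have : 0 ≤ x * Real.log (2 + x) ^ ((k + 3) * (256 * k ^ 2) + 2 * k + 13) := by positivity
          linarith
      rw [timeBound]
      push_cast at h3 ⊢
      calc (2 : ℝ) = 2 * 1 * 1 := by norm_num
        _ ≤ _ := by gcongr; linarith
    · rw [hS, Set.mem_ofPred_eq, zero_sub, abs_neg]
      refine hZ1.trans ?_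
      exact le_mul_of_one_le_left (by positivity) hε1
  rw [not_le] at hε1
  have hx1 : 1 ≤ x := by
    rw [hx, le_div_iff₀ (by positivity), one_mul]
    exact mul_le_one₀ (pow_le_one₀ hε.le hε1.le) hΔ.le hΔ1
  have hxy : x * (ε * ε * Δ) = 1 := by rw [hx]; field_simp
  have hy : 0 < ε * ε * Δ := by positivity
  obtain ⟨T, hT1, hT2⟩ := RealRAM.exists_least_rounds (c := ((256 * k ^ 2 : ℕ) : ℝ)) hy
  obtain ⟨R, hR0, hR1, hR2, hR3⟩ := RealRAM.exists_least_halvings hδ hδ1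
  push_cast at hT2
  have hT0 : 0 < T := by
    rcases Nat.eq_zero_or_pos T with h | h
    · rw [h, Nat.cast_zero, zero_mul] at hT2
      have : (0 : ℝ) < 256 * k ^ 2 := by positivity
      linarith
    · exact h
  have : NeZero T := ⟨hT0.ne'⟩
  have hT' : (0 : ℝ) < T := by exact_mod_cast hT0
  have hn' : (0 : ℝ) < n := by exact_mod_cast hn0
  have hTx : (T : ℝ) ≤ 256 * k ^ 2 * x + 1 := by
    have h1 := hT1 (T - 1) (by omega)
    rw [Nat.cast_sub hT0] at h1
    push_cast at h1
    nlinarith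
  have hTx' : (T : ℝ) ≤ 257 * k ^ 2 * x := by nlinarith
  have hnb : 9600 * k ^ 4 * x ^ 2 ≤ (n : ℝ) := by
    have : (200 * (k : ℝ) ^ 2 * x) ^ 2 * (6 / 25) = 9600 * k ^ 4 * x ^ 2 := by ring
    linarith
  have hkT := mul_rounds_le (by linarith) hk' hε (inv_sq_mul_bounds hε hε1.le hΔ hΔ1 hx).1 hTx' hnb
  have he2 := density_error_le hM0 hk' hΔ hε hn' hx1 (inv_sq_mul_bounds hε hε1.le hΔ hΔ1 hx).2 hnb
  have hTy : 256 * (k : ℝ) ^ 2 ≤ T * ε :=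
    hT2.trans (by
      gcongr
      rw [mul_assoc]
      exact mul_le_of_le_one_right hε.le (mul_le_one₀ hε1.le hΔ.le hΔ1))
  have hTε : (16 : ℝ) * k ≤ T * ε := by nlinarith
  have hnT : (n : ℝ) / T ≤ ε * n / 16 := by
    rw [div_le_iff₀ hT']
    have h1 : (16 : ℝ) ≤ T * ε := by linarith
    linarith [mul_le_mul_of_nonneg_right h1 hn'.le]
  have hT1' : (1 : ℝ) ≤ T := by exact_mod_cast hT0
  set β : ℝ := ε * T * M / (16 * n) with hβ
  have hβ0 : 0 ≤ β := by positivity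
  have hβn : β * n = T * (ε * M / 16) := by rw [hβ]; field_simp
  -- The truncation order is T. The per-round second-order error is B = εM/16, and θ gives equality
  -- in 2(e₁ + e₂) = θ + e₂.
  have hgood := Tensor.card_good_ge hk0 hn0 hJ hΔ (L := T) hT0 hβ0 (B := ε * M / 16)
    (by positivity) ?_ T (e₁ := ε * (M + n) / 7) (e₂ := ε * M / 16)
    (θ := 2 * (ε * (M + n) / 7) + ε * M / 16) ?_ he2 (by linarith) (by positivity)
  rotate_left
  · rw [div_le_iff₀ (by positivity), ← hM, hβ]
    -- Here Bβ = ε²TM²/(256n), so the variance condition is exactly Tε²Δ ≥ 256k².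
    have h1 : ε * M / 16 * (ε * T * M / (16 * n)) * (Δ * n) = M ^ 2 * (T * (ε * ε * Δ)) / 256 := by
      field_simp; norm_num
    rw [h1]
    nlinarith [sq_nonneg M]
  · have h1 : (β + T) * (k * T + n / T) ≤ (β + T) * (ε * n / 8) := by
      gcongr
      linarith
    have h2 : (β + T) * (ε * n / 8) = T * (ε * (ε * M / 128) + ε * n / 8) := by
      have : (β + T) * (ε * n / 8) = β * n * (ε / 8) + T * (ε * n / 8) := by ring
      rw [this, hβn]; ring
    have h3 : ε * (ε * M / 128) ≤ ε * M / 128 := by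
      have : 0 ≤ ε * M / 128 := by positivity
      nlinarith
    -- The coefficients of εM add up to 1/128 + 1/16 + 1/16 and that of εn is 1/8, all below 1/7.
    have h4 : (T : ℝ) * (ε * (ε * M / 128) + ε * n / 8) + T * (ε * M / 16) + T * (ε * M / 16) ≤
        T * (ε * (M + n) / 7) := by
      rw [← mul_add, ← mul_add]
      gcongr
      have : 0 ≤ ε * M := by positivity
      have : 0 ≤ ε * n := by positivity
      linarith
    linarith
  refine ⟨RealRAM.totalCost k n T R, _, RealRAM.totalCost_le_timeBound hk0 hn0 hT0 hR0 hx1 hTx hR3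
    le_rfl, ?_, RealRAM.wins_meanFieldProg hn0 hε.le hε1 hT1 (by push_cast; exact hT2) hR1 hR2
    (p := 1 / 2 ^ (k * T + 1)) (d := k * M * (1 / ((T : ℝ) * T)) + n * (T * (1 / ((T : ℝ) * T))))
    (lo := Real.log J.partitionFunction - (2 * (ε * (M + n) / 7) + ε * M / 16))
    (up := Real.log J.partitionFunction + ε * M / 16) ?_
    (fun a b ha hb hab => J.freeEnergy_sub_le T ha hb hab)
    (fun a ha => (Tensor.freeEnergy_le hJ hΔ hn0 T ha).trans (by linarith))
    (le_trans (le_of_eq ?_) hgood) ?_ ?_⟩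
  · have := RealRAM.one_sub_pow_le (k * T + 1) hR2
    linarith
  · rw [div_le_one (by positivity)]
    exact one_le_pow₀ (by norm_num)
  · simp only [Fintype.card_fun, Fintype.card_fin]
    push_cast
    rw [mul_pow, mul_comm T k, pow_succ, ← pow_mul]
    field_simp
  · have : 0 ≤ ε * M / 16 := by positivity
    linarith
  -- The grid width 1/T² makes the rounding loss at most ε(M + n)/16. Altogether the lower deviation
  -- is at most (2/7 + 1/8)ε(M + n).
  · intro y hlo hup
    have h1 : k * M * (1 / ((T : ℝ) * T)) ≤ ε * M / 16 := by
      rw [mul_one_div, div_le_iff₀ (by positivity)]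
      have h2 : 16 * (k : ℝ) * 1 ≤ T * ε * T := by gcongr
      linarith [mul_le_mul_of_nonneg_right h2 hM0]
    have h2 : n * (T * (1 / ((T : ℝ) * T))) ≤ ε * n / 16 := by
      have : n * (T * (1 / ((T : ℝ) * T))) = n / T := by field_simp
      rw [this]; exact hnT
    have h3 : 0 ≤ ε * M := by positivity
    have h4 : 0 ≤ ε * n := by positivity
    rw [hS, Set.mem_ofPred_eq, abs_le]
    constructor <;> linarith
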